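/- Let $B$ be a finite-dimensional smooth (Hausdorff) manifold, $G$ a Lie group with Lie algebra $\mathfrak g$, $\Xi:P\to B$ a smooth principal $G$-bundle (right action $p\cdot g$), and $\omega\in\Lambda^1(P;\mathfrak g)$ a principal connection form, with horizontal spaces $\mathscr H_p=\ker\omega_p$ and curvature $R=d\omega+\omega\wedge\omega$, i.e. $R(u,v)=d\omega(u,v)+[\omega(u),\omega(v)]$ (so $R(X,Y)=-\omega([X,Y])$ for horizontal vector fields $X,Y$). For a closed loop $\gamma:[0,1]\to B$ and $p_0\in\Xi^{-1}(\gamma(0))$, the holonomy $\mathrm{Hol}(\gamma,p_0)\in G$ is the element $h$ such that the horizontal lift of $\gamma$ starting at $p_0$ ends at $p_0\cdot h$. (1) Let $\mathscr S$ be a disc given by a smooth map $f:\{z\in\mathbb C:|z|\le1\}\to B$ with boundary loop $\gamma(t)=f(e^{2\pi i t})$. Then $\mathrm{Hol}(\gamma,p_0)$ exists, is unique, and $$\mathrm{Hol}(\gamma,p_0)=\mathcal P\exp\Big(-\int_{\mathscr S}R\Big).$$ Here the right-hand side is defined as follows. Let $\Phi(r,t)\in P$, $(r,t)\in[0,1]^2$,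 be the lift of $f(re^{2\pi i t})$ that is horizontal along every radius $t=\mathrm{const}$, starts for all $t$ at one and the same point over the centre $f(0)$, and satisfies $\Phi(1,0)=p_0$. Put $R(t)=\int_0^1R_{\Phi(r,t)}(\partial_r\Phi,\partial_t\Phi)\,dr\in\mathfrak g$. Then $\mathcal P\exp(-\int_{\mathscr S}R):=g(1)$, where $g:[0,1]\to G$ is the solution of $g'(t)=-R(t)\,g(t)$ (right translation of $-R(t)$ to $g(t)$) with $g(0)=1$. (2) Let $G=(\mathbb R^{n+1},+)$. Then $R$ is the pull-back under $\Xi$ of a unique $\mathbb R^{n+1}$-valued two-form on $B$, again denoted by $R$. Let $\gamma:[0,1]\to B$ be any smooth closed loop and let $\mathscr S$ be any piecewise smooth oriented surface in $B$ bounded by $\gamma$, that is, a finite integral combination of smooth squares $[0,1]^2\to B$ whose oriented boundary is $\gamma$ up to cancelling an edge against its reverse and dropping constant edges. Then for every $p_0\in\Xi^{-1}(\gamma(0))$ the holonomy exists, is unique, and $$\mathrm{Hol}(\gamma,p_0)=-\int_{\mathscr S}R\in\mathbb R^{n+1},$$ a vertical displacement in the fibre: the horizontal lift of $\gamma$ from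 $p_0$ ends at $p_0$ translated by $-\int_{\mathscr S}R$. -/

import Mathlib

open scoped Manifold ContDiff
open Set

noncomputable section

/-! ### The additive group of a vector space as a Lie group

The translation group `(V, +)` of a normed space `V` is used in multiplicative notation, as
`Multiplicative V`, so that it can serve as the structure group of a principal bundle. -/

instance translationGroupChartedSpace (V : Type*) [NormedAddCommGroup V] :
    ChartedSpace V (Multiplicative V) :=
  inferInstanceAs (ChartedSpace V V)

instance translationGroupLieGroup (V : Type*) [NormedAddCommGroup V] [NormedSpace ℝ V] :
    LieGroup 𝓘(ℝ, V) ∞ (Multiplicative V) where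
  compatible := (inferInstance : IsManifold 𝓘(ℝ, V) ∞ V).compatible
  contMDiff_mul := (contMDiff_add 𝓘(ℝ, V) ∞ :
    ContMDiff (𝓘(ℝ, V).prod 𝓘(ℝ, V)) 𝓘(ℝ, V) ∞ fun p : V × V => p.1 + p.2)
  contMDiff_inv := (contMDiff_neg 𝓘(ℝ, V) ∞ : ContMDiff 𝓘(ℝ, V) 𝓘(ℝ, V) ∞ fun x : V => -x)

/-! ### Principal bundles and principal connections -/

section Bundle

variable {EB : Type*} [NormedAddCommGroup EB] [NormedSpace ℝ EB]
  {B : Type*} [TopologicalSpace B] [ChartedSpace EB B]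
  {EP : Type*} [NormedAddCommGroup EP] [NormedSpace ℝ EP]
  {P : Type*} [TopologicalSpace P] [ChartedSpace EP P]
  {EG : Type*} [NormedAddCommGroup EG] [NormedSpace ℝ EG]
  {G : Type*} [TopologicalSpace G] [ChartedSpace EG G] [Group G]

variable (EB B EP P EG G) in
/-- A smooth principal `G`-bundle `proj : P → B` with right action `act p g = p · g`: the action is
smooth, preserves the fibres, is free and transitive on each fibre, and there are smooth
`G`-equivariant local trivializations `proj⁻¹(U) ≃ U × G`. -/
structure PrincipalBundle where
  proj : P → B
  act : P → G → P
  contMDiff_proj : ContMDiff 𝓘(ℝ, EP) 𝓘(ℝ, EB) ∞ proj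
  contMDiff_act : ContMDiff (𝓘(ℝ, EP).prod 𝓘(ℝ, EG)) 𝓘(ℝ, EP) ∞ fun x : P × G => act x.1 x.2
  act_one : ∀ p, act p 1 = p
  act_mul : ∀ p g h, act p (g * h) = act (act p g) h
  proj_act : ∀ p g, proj (act p g) = proj p
  existsUnique_act : ∀ p q, proj p = proj q → ∃! g, act p g = q
  exists_trivialization : ∀ b : B, ∃ (U : Set B) (e : OpenPartialHomeomorph P (B × G)),
    IsOpen U ∧ b ∈ U ∧ e.source = proj ⁻¹' U ∧ e.target = U ×ˢ univ ∧
    ContMDiffOn 𝓘(ℝ, EP) (𝓘(ℝ, EB).prod 𝓘(ℝ, EG)) ∞ e e.source ∧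
    ContMDiffOn (𝓘(ℝ, EB).prod 𝓘(ℝ, EG)) 𝓘(ℝ, EP) ∞ e.symm e.target ∧
    (∀ p ∈ e.source, (e p).1 = proj p) ∧
    (∀ p ∈ e.source, ∀ g, e (act p g) = ((e p).1, (e p).2 * g))

variable (EG) in
/-- The adjoint representation `Ad g : 𝔤 → 𝔤`, the derivative at `1` of `x ↦ g x g⁻¹`. The model
space `EG` of `G` is by definition the underlying vector space of `𝔤 = T₁ G`. -/
def adjointAction (g : G) : EG →L[ℝ] EG :=
  mfderiv 𝓘(ℝ, EG) 𝓘(ℝ, EG) (fun x : G => g * x * g⁻¹) 1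

variable (G) in
/-- The Lie bracket of `𝔤 = T₁ G`, as an operation on the model space `EG`. -/
def structureBracket (X Y : EG) : EG :=
  (Bracket.bracket : GroupLieAlgebra 𝓘(ℝ, EG) G → GroupLieAlgebra 𝓘(ℝ, EG) G →
    GroupLieAlgebra 𝓘(ℝ, EG) G) X Y

variable [IsManifold 𝓘(ℝ, EP) ∞ P]

/-- A principal connection, given by its connection form: a smooth `𝔤`-valued one-form `ω` on `P`
with `R_g^* ω = Ad(g⁻¹) ω` which maps the fundamental vector field of `X ∈ 𝔤` to `X`. -/
structure PrincipalConnection (Q : PrincipalBundle EB B EP P EG G) where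
  form : ∀ p : P, TangentSpace 𝓘(ℝ, EP) p →L[ℝ] EG
  contMDiff_form : ContMDiff 𝓘(ℝ, EP).tangent 𝓘(ℝ, EG) ∞
    fun v : TangentBundle 𝓘(ℝ, EP) P => form v.proj v.snd
  form_act : ∀ (p : P) (g : G) (u : TangentSpace 𝓘(ℝ, EP) p),
    form (Q.act p g) (mfderiv 𝓘(ℝ, EP) 𝓘(ℝ, EP) (fun q : P => Q.act q g) p u) =
      adjointAction EG g⁻¹ (form p u)
  form_fundamental : ∀ (p : P) (X : EG),
    form (Q.act p 1) (mfderiv 𝓘(ℝ, EG) 𝓘(ℝ, EP) (fun g : G => Q.act p g) 1 X) = X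

namespace PrincipalConnection

variable {Q : PrincipalBundle EB B EP P EG G} (conn : PrincipalConnection Q)

/-- The connection form read in the chart of `P` at `p`, a one-form on (a subset of) `EP`. -/
def formInChart (p : P) (x : EP) : EP →L[ℝ] EG :=
  (conn.form ((extChartAt 𝓘(ℝ, EP) p).symm x)).comp
    (mfderiv 𝓘(ℝ, EP) 𝓘(ℝ, EP) (extChartAt 𝓘(ℝ, EP) p).symm x)

/-- The exterior derivative `dω` at `p`, computed in the chart at `p`. -/
def dform (p : P) (u v : TangentSpace 𝓘(ℝ, EP) p) : EG :=
  extDeriv (fun x => ContinuousAlternatingMap.ofSubsingleton ℝ EP EG (0 : Fin 1)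
      (conn.formInChart p x)) (extChartAt 𝓘(ℝ, EP) p p)
    ![mfderiv 𝓘(ℝ, EP) 𝓘(ℝ, EP) (extChartAt 𝓘(ℝ, EP) p) p u,
      mfderiv 𝓘(ℝ, EP) 𝓘(ℝ, EP) (extChartAt 𝓘(ℝ, EP) p) p v]

/-- The curvature two-form `R = dω + ω ∧ ω`, where `(ω ∧ ω)(u, v) = [ω(u), ω(v)]` with the bracket
of the Lie algebra of `G`. For horizontal vector fields this is `R(X, Y) = -ω([X, Y])`. -/
def curvature (p : P) (u v : TangentSpace 𝓘(ℝ, EP) p) : EG :=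
  conn.dform p u v + structureBracket G (conn.form p u) (conn.form p v)

end PrincipalConnection

/-- Velocity at time `t` of a curve defined on `[0, 1]` (one-sided at the end points). -/
def velocity (c : ℝ → P) (t : ℝ) : TangentSpace 𝓘(ℝ, EP) (c t) :=
  mfderivWithin 𝓘(ℝ, ℝ) 𝓘(ℝ, EP) c (Icc 0 1) t (1 : ℝ)

/-- The path-ordered exponential `h = P exp (∫₀¹ a(t) dt) ∈ G` of a curve `a` in the Lie algebra:
`h = g(1)`, where `g : [0, 1] → G` solves `g'(t) = a(t) · g(t)` (`a(t)` is carried to the point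
`g(t)` by right translation), `g(0) = 1`. -/
def IsPathOrderedExp (a : ℝ → EG) (h : G) : Prop :=
  ∃ g : ℝ → G, g 0 = 1 ∧ g 1 = h ∧ ∀ t ∈ Icc (0 : ℝ) 1,
    HasMFDerivWithinAt 𝓘(ℝ, ℝ) 𝓘(ℝ, EG) g (Icc 0 1) t
      (ContinuousLinearMap.toSpanSingleton ℝ
        (mfderiv 𝓘(ℝ, EG) 𝓘(ℝ, EG) (fun x : G => x * g t) 1 (a t) : EG))

namespace PrincipalConnection

variable {Q : PrincipalBundle EB B EP P EG G} (conn : PrincipalConnection Q)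

/-- `c` is a horizontal lift of the path `γ : [0, 1] → B`: it is a differentiable curve over `γ`
whose velocity lies in the horizontal space `ker ω` at every time. -/
structure IsHorizontalLift (γ : ℝ → B) (c : ℝ → P) : Prop where
  proj_eq : ∀ t ∈ Icc (0 : ℝ) 1, Q.proj (c t) = γ t
  mdifferentiableOn : MDifferentiableOn 𝓘(ℝ, ℝ) 𝓘(ℝ, EP) c (Icc 0 1)
  horizontal : ∀ t ∈ Icc (0 : ℝ) 1, conn.form (c t) (velocity c t) = 0

/-- `h ∈ G` is the holonomy `Hol(γ, p₀)`: the horizontal lift of `γ` which starts at `p₀` ends at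
`p₀ · h`. -/
def IsHolonomy (γ : ℝ → B) (p₀ : P) (h : G) : Prop :=
  ∃ c : ℝ → P, conn.IsHorizontalLift γ c ∧ c 0 = p₀ ∧ c 1 = Q.act p₀ h

/-- The horizontal lift `Φ(r, t)` through `p₀` of a disc `f`, along the radii
`r ↦ f (r e^{2πit})`: all radii are lifted horizontally from one point over the centre, which is
such that the lift of the radius `t = 0` ends at `p₀`. -/
structure IsRadialLift (f : ℂ → B) (p₀ : P) (Φ : ℝ → ℝ → P) : Prop where
  basepoint : Φ 1 0 = p₀
  centre : ∀ t ∈ Icc (0 : ℝ) 1, Φ 0 t = Φ 0 0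
  lift : ∀ t ∈ Icc (0 : ℝ) 1, conn.IsHorizontalLift
    (fun r => f (r * Complex.exp (2 * Real.pi * t * Complex.I))) (fun r => Φ r t)
  mdifferentiableOn : ∀ r ∈ Icc (0 : ℝ) 1,
    MDifferentiableOn 𝓘(ℝ, ℝ) 𝓘(ℝ, EP) (fun t => Φ r t) (Icc 0 1)

/-- `h = P exp (- ∫_S R)`, for the disc `S` parametrized by `f` and the base point `p₀`: the
curvature is pulled back by the horizontal radial lift `Φ` of the disc through `p₀`, is integrated
along each radius, `R(t) = ∫₀¹ R (∂Φ/∂r, ∂Φ/∂t) dr`, and the ordering is that of the parameter `t`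
of the boundary loop. -/
def IsSurfaceOrderedExp (f : ℂ → B) (p₀ : P) (h : G) : Prop :=
  ∃ Φ : ℝ → ℝ → P, conn.IsRadialLift f p₀ Φ ∧
    IsPathOrderedExp (fun t => -∫ r in (0 : ℝ)..1,
      conn.curvature (Φ r t) (velocity (fun s => Φ s t) r) (velocity (fun s => Φ r s) t)) h

/-- `F` is the curvature as a two-form on the base: `proj^* F = R`. -/
def IsBaseCurvature
    (F : ∀ b : B, TangentSpace 𝓘(ℝ, EB) b → TangentSpace 𝓘(ℝ, EB) b → EG) : Prop :=
  ∀ (p : P) (u v : TangentSpace 𝓘(ℝ, EP) p), conn.curvature p u v =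
    F (Q.proj p) (mfderiv 𝓘(ℝ, EP) 𝓘(ℝ, EB) Q.proj p u) (mfderiv 𝓘(ℝ, EP) 𝓘(ℝ, EB) Q.proj p v)

end PrincipalConnection

end Bundle

/-! ### Surfaces as smooth singular chains -/

section Chains

variable (EB : Type*) [NormedAddCommGroup EB] [NormedSpace ℝ EB]
  (B : Type*) [TopologicalSpace B] [ChartedSpace EB B]

/-- A piecewise smooth oriented surface in `B`: a finite formal combination of smooth squares
`[0, 1]² → B` with integer coefficients. -/
structure SurfaceChain where
  size : ℕ
  coeff : Fin size → ℤ
  square : Fin size → ℝ × ℝ → B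
  contMDiffOn_square : ∀ i,
    ContMDiffOn 𝓘(ℝ, ℝ × ℝ) 𝓘(ℝ, EB) ∞ (square i) (Icc (0 : ℝ × ℝ) 1)

/-- The edge `[0, 1] → B`, as a one-chain. -/
def edgeChain {B : Type*} (e : ℝ → B) : (unitInterval → B) →₀ ℤ :=
  Finsupp.single (fun t : unitInterval => e t) 1

/-- One-chains that are regarded as zero: an edge plus the reversed edge, and constant edges. -/
def trivialEdgeChains : AddSubgroup ((unitInterval → B) →₀ ℤ) :=
  AddSubgroup.closure
    ({z | ∃ e : unitInterval → B, z = Finsupp.single e 1 + Finsupp.single (fun t => e (unitInterval.symm t)) 1} ∪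
      {z | ∃ b : B, z = Finsupp.single (fun _ => b) 1})

namespace SurfaceChain

variable {EB B} (S : SurfaceChain EB B)

/-- The oriented boundary: for each square the four edges, counterclockwise. -/
def boundary : (unitInterval → B) →₀ ℤ :=
  ∑ i, S.coeff i • (edgeChain (fun t => S.square i (t, 0)) + edgeChain (fun t => S.square i (1, t))
    - edgeChain (fun t => S.square i (t, 1)) - edgeChain (fun t => S.square i (0, t)))

/-- `∂S = γ`, up to reversed and constant edges. -/
def Bounds (γ : ℝ → B) : Prop :=
  S.boundary - edgeChain γ ∈ trivialEdgeChains B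

/-- The integral over `S` of a vector-valued two-form `F` on `B`. -/
def integral {V : Type*} [NormedAddCommGroup V] [NormedSpace ℝ V]
    (F : ∀ b : B, TangentSpace 𝓘(ℝ, EB) b → TangentSpace 𝓘(ℝ, EB) b → V) : V :=
  ∑ i, S.coeff i • ∫ x in (0 : ℝ)..1, ∫ y in (0 : ℝ)..1,
    F (S.square i (x, y))
      (mfderivWithin 𝓘(ℝ, ℝ × ℝ) 𝓘(ℝ, EB) (S.square i) (Icc 0 1) (x, y) ((1, 0) : ℝ × ℝ))
      (mfderivWithin 𝓘(ℝ, ℝ × ℝ) 𝓘(ℝ, EB) (S.square i) (Icc 0 1) (x, y) ((0, 1) : ℝ × ℝ))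

end SurfaceChain

end Chains

end

noncomputable section

section Calculus

open Filter Topology Metric
open scoped NNReal

variable {E : Type*} [NormedAddCommGroup E] [NormedSpace ℝ E]
  {W : Type*} [NormedAddCommGroup W] [NormedSpace ℝ W]

/-- A Grönwall type estimate on a short interval. -/
theorem norm_le_of_hasDerivWithinAt_short {a b r₀ k ε : ℝ} {w w' : ℝ → E}
    (hr₀ : r₀ ∈ Icc a b) (hw : ∀ r ∈ Icc a b, HasDerivWithinAt w (w' r) (Icc a b) r)
    (hb : ∀ r ∈ Icc a b, ‖w' r‖ ≤ k * ‖w r‖ + ε) (h0 : w r₀ = 0) (hk : 0 ≤ k) (hε : 0 ≤ ε)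
    (hs : k * (b - a) ≤ 1 / 2) : ∀ r ∈ Icc a b, ‖w r‖ ≤ 2 * (b - a) * ε := by
  have hc : ContinuousOn (fun r => ‖w r‖) (Icc a b) :=
    ContinuousOn.norm fun r hr => (hw r hr).continuousWithinAt
  obtain ⟨m, hm, hmax⟩ := isCompact_Icc.exists_isMaxOn ⟨r₀, hr₀⟩ hc
  have hmax' : ∀ r ∈ Icc a b, ‖w r‖ ≤ ‖w m‖ := fun r hr => hmax hr
  have h1 := (convex_Icc a b).norm_image_sub_le_of_norm_hasDerivWithin_le (C := k * ‖w m‖ + ε) hw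
    (fun r hr => (hb r hr).trans (by have := hmax' r hr; gcongr)) hr₀ hm
  rw [h0, sub_zero] at h1
  have h2 : ‖m - r₀‖ ≤ b - a := by
    rw [Real.norm_eq_abs, abs_le]; constructor <;> linarith [hm.1, hm.2, hr₀.1, hr₀.2]
  have h3 : ‖w m‖ ≤ (k * ‖w m‖ + ε) * (b - a) := h1.trans (by gcongr)
  have h4 : k * (b - a) * ‖w m‖ ≤ 1 / 2 * ‖w m‖ := by gcongr
  intro r hr
  have := hmax' r hr
  nlinarith

theorem hasDerivWithinAt_of_norm_sub_le_sq {J : Set ℝ} {g : ℝ → E} {g' : E} {t C : ℝ}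
    (h : ∀ t' ∈ J, ‖g t' - g t - (t' - t) • g'‖ ≤ C * (t' - t) ^ 2) :
    HasDerivWithinAt g g' J t := by
  rw [hasDerivWithinAt_iff_isLittleO]
  have h1 : (fun t' => g t' - g t - (t' - t) • g') =O[𝓝[J] t] fun t' => ‖t' - t‖ ^ 2 := by
    refine Asymptotics.IsBigO.of_bound C ?_
    filter_upwards [self_mem_nhdsWithin] with t' ht'
    simpa using h t' ht'
  exact h1.trans_isLittleO ((Asymptotics.isLittleO_pow_sub_sub t one_lt_two).mono nhdsWithin_le_nhds)

/-- Picard–Lindelöf with a solution staying in the given ball. -/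
theorem IsPicardLindelof.exists_solution_mem_closedBall [CompleteSpace E] {v : ℝ → E → E} {a b : ℝ}
    {r₀ : Icc a b} {x₀ : E} {ρ L K : ℝ≥0} (h : IsPicardLindelof v r₀ x₀ ρ 0 L K) :
    ∃ x : ℝ → E, x r₀ = x₀ ∧ ∀ r ∈ Icc a b, x r ∈ closedBall x₀ ρ ∧
      HasDerivWithinAt x (v r (x r)) (Icc a b) r := by
  have hx : x₀ ∈ closedBall x₀ ((0 : ℝ≥0) : ℝ) := by simp
  obtain ⟨α, hα⟩ := ODE.FunSpace.exists_isFixedPt_next h hx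
  refine ⟨α.compProj, by rw [ODE.FunSpace.compProj_val, ← hα, ODE.FunSpace.next_apply₀],
    fun t ht ↦ ⟨α.compProj_mem_closedBall h.mul_max_le, ?_⟩⟩
  apply ODE.hasDerivWithinAt_picard_Icc r₀.2 h.continuousOn_uncurry
    α.continuous_compProj.continuousOn (fun _ ht' ↦ α.compProj_mem_closedBall h.mul_max_le)
    x₀ ht |>.congr_of_mem _ ht
  intro t' ht'
  nth_rw 1 [← hα]
  rw [ODE.FunSpace.compProj_of_mem ht', ODE.FunSpace.next_apply]

/-- Differentiable dependence on a parameter of the solution of `∂ᵣ x = f (α (r, t), x)`,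
`x (r₀, t) = x₀`, on a short interval, with the variational equation for `∂ₜ x`. -/
theorem exists_solution_hasDerivWithinAt_parameter [CompleteSpace E]
    {f : W × E → E} {f' : W × E → W × E →L[ℝ] E} {w₀ : W} {x₀ : E} {ρ K K₂ L : ℝ}
    (hρ : 0 ≤ ρ) (hK₀ : 0 ≤ K) (hK₂₀ : 0 ≤ K₂) (hL₀ : 0 ≤ L)
    (hf : ∀ p ∈ closedBall w₀ ρ ×ˢ closedBall x₀ ρ, HasFDerivAt f (f' p) p)
    (hf'c : ContinuousOn f' (closedBall w₀ ρ ×ˢ closedBall x₀ ρ))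
    (hK : ∀ p ∈ closedBall w₀ ρ ×ˢ closedBall x₀ ρ, ‖f' p‖ ≤ K)
    (hK₂ : ∀ p ∈ closedBall w₀ ρ ×ˢ closedBall x₀ ρ, ∀ q ∈ closedBall w₀ ρ ×ˢ closedBall x₀ ρ,
      ‖f q - f p - f' p (q - p)‖ ≤ K₂ * ‖q - p‖ ^ 2)
    (hL : ∀ p ∈ closedBall w₀ ρ ×ˢ closedBall x₀ ρ, ‖f p‖ ≤ L)
    {a b r₀ : ℝ} (hr₀ : r₀ ∈ Icc a b) {J : Set ℝ} {α αt : ℝ → ℝ → W} {M C : ℝ}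
    (hM₀ : 0 ≤ M) (hC₀ : 0 ≤ C)
    (hα : ∀ t ∈ J, ContinuousOn (fun r => α r t) (Icc a b))
    (hαm : ∀ r ∈ Icc a b, ∀ t ∈ J, α r t ∈ closedBall w₀ ρ)
    (hαt : ∀ t ∈ J, ContinuousOn (fun r => αt r t) (Icc a b))
    (hαtM : ∀ r ∈ Icc a b, ∀ t ∈ J, ‖αt r t‖ ≤ M)
    (hαL : ∀ r ∈ Icc a b, ∀ t ∈ J, ∀ t' ∈ J, ‖α r t' - α r t‖ ≤ M * |t' - t|)
    (hαq : ∀ r ∈ Icc a b, ∀ t ∈ J, ∀ t' ∈ J,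
      ‖α r t' - α r t - (t' - t) • αt r t‖ ≤ C * (t' - t) ^ 2)
    (hab : K * (b - a) ≤ 1 / 2) (hab' : L * (b - a) ≤ ρ) :
    ∃ x xt : ℝ → ℝ → E, ∀ t ∈ J, x r₀ t = x₀ ∧ ∀ r ∈ Icc a b,
      x r t ∈ closedBall x₀ ρ ∧
      HasDerivWithinAt (fun r => x r t) (f (α r t, x r t)) (Icc a b) r ∧
      HasDerivWithinAt (fun r => xt r t) (f' (α r t, x r t) (αt r t, xt r t)) (Icc a b) r ∧
      HasDerivWithinAt (fun t => x r t) (xt r t) J t := by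
  lift ρ to ℝ≥0 using hρ
  lift K to ℝ≥0 using hK₀
  lift L to ℝ≥0 using hL₀
  lift M to ℝ≥0 using hM₀
  have hK₀ : (0 : ℝ) ≤ K := K.2
  have hL₀ : (0 : ℝ) ≤ L := L.2
  have hM₀ : (0 : ℝ) ≤ M := M.2
  have hba : 0 ≤ b - a := by linarith [hr₀.1, hr₀.2]
  have hmax : max (b - r₀) (r₀ - a) ≤ b - a := max_le (by linarith [hr₀.1]) (by linarith [hr₀.2])
  have hconv : Convex ℝ (closedBall w₀ ρ ×ˢ closedBall x₀ ρ) :=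
    (convex_closedBall _ _).prod (convex_closedBall _ _)
  have hLip : ∀ p ∈ closedBall w₀ ρ ×ˢ closedBall x₀ ρ, ∀ q ∈ closedBall w₀ ρ ×ˢ closedBall x₀ ρ,
      ‖f q - f p‖ ≤ K * ‖q - p‖ := fun p hp q hq =>
    hconv.norm_image_sub_le_of_norm_hasFDerivWithin_le (fun z hz => (hf z hz).hasFDerivWithinAt)
      hK hp hq
  have hfc : ContinuousOn f (closedBall w₀ ρ ×ˢ closedBall x₀ ρ) := fun p hp =>
    (hf p hp).continuousAt.continuousWithinAt
  have hx : ∀ t ∈ J, ∃ x : ℝ → E, x r₀ = x₀ ∧ ∀ r ∈ Icc a b, x r ∈ closedBall x₀ ρ ∧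
      HasDerivWithinAt x (f (α r t, x r)) (Icc a b) r := by
    intro t ht
    have hpl : IsPicardLindelof (fun r y => f (α r t, y)) (⟨r₀, hr₀⟩ : Icc a b) x₀ ρ 0 L K := by
      refine ⟨fun r hr => ?_, fun y hy => ?_, fun r hr y hy => ?_, ?_⟩
      · refine LipschitzOnWith.of_dist_le_mul fun y hy y' hy' => ?_
        rw [dist_eq_norm, dist_eq_norm]
        have h := hLip (α r t, y') ⟨hαm r hr t ht, hy'⟩ (α r t, y) ⟨hαm r hr t ht, hy⟩
        simpa [Prod.norm_def] using h
      · exact hfc.comp ((hα t ht).prodMk continuousOn_const) fun r hr => ⟨hαm r hr t ht, hy⟩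
      · exact hL _ ⟨hαm r hr t ht, hy⟩
      · simp only [NNReal.coe_zero, sub_zero]
        exact (mul_le_mul_of_nonneg_left hmax hL₀).trans hab'
    obtain ⟨x, h1, h2⟩ := hpl.exists_solution_mem_closedBall
    exact ⟨x, h1, h2⟩
  choose! x hx₀ hx using hx
  have hxc : ∀ t ∈ J, ContinuousOn (x t) (Icc a b) := fun t ht r hr =>
    ((hx t ht r hr).2).continuousWithinAt
  have hy : ∀ t ∈ J, ∃ y : ℝ → E, y r₀ = 0 ∧ ∀ r ∈ Icc a b,
      HasDerivWithinAt y (f' (α r t, x t r) (αt r t, y r)) (Icc a b) r := by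
    intro t ht
    have hpl : IsPicardLindelof (fun r y => f' (α r t, x t r) (αt r t, y)) (⟨r₀, hr₀⟩ : Icc a b)
        (0 : E) M 0 (K * M) K := by
      refine ⟨fun r hr => ?_, fun y hy => ?_, fun r hr y hy => ?_, ?_⟩
      · refine LipschitzOnWith.of_dist_le_mul fun y hy y' hy' => ?_
        rw [dist_eq_norm, dist_eq_norm, ← map_sub]
        refine ((f' (α r t, x t r)).le_of_opNorm_le (hK _ ⟨hαm r hr t ht, (hx t ht r hr).1⟩) _).trans ?_
        simp [Prod.norm_def]
      · exact (hf'c.comp ((hα t ht).prodMk (hxc t ht)) fun r hr =>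
          ⟨hαm r hr t ht, (hx t ht r hr).1⟩).clm_apply ((hαt t ht).prodMk continuousOn_const)
      · refine ((f' (α r t, x t r)).le_of_opNorm_le (hK _ ⟨hαm r hr t ht, (hx t ht r hr).1⟩) _).trans ?_
        have hy' : ‖y‖ ≤ M := by simpa using hy
        have := hαtM r hr t ht
        simp only [Prod.norm_def, NNReal.coe_mul]
        gcongr
        exact max_le this hy'
      · simp only [NNReal.coe_mul, NNReal.coe_zero, sub_zero]
        have : K * M * max (b - r₀) (r₀ - a) ≤ K * M * (b - a) := by gcongr
        nlinarith
    obtain ⟨y, h1, h2⟩ := hpl.exists_solution_mem_closedBall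
    exact ⟨y, h1, fun r hr => (h2 r hr).2⟩
  choose! y hy₀ hy using hy
  refine ⟨fun r t => x t r, fun r t => y t r, fun t ht => ⟨hx₀ t ht, fun r hr =>
    ⟨(hx t ht r hr).1, (hx t ht r hr).2, hy t ht r hr, ?_⟩⟩⟩
  have hmem : ∀ t ∈ J, ∀ r ∈ Icc a b, (α r t, x t r) ∈ closedBall w₀ ρ ×ˢ closedBall x₀ ρ :=
    fun t ht r hr => ⟨hαm r hr t ht, (hx t ht r hr).1⟩
  have hxlip : ∀ t' ∈ J, ∀ r ∈ Icc a b, ‖x t' r - x t r‖ ≤ M * |t' - t| := by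
    intro t' ht' r hr
    have h := norm_le_of_hasDerivWithinAt_short (w := fun r => x t' r - x t r) (k := K)
      (ε := K * (M * |t' - t|)) hr₀ (fun r hr => ((hx t' ht' r hr).2).sub (hx t ht r hr).2)
      (fun r hr => by
        refine (hLip _ (hmem t ht r hr) _ (hmem t' ht' r hr)).trans ?_
        rw [← mul_add]
        gcongr
        rw [Prod.mk_sub_mk, Prod.norm_def]
        refine max_le ((hαL r hr t ht t' ht').trans ?_) ?_
        · simp
        · simp only [le_add_iff_nonneg_right]; positivity)
      (by simp [hx₀ t ht, hx₀ t' ht']) hK₀ (by positivity) hab r hr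
    refine h.trans ?_
    have : 0 ≤ M * |t' - t| := by positivity
    nlinarith
  refine hasDerivWithinAt_of_norm_sub_le_sq (C := 2 * (b - a) * (K₂ * M ^ 2 + K * C)) fun t' ht' => ?_
  have h := norm_le_of_hasDerivWithinAt_short
    (w := fun r => x t' r - x t r - (t' - t) • y t r) (k := K)
    (ε := (K₂ * M ^ 2 + K * C) * (t' - t) ^ 2) hr₀
    (fun r hr => (((hx t' ht' r hr).2).sub (hx t ht r hr).2).sub ((hy t ht r hr).const_smul (t' - t)))
    (fun r hr => by
      set p : W × E := (α r t, x t r) with hp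
      set q : W × E := (α r t', x t' r) with hq
      have e : f q - f p - (t' - t) • f' p (αt r t, y t r) = (f q - f p - f' p (q - p)) +
          f' p (α r t' - α r t - (t' - t) • αt r t, x t' r - x t r - (t' - t) • y t r) := by
        have : (α r t' - α r t - (t' - t) • αt r t, x t' r - x t r - (t' - t) • y t r) =
          (q - p) - (t' - t) • ((αt r t, y t r) : W × E) := by simp [hp, hq]
        rw [this, map_sub (f' p) (q - p), map_smul]; abel
      rw [e]
      have hqp : ‖q - p‖ ≤ M * |t' - t| := by
        rw [hp, hq, Prod.mk_sub_mk, Prod.norm_def]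
        exact max_le (hαL r hr t ht t' ht') (hxlip t' ht' r hr)
      have h1 : ‖f q - f p - f' p (q - p)‖ ≤ K₂ * (M * |t' - t|) ^ 2 :=
        (hK₂ _ (hmem t ht r hr) _ (hmem t' ht' r hr)).trans (by gcongr)
      have h2 := (f' p).le_of_opNorm_le (hK _ (hmem t ht r hr))
        (α r t' - α r t - (t' - t) • αt r t, x t' r - x t r - (t' - t) • y t r)
      have h3 : ‖((α r t' - α r t - (t' - t) • αt r t, x t' r - x t r - (t' - t) • y t r) : W × E)‖
          ≤ C * (t' - t) ^ 2 + ‖x t' r - x t r - (t' - t) • y t r‖ := by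
        rw [Prod.norm_def]
        refine max_le ((hαq r hr t ht t' ht').trans (by simp)) ?_
        simp only [le_add_iff_nonneg_left]; positivity
      refine (norm_add_le _ _).trans ?_
      have h4 := mul_le_mul_of_nonneg_left h3 hK₀
      rw [mul_pow, sq_abs] at h1
      linarith)
    (by simp [hx₀ t ht, hx₀ t' ht', hy₀ t ht]) hK₀ (by positivity) hab r hr
  refine h.trans (le_of_eq (by ring))

end Calculus

section Calculus

open Filter Topology Metric
open scoped NNReal

variable {E : Type*} [NormedAddCommGroup E] [NormedSpace ℝ E]
  {W : Type*} [NormedAddCommGroup W] [NormedSpace ℝ W]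

theorem ContDiffOn.fderivWithin_apply_const {F : Type*} [NormedAddCommGroup F] [NormedSpace ℝ F]
    {b : F → W} {s : Set F} (h : ContDiffOn ℝ ∞ b s)
    (hs : UniqueDiffOn ℝ s) (v : F) : ContDiffOn ℝ ∞ (fun p => fderivWithin ℝ b s p v) s :=
  (h.fderivWithin hs (m := ∞) (by simp)).clm_apply contDiffOn_const

theorem DifferentiableWithinAt.hasDerivWithinAt_fst {b : ℝ × ℝ → W} {I J : Set ℝ} {r t : ℝ}
    (h : DifferentiableWithinAt ℝ b (I ×ˢ J) (r, t)) (ht : t ∈ J) :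
    HasDerivWithinAt (fun r => b (r, t)) (fderivWithin ℝ b (I ×ˢ J) (r, t) (1, 0)) I r := by
  have h1 : HasDerivWithinAt (fun r : ℝ => ((r, t) : ℝ × ℝ)) (1, 0) I r :=
    (hasDerivWithinAt_id r I).prodMk (hasDerivWithinAt_const r I t)
  exact HasFDerivWithinAt.comp_hasDerivWithinAt (t := I ×ˢ J) r h.hasFDerivWithinAt h1
    fun r hr => ⟨hr, ht⟩

theorem DifferentiableWithinAt.hasDerivWithinAt_snd {b : ℝ × ℝ → W} {I J : Set ℝ} {r t : ℝ}
    (h : DifferentiableWithinAt ℝ b (I ×ˢ J) (r, t)) (hr : r ∈ I) :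
    HasDerivWithinAt (fun t => b (r, t)) (fderivWithin ℝ b (I ×ˢ J) (r, t) (0, 1)) J t := by
  have h1 : HasDerivWithinAt (fun t : ℝ => ((r, t) : ℝ × ℝ)) (0, 1) J t :=
    (hasDerivWithinAt_const t J r).prodMk (hasDerivWithinAt_id t J)
  exact HasFDerivWithinAt.comp_hasDerivWithinAt (t := I ×ˢ J) t h.hasFDerivWithinAt h1
    fun t ht => ⟨hr, ht⟩

theorem ContDiffOn.fderivWithin_fderivWithin_apply_comm {F : Type*} [NormedAddCommGroup F]
    [NormedSpace ℝ F] {b : F → W} {s : Set F}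
    (h : ContDiffOn ℝ ∞ b s) (hs : UniqueDiffOn ℝ s) (hs' : s ⊆ closure (interior s)) {p : F}
    (hp : p ∈ s) (v w : F) :
    fderivWithin ℝ (fun p => fderivWithin ℝ b s p v) s p w =
      fderivWithin ℝ (fun p => fderivWithin ℝ b s p w) s p v := by
  have hd : DifferentiableWithinAt ℝ (fderivWithin ℝ b s) s p :=
    ((h.fderivWithin hs (m := ∞) (by simp)).differentiableOn (by simp)) p hp
  have h2 : ∀ v, fderivWithin ℝ (fun p => fderivWithin ℝ b s p v) s p =
      (ContinuousLinearMap.apply ℝ W v).comp (fderivWithin ℝ (fderivWithin ℝ b s) s p) := by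
    intro v
    exact ((ContinuousLinearMap.apply ℝ W v).hasFDerivAt.comp_hasFDerivWithinAt p
      hd.hasFDerivWithinAt).fderivWithin (hs p hp)
  have hsym : IsSymmSndFDerivWithinAt ℝ b s p :=
    (h p hp).isSymmSndFDerivWithinAt (by rw [minSmoothness_of_isRCLikeNormedField]; exact WithTop.coe_le_coe.2 le_top) hs (hs' hp) hp
  rw [h2 v, h2 w]
  exact hsym w v

theorem uniqueDiffOn_Icc_prod {a b c d : ℝ} (hab : a < b) (hcd : c < d) :
    UniqueDiffOn ℝ (Icc a b ×ˢ Icc c d) :=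
  (uniqueDiffOn_Icc hab).prod (uniqueDiffOn_Icc hcd)

theorem Icc_prod_subset_closure_interior {a b c d : ℝ} (hab : a < b) (hcd : c < d) :
    Icc a b ×ˢ Icc c d ⊆ closure (interior (Icc a b ×ˢ Icc c d)) := by
  rw [interior_prod_eq, interior_Icc, interior_Icc, closure_prod_eq, closure_Ioo hab.ne,
    closure_Ioo hcd.ne]

/-- Constants that control a `C²` map near a point. -/
theorem ContDiffAt.exists_quadratic_bounds {F : Type*} [NormedAddCommGroup F] [NormedSpace ℝ F]
    {f : F → E} {p₀ : F} (hf : ContDiffAt ℝ 2 f p₀) {N : Set F} (hN : N ∈ 𝓝 p₀) :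
    ∃ ρ > 0, ∃ K K₂ L : ℝ, 0 ≤ K ∧ 0 ≤ K₂ ∧ 0 ≤ L ∧ closedBall p₀ ρ ⊆ N ∧
      (∀ p ∈ closedBall p₀ ρ, HasFDerivAt f (fderiv ℝ f p) p) ∧
      ContinuousOn (fderiv ℝ f) (closedBall p₀ ρ) ∧
      (∀ p ∈ closedBall p₀ ρ, ‖fderiv ℝ f p‖ ≤ K) ∧
      (∀ p ∈ closedBall p₀ ρ, ∀ q ∈ closedBall p₀ ρ,
        ‖f q - f p - fderiv ℝ f p (q - p)‖ ≤ K₂ * ‖q - p‖ ^ 2) ∧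
      (∀ p ∈ closedBall p₀ ρ, ‖f p‖ ≤ L) := by
  have h1 : ∀ᶠ p in 𝓝 p₀, ContDiffAt ℝ 2 f p := hf.eventually (by simp)
  have hd : ContDiffAt ℝ 1 (fderiv ℝ f) p₀ := hf.fderiv_right (by norm_num)
  obtain ⟨K₂, T, hT, hlip⟩ := hd.exists_lipschitzOnWith
  have h3 : ∀ᶠ p in 𝓝 p₀, ‖fderiv ℝ f p‖ < ‖fderiv ℝ f p₀‖ + 1 :=
    hd.continuousAt.norm.eventually_lt_const (lt_add_one _)
  have h4 : ∀ᶠ p in 𝓝 p₀, ‖f p‖ < ‖f p₀‖ + 1 :=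
    hf.continuousAt.norm.eventually_lt_const (lt_add_one _)
  obtain ⟨ρ, hρ, hball⟩ := nhds_basis_closedBall.eventually_iff.1
    (h1.and (h3.and (h4.and (inter_mem hT hN))))
  have hfd : ∀ p ∈ closedBall p₀ ρ, HasFDerivAt f (fderiv ℝ f p) p := fun p hp =>
    ((hball hp).1.differentiableAt (by simp)).hasFDerivAt
  refine ⟨ρ, hρ, ‖fderiv ℝ f p₀‖ + 1, K₂, ‖f p₀‖ + 1, by positivity, K₂.2, by positivity,
    fun p hp => (hball hp).2.2.2.2, hfd, ?_, fun p hp => (hball hp).2.1.le, ?_,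
    fun p hp => (hball hp).2.2.1.le⟩
  · exact hlip.continuousOn.mono fun p hp => (hball hp).2.2.2.1
  · intro p hp q hq
    have hseg : segment ℝ p q ⊆ closedBall p₀ ρ := (convex_closedBall p₀ ρ).segment_subset hp hq
    have := (convex_segment p q).norm_image_sub_le_of_norm_hasFDerivWithin_le'
      (f := f) (φ := fderiv ℝ f p) (C := K₂ * ‖q - p‖)
      (fun z hz => (hfd z (hseg hz)).hasFDerivWithinAt)
      (fun z hz => by
        have h := hlip.dist_le_mul z (hball (hseg hz)).2.2.2.1 p (hball hp).2.2.2.1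
        rw [dist_eq_norm, dist_eq_norm] at h
        refine h.trans ?_
        gcongr
        rw [segment_eq_image'] at hz
        obtain ⟨θ, hθ, rfl⟩ := hz
        rw [add_sub_cancel_left, norm_smul, Real.norm_eq_abs, abs_of_nonneg hθ.1]
        exact mul_le_of_le_one_left (norm_nonneg _) hθ.2)
      (left_mem_segment ℝ p q) (right_mem_segment ℝ p q)
    rw [pow_two, ← mul_assoc]
    exact this

/-- Local solutions of `∂ᵣ x = f (α (r, t), x)`, `x (r₀, t) = x₀`, with their dependence on `t`. -/
theorem exists_local_solution_parameter [CompleteSpace E] {f : W × E → E} {a b c d r₀ t₀ : ℝ}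
    {α : ℝ × ℝ → W} {x₀ : E} (hab : a < b) (hcd : c < d)
    (hα : ContDiffOn ℝ ∞ α (Icc a b ×ˢ Icc c d)) (hr₀ : r₀ ∈ Icc a b) (ht₀ : t₀ ∈ Icc c d)
    (hf : ContDiffAt ℝ 2 f (α (r₀, t₀), x₀)) {N : Set (W × E)} (hN : N ∈ 𝓝 (α (r₀, t₀), x₀)) :
    ∃ δ > 0, ∃ x xt : ℝ → ℝ → E, ∀ t ∈ Icc c d, |t - t₀| < δ → x r₀ t = x₀ ∧
      ∀ r ∈ Icc a b, |r - r₀| < δ → (α (r, t), x r t) ∈ N ∧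
        DifferentiableAt ℝ f (α (r, t), x r t) ∧
        HasDerivWithinAt (fun r => x r t) (f (α (r, t), x r t)) (Icc a b) r ∧
        HasDerivWithinAt (fun r => xt r t) (fderiv ℝ f (α (r, t), x r t)
          (fderivWithin ℝ α (Icc a b ×ˢ Icc c d) (r, t) (0, 1), xt r t)) (Icc a b) r ∧
        HasDerivWithinAt (fun t => x r t) (xt r t) (Icc c d) t := by
  obtain ⟨ρ, hρ, K, K₂, L, hK₀, hK₂₀, hL₀, hsub, hfd, hfc, hK, hK₂, hL⟩ :=
    hf.exists_quadratic_bounds hN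
  rw [← closedBall_prod_same] at hsub hfd hfc hK hK₂ hL
  set D := Icc a b ×ˢ Icc c d with hD
  have hDu : UniqueDiffOn ℝ D := uniqueDiffOn_Icc_prod hab hcd
  have hDc : IsCompact D := isCompact_Icc.prod isCompact_Icc
  set αt : ℝ × ℝ → W := fun p => fderivWithin ℝ α D p (0, 1) with hαt
  have hαts : ContDiffOn ℝ ∞ αt D := hα.fderivWithin_apply_const hDu _
  have hαtts : ContDiffOn ℝ ∞ (fun p => fderivWithin ℝ αt D p (0, 1)) D :=
    hαts.fderivWithin_apply_const hDu _
  have dα : ∀ r ∈ Icc a b, ∀ t ∈ Icc c d,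
      HasDerivWithinAt (fun t => α (r, t)) (αt (r, t)) (Icc c d) t := fun r hr t ht =>
    (hα.differentiableOn (by simp) (r, t) ⟨hr, ht⟩).hasDerivWithinAt_snd hr
  have dαt : ∀ r ∈ Icc a b, ∀ t ∈ Icc c d, HasDerivWithinAt (fun t => αt (r, t))
      (fderivWithin ℝ αt D (r, t) (0, 1)) (Icc c d) t := fun r hr t ht =>
    (hαts.differentiableOn (by simp) (r, t) ⟨hr, ht⟩).hasDerivWithinAt_snd hr
  obtain ⟨M, hM⟩ := hDc.exists_bound_of_continuousOn hαts.continuousOn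
  obtain ⟨C, hC⟩ := hDc.exists_bound_of_continuousOn hαtts.continuousOn
  have hM₀ : 0 ≤ M := (norm_nonneg _).trans (hM (r₀, t₀) ⟨hr₀, ht₀⟩)
  have hC₀ : 0 ≤ C := (norm_nonneg _).trans (hC (r₀, t₀) ⟨hr₀, ht₀⟩)
  have hcont : ∀ᶠ p in 𝓝[D] (r₀, t₀), α p ∈ closedBall (α (r₀, t₀)) ρ :=
    (hα.continuousOn (r₀, t₀) ⟨hr₀, ht₀⟩).eventually (closedBall_mem_nhds _ hρ)
  rw [eventually_nhdsWithin_iff, nhds_basis_closedBall.eventually_iff] at hcont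
  obtain ⟨δ₁, hδ₁, hball⟩ := hcont
  set δ := min δ₁ (min (1 / (4 * (K + 1))) (ρ / (2 * (L + 1)))) with hδ
  have hδ₀ : 0 < δ := by positivity
  have hδK : δ * (4 * (K + 1)) ≤ 1 := by
    rw [← le_div_iff₀ (by positivity)]; exact (min_le_right _ _).trans (min_le_left _ _)
  have hδL : δ * (2 * (L + 1)) ≤ ρ := by
    rw [← le_div_iff₀ (by positivity)]; exact (min_le_right _ _).trans (min_le_right _ _)
  set a' := max a (r₀ - δ)
  set b' := min b (r₀ + δ)
  have hI : Icc a' b' = Icc a b ∩ Icc (r₀ - δ) (r₀ + δ) := Icc_inter_Icc.symm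
  have hb'a' : b' - a' ≤ 2 * δ := by
    have h1 : b' ≤ r₀ + δ := min_le_right _ _
    have h2 : r₀ - δ ≤ a' := le_max_right _ _
    linarith
  have hb'a'' : 0 ≤ b' - a' := by
    have h1 : r₀ ≤ b' := le_min hr₀.2 (by linarith)
    have h2 : a' ≤ r₀ := max_le hr₀.1 (by linarith)
    linarith
  set J := Icc c d ∩ Icc (t₀ - δ) (t₀ + δ) with hJ
  have hmem : ∀ r ∈ Icc a' b', ∀ t ∈ J, (r, t) ∈ D := fun r hr t ht => ⟨(hI ▸ hr).1, ht.1⟩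
  have key := exists_solution_hasDerivWithinAt_parameter (f := f) (f' := fderiv ℝ f)
    (w₀ := α (r₀, t₀)) (x₀ := x₀) hρ.le hK₀ hK₂₀ hL₀ hfd hfc hK hK₂ hL (a := a') (b := b')
    (r₀ := r₀) ⟨max_le hr₀.1 (by linarith), le_min hr₀.2 (by linarith)⟩ (J := J)
    (α := fun r t => α (r, t)) (αt := fun r t => αt (r, t)) hM₀ hC₀
    (fun t ht => hα.continuousOn.comp (by fun_prop) fun r hr => hmem r hr t ht)
    (fun r hr t ht => by
      refine hball ?_ (hmem r hr t ht)
      rw [hI] at hr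
      have h1 : |r - r₀| ≤ δ₁ := (abs_le.2 ⟨by linarith [hr.2.1], by linarith [hr.2.2]⟩ :
        |r - r₀| ≤ δ).trans (min_le_left _ _)
      have h2 : |t - t₀| ≤ δ₁ := (abs_le.2 ⟨by linarith [ht.2.1], by linarith [ht.2.2]⟩ :
        |t - t₀| ≤ δ).trans (min_le_left _ _)
      rw [mem_closedBall, dist_eq_norm]
      exact max_le h1 h2)
    (fun t ht => hαts.continuousOn.comp (by fun_prop) fun r hr => hmem r hr t ht)
    (fun r hr t ht => hM _ (hmem r hr t ht))
    (fun r hr t ht t' ht' =>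
      (convex_Icc c d).norm_image_sub_le_of_norm_hasDerivWithin_le
        (fun s hs => dα r (hI ▸ hr).1 s hs) (fun s hs => hM (r, s) ⟨(hI ▸ hr).1, hs⟩) ht.1 ht'.1)
    (fun r hr t ht t' ht' => by
      have hr' := (hI ▸ hr : r ∈ Icc a b ∩ Icc (r₀ - δ) (r₀ + δ)).1
      have hlip : ∀ s ∈ Icc c d, ‖αt (r, s) - αt (r, t)‖ ≤ C * |s - t| := fun s hs =>
        (convex_Icc c d).norm_image_sub_le_of_norm_hasDerivWithin_le
          (fun s hs => dαt r hr' s hs) (fun s hs => hC (r, s) ⟨hr', hs⟩) ht.1 hs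
      have hseg : uIcc t t' ⊆ Icc c d := uIcc_subset_Icc ht.1 ht'.1
      have := (convex_uIcc t t').norm_image_sub_le_of_norm_hasDerivWithin_le
        (f := fun s => α (r, s) - s • αt (r, t)) (C := C * |t' - t|)
        (fun s hs => ((dα r hr' s (hseg hs)).mono hseg).sub
          ((hasDerivWithinAt_id s _).smul_const (αt (r, t))))
        (fun s hs => by
          rw [one_smul]
          exact (hlip s (hseg hs)).trans
            (mul_le_mul_of_nonneg_left (abs_sub_left_of_mem_uIcc hs) hC₀))
        left_mem_uIcc right_mem_uIcc
      rw [mul_assoc, Real.norm_eq_abs, ← pow_two, sq_abs] at this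
      refine le_trans (le_of_eq ?_) this
      congr 1
      rw [sub_smul]
      abel)
    (by nlinarith) (by nlinarith)
  obtain ⟨x, xt, hx⟩ := key
  refine ⟨δ, hδ₀, x, xt, fun t ht htδ => ?_⟩
  have htJ : t ∈ J := ⟨ht, by rw [abs_lt] at htδ; constructor <;> linarith⟩
  refine ⟨(hx t htJ).1, fun r hr hrδ => ?_⟩
  have hrI : r ∈ Icc a' b' := by
    rw [hI]; exact ⟨hr, by rw [abs_lt] at hrδ; constructor <;> linarith⟩
  obtain ⟨h1, h2, h3, h4⟩ := (hx t htJ).2 r hrI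
  rw [abs_lt] at htδ hrδ
  have hIm : Icc a' b' ∈ 𝓝[Icc a b] r := by
    rw [hI]
    exact inter_mem self_mem_nhdsWithin
      (mem_nhdsWithin_of_mem_nhds (Icc_mem_nhds (by linarith) (by linarith)))
  have hJm : J ∈ 𝓝[Icc c d] t := inter_mem self_mem_nhdsWithin
      (mem_nhdsWithin_of_mem_nhds (Icc_mem_nhds (by linarith) (by linarith)))
  have hp : (α (r, t), x r t) ∈ closedBall (α (r₀, t₀)) ρ ×ˢ closedBall x₀ ρ := by
    refine ⟨?_, h1⟩
    refine hball ?_ ⟨hr, ht⟩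
    rw [mem_closedBall, dist_eq_norm]
    exact max_le ((abs_lt.2 ⟨by linarith, by linarith⟩ : |r - r₀| < δ).le.trans (min_le_left _ _))
      ((abs_lt.2 ⟨by linarith, by linarith⟩ : |t - t₀| < δ).le.trans (min_le_left _ _))
  exact ⟨hsub hp, (hfd _ hp).differentiableAt, h2.mono_of_mem_nhdsWithin hIm,
    h3.mono_of_mem_nhdsWithin hIm, h4.mono_of_mem_nhdsWithin hJm⟩

end Calculus

theorem extDeriv_ofSubsingleton_apply {E V : Type*} [NormedAddCommGroup E] [NormedSpace ℝ E]
    [NormedAddCommGroup V] [NormedSpace ℝ V] {Ω : E → E →L[ℝ] V} {x : E}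
    (h : DifferentiableAt ℝ Ω x) (a b : E) :
    extDeriv (fun x => ContinuousAlternatingMap.ofSubsingleton ℝ E V (0 : Fin 1) (Ω x)) x ![a, b] =
      fderiv ℝ Ω x a b - fderiv ℝ Ω x b a := by
  set T : (E →L[ℝ] V) →L[ℝ] (E [⋀^Fin 1]→L[ℝ] V) :=
    (ContinuousAlternatingMap.ofSubsingletonLIE (𝕜 := ℝ) (E := E) (F := V)
      (0 : Fin 1)).toContinuousLinearEquiv.toContinuousLinearMap with hT
  have h1 : HasFDerivAt (fun x => ContinuousAlternatingMap.ofSubsingleton ℝ E V (0 : Fin 1) (Ω x))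
      (T.comp (fderiv ℝ Ω x)) x := T.hasFDerivAt.comp x h.hasFDerivAt
  have hw : ∀ w v : E, fderiv ℝ (fun x => Ω x w) x v = fderiv ℝ Ω x v w := fun w v => by
    rw [(h.hasFDerivAt.clm_apply (hasFDerivAt_const w x)).fderiv]
    simp
  rw [extDeriv_apply h1.differentiableAt, Fin.sum_univ_two]
  simp only [ContinuousAlternatingMap.ofSubsingleton_apply_apply]
  rw [hw, hw]
  simp [Fin.removeNth, sub_eq_add_neg]

section Bundle

variable {EB : Type*} [NormedAddCommGroup EB] [NormedSpace ℝ EB]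
  {B : Type*} [TopologicalSpace B] [ChartedSpace EB B]
  {EP : Type*} [NormedAddCommGroup EP] [NormedSpace ℝ EP]
  {P : Type*} [TopologicalSpace P] [ChartedSpace EP P]
  {EG : Type*} [NormedAddCommGroup EG] [NormedSpace ℝ EG]
  {G : Type*} [TopologicalSpace G] [ChartedSpace EG G] [Group G]
  [IsManifold 𝓘(ℝ, EP) ∞ P]
  {Q : PrincipalBundle EB B EP P EG G}
  {F : Type*} [NormedAddCommGroup F] [NormedSpace ℝ F]

open Filter Topology

namespace PrincipalConnection

variable (conn : PrincipalConnection Q)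

/-- The connection form pulled back to a vector space. -/
def pullForm (N : F → P) (z : F) : F →L[ℝ] EG :=
  (conn.form (N z)).comp (mfderiv 𝓘(ℝ, F) 𝓘(ℝ, EP) N z)

theorem form_congr {p q : P} (h : p = q) (w : EP) :
    conn.form p w = conn.form q w := by subst h; rfl

theorem contDiffOn_pullForm [FiniteDimensional ℝ F] {N : F → P} {O : Set F} (hO : IsOpen O)
    (hN : ContMDiffOn 𝓘(ℝ, F) 𝓘(ℝ, EP) ∞ N O) : ContDiffOn ℝ ∞ (conn.pullForm N) O := by
  rw [contDiffOn_clm_apply]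
  intro a
  rw [← contMDiffOn_iff_contDiffOn]
  have h1 : ContMDiffOn 𝓘(ℝ, F) 𝓘(ℝ, F).tangent ∞
      (fun z => (⟨z, a⟩ : TangentBundle 𝓘(ℝ, F) F)) O :=
    contMDiffOn_vectorSpace_iff_contDiffOn.2 contDiffOn_const
  have h2 := hN.contMDiffOn_tangentMapWithin (m := ∞) (by simp) hO.uniqueMDiffOn
  have h3 := conn.contMDiff_form.comp_contMDiffOn (h2.comp h1 fun z hz => hz)
  refine h3.congr fun z hz => ?_
  simp only [pullForm, Function.comp, tangentMapWithin, mfderivWithin_of_isOpen hO hz]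
  rfl

theorem form_mfderivWithin_eq_pullForm {N : F → P} {z : ℝ → F} {z' : F} {s : Set ℝ} {r : ℝ}
    {c : ℝ → P} (hz : HasDerivWithinAt z z' s r)
    (hN : MDifferentiableAt 𝓘(ℝ, F) 𝓘(ℝ, EP) N (z r))
    (hc : c =ᶠ[𝓝[s] r] N ∘ z) (hcr : c r = N (z r)) (hs : UniqueDiffWithinAt ℝ s r) :
    MDifferentiableWithinAt 𝓘(ℝ, ℝ) 𝓘(ℝ, EP) c s r ∧
    (mfderivWithin 𝓘(ℝ, ℝ) 𝓘(ℝ, EP) c s r (1 : ℝ) : EP) =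
      mfderiv 𝓘(ℝ, F) 𝓘(ℝ, EP) N (z r) z' ∧
    conn.form (c r) (mfderivWithin 𝓘(ℝ, ℝ) 𝓘(ℝ, EP) c s r (1 : ℝ)) = conn.pullForm N (z r) z' := by
  have h0 : HasMFDerivWithinAt 𝓘(ℝ, ℝ) 𝓘(ℝ, F) z s r (ContinuousLinearMap.toSpanSingleton ℝ z') :=
    hz.hasFDerivWithinAt.hasMFDerivWithinAt
  have h1 := (hN.hasMFDerivAt.comp_hasMFDerivWithinAt r h0).congr_of_eventuallyEq hc hcr
  have h2 : (mfderivWithin 𝓘(ℝ, ℝ) 𝓘(ℝ, EP) c s r (1 : ℝ) : EP) =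
      mfderiv 𝓘(ℝ, F) 𝓘(ℝ, EP) N (z r) z' := by
    rw [h1.mfderivWithin hs.uniqueMDiffWithinAt]
    change (mfderiv 𝓘(ℝ, F) 𝓘(ℝ, EP) N (z r)) ((1 : ℝ) • z') = _
    rw [one_smul]
  refine ⟨h1.mdifferentiableWithinAt, h2, ?_⟩
  exact (congrArg (conn.form (c r)) h2).trans (conn.form_congr hcr _)

theorem dform_mfderiv [FiniteDimensional ℝ EP] [FiniteDimensional ℝ F] {N : F → P} {O : Set F}
    (hO : IsOpen O) (hN : ContMDiffOn 𝓘(ℝ, F) 𝓘(ℝ, EP) ∞ N O) {z : F} (hz : z ∈ O) (a b : F) :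
    conn.dform (N z) (mfderiv 𝓘(ℝ, F) 𝓘(ℝ, EP) N z a) (mfderiv 𝓘(ℝ, F) 𝓘(ℝ, EP) N z b) =
      fderiv ℝ (conn.pullForm N) z a b - fderiv ℝ (conn.pullForm N) z b a := by
  set φ := extChartAt 𝓘(ℝ, EP) (N z) with hφ
  set M : F → EP := fun y => φ (N y) with hM
  set Ω := conn.formInChart (N z) with hΩ
  have hNat : ∀ y ∈ O, ContMDiffAt 𝓘(ℝ, F) 𝓘(ℝ, EP) ∞ N y := fun y hy =>
    (hN y hy).contMDiffAt (hO.mem_nhds hy)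
  have hsrc : ∀ᶠ y in 𝓝 z, N y ∈ φ.source :=
    (hNat z hz).continuousAt.eventually (extChartAt_source_mem_nhds (N z))
  have hMs : ∀ y ∈ O, N y ∈ φ.source → ContDiffAt ℝ ∞ M y := fun y hy hy' => by
    rw [← contMDiffAt_iff_contDiffAt]
    exact (contMDiffAt_extChartAt' (by simpa [hφ] using hy')).comp y (hNat y hy)
  have hΩs : ContDiffOn ℝ ∞ Ω φ.target :=
    conn.contDiffOn_pullForm (isOpen_extChartAt_target (N z)) (contMDiffOn_extChartAt_symm (N z))
  have hΩd : DifferentiableAt ℝ Ω (φ (N z)) :=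
    (hΩs.contDiffAt (extChartAt_target_mem_nhds (N z))).differentiableAt (by simp)
  have hMd : ∀ y ∈ O, N y ∈ φ.source → ∀ a : F, (fderiv ℝ M y a : EP) =
      mfderiv 𝓘(ℝ, EP) 𝓘(ℝ, EP) φ (N y) (mfderiv 𝓘(ℝ, F) 𝓘(ℝ, EP) N y a) := by
    intro y hy hy' a
    rw [← mfderiv_eq_fderiv, show M = φ ∘ N from rfl, mfderiv_comp y
      (mdifferentiableAt_extChartAt (by simpa [hφ] using hy'))
      ((hNat y hy).mdifferentiableAt (by simp))]
    rfl
  have hpull : conn.pullForm N =ᶠ[𝓝 z] fun y => (Ω (M y)).comp (fderiv ℝ M y) := by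
    filter_upwards [hsrc, hO.mem_nhds hz] with y hy hyO
    ext a
    have h1 := hMd y hyO hy a
    have hsy : φ.symm (φ (N y)) = N y := φ.left_inv hy
    have hyt : φ (N y) ∈ φ.target := φ.map_source hy
    have h2 : (mfderiv 𝓘(ℝ, EP) 𝓘(ℝ, EP) φ.symm (φ (N y)) (fderiv ℝ M y a) : EP) =
        mfderiv 𝓘(ℝ, F) 𝓘(ℝ, EP) N y a := by
      have h3 : N =ᶠ[𝓝 y] φ.symm ∘ M := by
        filter_upwards [(hNat y hyO).continuousAt.eventually
          ((isOpen_extChartAt_source (N z)).mem_nhds hy)] with w hw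
        exact (φ.left_inv hw).symm
      have hs : MDifferentiableAt 𝓘(ℝ, EP) 𝓘(ℝ, EP) φ.symm (M y) :=
        ((contMDiffOn_extChartAt_symm (N z)).contMDiffAt
          ((isOpen_extChartAt_target (N z)).mem_nhds hyt)).mdifferentiableAt (n := ∞) (by simp)
      have h4 : mfderiv 𝓘(ℝ, F) 𝓘(ℝ, EP) N y = _ := h3.mfderiv_eq.trans (mfderiv_comp y hs
        ((hMs y hyO hy).differentiableAt (by simp)).mdifferentiableAt)
      have h5 := congrArg (fun T => T a) h4
      refine Eq.trans ?_ h5.symm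
      rw [← mfderiv_eq_fderiv]
      rfl
    exact (conn.form_congr hsy.symm _).trans (congrArg (conn.form (φ.symm (φ (N y)))) h2.symm)
  have hz' : N z ∈ φ.source := mem_extChartAt_source (N z)
  have hM2 := hMs z hz hz'
  have hD : HasFDerivAt (fun y => (Ω (M y)).comp (fderiv ℝ M y)) _ z :=
    (hΩd.hasFDerivAt.comp z (hM2.differentiableAt (by simp)).hasFDerivAt).clm_comp
      ((hM2.fderiv_right (m := 1) (by exact WithTop.coe_le_coe.2 le_top)).differentiableAt (by simp)).hasFDerivAt
  have hsym : fderiv ℝ (fderiv ℝ M) z a b = fderiv ℝ (fderiv ℝ M) z b a :=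
    (hM2.isSymmSndFDerivAt
      (by rw [minSmoothness_of_isRCLikeNormedField]; exact WithTop.coe_le_coe.2 le_top)) a b
  rw [hpull.fderiv_eq, hD.fderiv]
  refine (extDeriv_ofSubsingleton_apply hΩd _ _).trans ?_
  rw [← hMd z hz hz' a, ← hMd z hz hz' b]
  simp [hsym]

end PrincipalConnection

end Bundle

theorem toSpanSingleton_apply_one {E : Type*} [NormedAddCommGroup E] [NormedSpace ℝ E] (v : E) :
    ContinuousLinearMap.toSpanSingleton ℝ v (1 : ℝ) = v := by simp

theorem eq_toSpanSingleton {E : Type*} [NormedAddCommGroup E] [NormedSpace ℝ E] (T : ℝ →L[ℝ] E) :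
    T = ContinuousLinearMap.toSpanSingleton ℝ (T 1) :=
  ContinuousLinearMap.ext_ring (by simp)

section Bundle

variable {EB : Type*} [NormedAddCommGroup EB] [NormedSpace ℝ EB]
  {B : Type*} [TopologicalSpace B] [ChartedSpace EB B]
  {EP : Type*} [NormedAddCommGroup EP] [NormedSpace ℝ EP]
  {P : Type*} [TopologicalSpace P] [ChartedSpace EP P]
  {EG : Type*} [NormedAddCommGroup EG] [NormedSpace ℝ EG]
  {G : Type*} [TopologicalSpace G] [ChartedSpace EG G] [Group G]
  {Q : PrincipalBundle EB B EP P EG G}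

open Filter Topology

namespace PrincipalBundle

variable (Q)

theorem mdifferentiableAt_act_left (p : P) (g : G) :
    MDifferentiableAt 𝓘(ℝ, EP) 𝓘(ℝ, EP) (fun q => Q.act q g) p :=
  ((Q.contMDiff_act.comp (contMDiff_id.prodMk contMDiff_const)).mdifferentiable (n := ∞) (by simp)) p

theorem mdifferentiableAt_act_right (p : P) (g : G) :
    MDifferentiableAt 𝓘(ℝ, EG) 𝓘(ℝ, EP) (fun h => Q.act p h) g :=
  ((Q.contMDiff_act.comp (contMDiff_const.prodMk contMDiff_id)).mdifferentiable (n := ∞) (by simp)) g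

theorem hasMFDerivWithinAt_act {c : ℝ → P} {g : ℝ → G} {s : Set ℝ} {t : ℝ} {c' : EP} {g' : EG}
    (hc : HasMFDerivWithinAt 𝓘(ℝ, ℝ) 𝓘(ℝ, EP) c s t (ContinuousLinearMap.toSpanSingleton ℝ c'))
    (hg : HasMFDerivWithinAt 𝓘(ℝ, ℝ) 𝓘(ℝ, EG) g s t (ContinuousLinearMap.toSpanSingleton ℝ g')) :
    HasMFDerivWithinAt 𝓘(ℝ, ℝ) 𝓘(ℝ, EP) (fun t => Q.act (c t) (g t)) s t
      (ContinuousLinearMap.toSpanSingleton ℝ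
        ((mfderiv 𝓘(ℝ, EP) 𝓘(ℝ, EP) (fun q => Q.act q (g t)) (c t) c' : EP) +
          (mfderiv 𝓘(ℝ, EG) 𝓘(ℝ, EP) (fun h => Q.act (c t) h) (g t) g' : EP))) := by
  have hA : MDifferentiableAt (𝓘(ℝ, EP).prod 𝓘(ℝ, EG)) 𝓘(ℝ, EP)
      (fun x : P × G => Q.act x.1 x.2) (c t, g t) :=
    (Q.contMDiff_act.mdifferentiable (by simp)) _
  have h1 := hA.hasMFDerivAt.comp_hasMFDerivWithinAt t (hc.prodMk hg)
  have e : ((ContinuousLinearMap.toSpanSingleton ℝ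
        ((mfderiv 𝓘(ℝ, EP) 𝓘(ℝ, EP) (fun q => Q.act q (g t)) (c t) c' : EP) +
          (mfderiv 𝓘(ℝ, EG) 𝓘(ℝ, EP) (fun h => Q.act (c t) h) (g t) g' : EP))) : ℝ →L[ℝ] EP) =
      (mfderiv (𝓘(ℝ, EP).prod 𝓘(ℝ, EG)) 𝓘(ℝ, EP)
        (fun x : P × G => Q.act x.1 x.2) (c t, g t)).comp
        ((ContinuousLinearMap.toSpanSingleton ℝ c').prod
          (ContinuousLinearMap.toSpanSingleton ℝ g')) := by
    refine ContinuousLinearMap.ext_ring ?_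
    have h2 := mfderiv_prod_eq_add_apply (v := ((c', g') : EP × EG)) hA
    refine Eq.trans ?_ (Eq.trans h2.symm ?_)
    · exact toSpanSingleton_apply_one _
    · have h3 : ((c', g') : EP × EG) = (ContinuousLinearMap.toSpanSingleton ℝ c' (1 : ℝ),
          ContinuousLinearMap.toSpanSingleton ℝ g' (1 : ℝ)) := by simp
      exact congrArg (mfderiv (𝓘(ℝ, EP).prod 𝓘(ℝ, EG)) 𝓘(ℝ, EP)
        (fun x : P × G => Q.act x.1 x.2) (c t, g t)) h3
  exact e ▸ h1

/-- A function with values in the structure group is as differentiable as the two curves which it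
relates. -/
theorem mdifferentiableWithinAt_of_act_eq [LieGroup 𝓘(ℝ, EG) ∞ G] {c d : ℝ → P} {g : ℝ → G}
    {s : Set ℝ} {t : ℝ}
    (hc : MDifferentiableWithinAt 𝓘(ℝ, ℝ) 𝓘(ℝ, EP) c s t)
    (hd : MDifferentiableWithinAt 𝓘(ℝ, ℝ) 𝓘(ℝ, EP) d s t) (ht : t ∈ s)
    (h : ∀ᶠ r in 𝓝[s] t, Q.act (c r) (g r) = d r) :
    MDifferentiableWithinAt 𝓘(ℝ, ℝ) 𝓘(ℝ, EG) g s t := by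
  obtain ⟨U, e, hU, hb, hes, het, he, he', hfst, hact⟩ := Q.exists_trivialization (Q.proj (c t))
  have hpr : Q.proj (d t) = Q.proj (c t) := by
    rw [← h.self_of_nhdsWithin ht, Q.proj_act]
  have hcs : c t ∈ e.source := by rw [hes]; exact hb
  have hds : d t ∈ e.source := by rw [hes]; simpa [hpr] using hb
  have hdiff : ∀ p ∈ e.source, MDifferentiableAt 𝓘(ℝ, EP) (𝓘(ℝ, EB).prod 𝓘(ℝ, EG)) e p :=
    fun p hp => ((he p hp).contMDiffAt (e.open_source.mem_nhds hp)).mdifferentiableAt (by simp)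
  have h1 : MDifferentiableWithinAt 𝓘(ℝ, ℝ) 𝓘(ℝ, EG) (fun r => (e (c r)).2) s t :=
    mdifferentiableAt_snd.comp_mdifferentiableWithinAt t
      ((hdiff _ hcs).comp_mdifferentiableWithinAt t hc)
  have h2 : MDifferentiableWithinAt 𝓘(ℝ, ℝ) 𝓘(ℝ, EG) (fun r => (e (d r)).2) s t :=
    mdifferentiableAt_snd.comp_mdifferentiableWithinAt t
      ((hdiff _ hds).comp_mdifferentiableWithinAt t hd)
  have hdiv : MDifferentiableAt (𝓘(ℝ, EG).prod 𝓘(ℝ, EG)) 𝓘(ℝ, EG)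
      (fun x : G × G => x.1⁻¹ * x.2) ((e (c t)).2, (e (d t)).2) :=
    (((contMDiff_fst.inv).mul contMDiff_snd).mdifferentiable (n := ∞) (by simp)) _
  have h3 := hdiv.comp_mdifferentiableWithinAt t (h1.prodMk h2)
  have h4 : ∀ᶠ r in 𝓝[s] t, g r = (e (c r)).2⁻¹ * (e (d r)).2 := by
    filter_upwards [h, hc.continuousWithinAt.eventually (e.open_source.mem_nhds hcs)] with r hr hrs
    rw [← hr, hact _ hrs]
    simp
  exact h3.congr_of_eventuallyEq h4 (h4.self_of_nhdsWithin ht)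

theorem act_left_cancel {p : P} {g h : G} (hgh : Q.act p g = Q.act p h) : g = h :=
  (Q.existsUnique_act p (Q.act p h) (Q.proj_act p h).symm).unique hgh rfl

theorem exists_act {p q : P} (h : Q.proj p = Q.proj q) : ∃ g, Q.act p g = q :=
  (Q.existsUnique_act p q h).exists

end PrincipalBundle

section LieGroup

variable [LieGroup 𝓘(ℝ, EG) ∞ G]

theorem mdifferentiableAt_mul_right_const (g x : G) :
    MDifferentiableAt 𝓘(ℝ, EG) 𝓘(ℝ, EG) (fun y : G => y * g) x :=
  ((contMDiff_mul_right (I := 𝓘(ℝ, EG)) (n := ∞) (a := g)).mdifferentiable (by simp)) x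

theorem mdifferentiableAt_conj (g x : G) :
    MDifferentiableAt 𝓘(ℝ, EG) 𝓘(ℝ, EG) (fun y : G => g * y * g⁻¹) x :=
  ((((contMDiff_mul_right (I := 𝓘(ℝ, EG)) (n := ∞) (a := g⁻¹))).comp
    (contMDiff_mul_left (I := 𝓘(ℝ, EG)) (n := ∞) (a := g))).mdifferentiable (by simp)) x

theorem exists_mfderiv_mul_right_eq (g : G) (w : EG) : ∃ η : EG,
    (mfderiv 𝓘(ℝ, EG) 𝓘(ℝ, EG) (fun x : G => x * g) 1 η : EG) = w := by
  have h1 : HasMFDerivAt 𝓘(ℝ, EG) 𝓘(ℝ, EG) (fun x : G => x * g) (g * g⁻¹) _ :=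
    (mdifferentiableAt_mul_right_const g (g * g⁻¹)).hasMFDerivAt
  have h2 := h1.comp g (mdifferentiableAt_mul_right_const g⁻¹ g).hasMFDerivAt
  have h3 : (fun x : G => x * g) ∘ (fun y : G => y * g⁻¹) = id := by ext x; simp
  rw [h3] at h2
  have h4 := congrArg (fun T : EG →L[ℝ] EG => T w) (hasMFDerivAt_unique h2 (hasMFDerivAt_id g))
  refine ⟨(mfderiv 𝓘(ℝ, EG) 𝓘(ℝ, EG) (fun y : G => y * g⁻¹) g w : EG), ?_⟩
  refine Eq.trans ?_ h4
  have key : ∀ x : G, x = 1 → ∀ v : EG, (mfderiv 𝓘(ℝ, EG) 𝓘(ℝ, EG) (fun x : G => x * g) 1 v : EG) =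
      (mfderiv 𝓘(ℝ, EG) 𝓘(ℝ, EG) (fun x : G => x * g) x v : EG) := by rintro x rfl v; rfl
  exact key _ (mul_inv_cancel g) _

theorem adjointAction_eq_zero {g : G} {X : EG} (h : adjointAction EG g X = 0) : X = 0 := by
  have h1 := (mdifferentiableAt_conj (EG := EG) g⁻¹ (g * 1 * g⁻¹)).hasMFDerivAt
  have h2 := h1.comp 1 (mdifferentiableAt_conj (EG := EG) g 1).hasMFDerivAt
  have h3 : (fun x : G => g⁻¹ * x * g⁻¹⁻¹) ∘ (fun x : G => g * x * g⁻¹) = id := by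
    ext x; simp [mul_assoc]
  rw [h3] at h2
  have h4 := congrArg (fun T : EG →L[ℝ] EG => T X) (hasMFDerivAt_unique h2 (hasMFDerivAt_id 1))
  refine Eq.trans h4.symm ?_
  exact (congrArg (mfderiv 𝓘(ℝ, EG) 𝓘(ℝ, EG) (fun x : G => g⁻¹ * x * g⁻¹⁻¹) (g * 1 * g⁻¹) :
    EG →L[ℝ] EG) h).trans (map_zero _)

end LieGroup

namespace PrincipalConnection

variable [IsManifold 𝓘(ℝ, EP) ∞ P] (conn : PrincipalConnection Q)

theorem form_mfderiv_orbit [LieGroup 𝓘(ℝ, EG) ∞ G] (p : P) (g : G) (η : EG) :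
    conn.form (Q.act p g) (mfderiv 𝓘(ℝ, EG) 𝓘(ℝ, EP) (fun h => Q.act p h) g
      (mfderiv 𝓘(ℝ, EG) 𝓘(ℝ, EG) (fun x : G => x * g) 1 η : EG)) = adjointAction EG g⁻¹ η := by
  have h1 : HasMFDerivAt 𝓘(ℝ, EG) 𝓘(ℝ, EP) (fun h => Q.act p h) (1 * g) _ :=
    (Q.mdifferentiableAt_act_right p (1 * g)).hasMFDerivAt
  have h2 := h1.comp 1 (mdifferentiableAt_mul_right_const (EG := EG) g 1).hasMFDerivAt
  have h3 := (Q.mdifferentiableAt_act_left (Q.act p 1) g).hasMFDerivAt.comp 1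
    (Q.mdifferentiableAt_act_right p 1).hasMFDerivAt
  have h4 : (fun h => Q.act p h) ∘ (fun x : G => x * g) =
      (fun q => Q.act q g) ∘ (fun h => Q.act p h) := by ext x; simp [Q.act_mul]
  rw [h4] at h2
  have h5 := congrArg (fun T : EG →L[ℝ] EP => T η) (hasMFDerivAt_unique h2 h3)
  have key : ∀ x : G, x = g → ∀ v : EG,
      (mfderiv 𝓘(ℝ, EG) 𝓘(ℝ, EP) (fun h => Q.act p h) g v : EP) =
      (mfderiv 𝓘(ℝ, EG) 𝓘(ℝ, EP) (fun h => Q.act p h) x v : EP) := by rintro x rfl v; rfl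
  have h6 := (key _ (one_mul g) (mfderiv 𝓘(ℝ, EG) 𝓘(ℝ, EG) (fun x : G => x * g) 1 η : EG)).trans h5
  have h7 := conn.form_act (Q.act p 1) g (mfderiv 𝓘(ℝ, EG) 𝓘(ℝ, EP) (fun h => Q.act p h) 1 η)
  rw [conn.form_fundamental p η] at h7
  refine Eq.trans ?_ h7
  refine (congrArg (conn.form (Q.act p g)) h6).trans ?_
  exact conn.form_congr (by rw [Q.act_one]) _

theorem form_mfderivWithin_act [LieGroup 𝓘(ℝ, EG) ∞ G] {c : ℝ → P} {g : ℝ → G} {s : Set ℝ} {t : ℝ}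
    {η : EG} (hs : UniqueDiffWithinAt ℝ s t)
    (hc : MDifferentiableWithinAt 𝓘(ℝ, ℝ) 𝓘(ℝ, EP) c s t)
    (hg : HasMFDerivWithinAt 𝓘(ℝ, ℝ) 𝓘(ℝ, EG) g s t (ContinuousLinearMap.toSpanSingleton ℝ
      (mfderiv 𝓘(ℝ, EG) 𝓘(ℝ, EG) (fun x : G => x * g t) 1 η : EG))) :
    MDifferentiableWithinAt 𝓘(ℝ, ℝ) 𝓘(ℝ, EP) (fun t => Q.act (c t) (g t)) s t ∧
    conn.form (Q.act (c t) (g t))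
      (mfderivWithin 𝓘(ℝ, ℝ) 𝓘(ℝ, EP) (fun t => Q.act (c t) (g t)) s t (1 : ℝ)) =
      adjointAction EG (g t)⁻¹
        (conn.form (c t) (mfderivWithin 𝓘(ℝ, ℝ) 𝓘(ℝ, EP) c s t (1 : ℝ)) + η) := by
  set c' : EP := mfderivWithin 𝓘(ℝ, ℝ) 𝓘(ℝ, EP) c s t (1 : ℝ) with hc'
  have e : (mfderivWithin 𝓘(ℝ, ℝ) 𝓘(ℝ, EP) c s t : ℝ →L[ℝ] EP) =
      ContinuousLinearMap.toSpanSingleton ℝ c' := eq_toSpanSingleton (E := EP) _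
  have h1 : HasMFDerivWithinAt 𝓘(ℝ, ℝ) 𝓘(ℝ, EP) c s t (ContinuousLinearMap.toSpanSingleton ℝ c') :=
    e ▸ hc.hasMFDerivWithinAt
  have h2 := Q.hasMFDerivWithinAt_act h1 hg
  refine ⟨h2.mdifferentiableWithinAt, ?_⟩
  have h3 : (mfderivWithin 𝓘(ℝ, ℝ) 𝓘(ℝ, EP) (fun t => Q.act (c t) (g t)) s t (1 : ℝ) : EP) =
      ((mfderiv 𝓘(ℝ, EP) 𝓘(ℝ, EP) (fun q => Q.act q (g t)) (c t) c' : EP) +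
          (mfderiv 𝓘(ℝ, EG) 𝓘(ℝ, EP) (fun h => Q.act (c t) h) (g t)
            (mfderiv 𝓘(ℝ, EG) 𝓘(ℝ, EG) (fun x : G => x * g t) 1 η : EG) : EP)) := by
    rw [h2.mfderivWithin hs.uniqueMDiffWithinAt]
    exact toSpanSingleton_apply_one (E := EP) _
  refine (congrArg (conn.form (Q.act (c t) (g t))) h3).trans ?_
  refine (map_add (conn.form (Q.act (c t) (g t))) _ _).trans ?_
  rw [map_add]
  exact congrArg₂ (· + ·) (conn.form_act (c t) (g t) c') (conn.form_mfderiv_orbit (c t) (g t) η)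

end PrincipalConnection

end Bundle

theorem toSpanSingleton_map_zero {E : Type*} [NormedAddCommGroup E] [NormedSpace ℝ E]
    (T : E →L[ℝ] E) : ContinuousLinearMap.toSpanSingleton ℝ (T 0) = 0 := by simp

section Bundle

variable {EB : Type*} [NormedAddCommGroup EB] [NormedSpace ℝ EB]
  {B : Type*} [TopologicalSpace B] [ChartedSpace EB B]
  {EP : Type*} [NormedAddCommGroup EP] [NormedSpace ℝ EP]
  {P : Type*} [TopologicalSpace P] [ChartedSpace EP P]
  {EG : Type*} [NormedAddCommGroup EG] [NormedSpace ℝ EG]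
  {G : Type*} [TopologicalSpace G] [ChartedSpace EG G] [Group G]
  {Q : PrincipalBundle EB B EP P EG G}

open Filter Topology

theorem eventually_eq_of_hasMFDerivWithinAt_zero [IsManifold 𝓘(ℝ, EP) ∞ P] {g : ℝ → P} {I : Set ℝ}
    {t : ℝ} (hI : Convex ℝ I) (ht : t ∈ I) (h : ∀ᶠ s in 𝓝[I] t, HasMFDerivWithinAt 𝓘(ℝ, ℝ) 𝓘(ℝ, EP) g I s
      (0 : ℝ →L[ℝ] EP)) : ∀ᶠ s in 𝓝[I] t, g s = g t := by
  set φ := extChartAt 𝓘(ℝ, EP) (g t)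
  have hsrc : ∀ᶠ s in 𝓝[I] t, g s ∈ φ.source :=
    (h.self_of_nhdsWithin ht).continuousWithinAt.eventually (extChartAt_source_mem_nhds (g t))
  have h2 := h.and hsrc
  rw [eventually_nhdsWithin_iff, Metric.eventually_nhds_iff_ball] at h2
  obtain ⟨ε, hε, hb⟩ := h2
  rw [eventually_nhdsWithin_iff, Metric.eventually_nhds_iff_ball]
  refine ⟨ε, hε, fun s hs hsI => ?_⟩
  have hd : ∀ r ∈ Metric.ball t ε ∩ I,
      HasFDerivWithinAt (φ ∘ g) (0 : ℝ →L[ℝ] EP) (Metric.ball t ε ∩ I) r := by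
    intro r hr
    obtain ⟨h3, h4⟩ := hb r hr.1 hr.2
    have h5 := (mdifferentiableAt_extChartAt (I := 𝓘(ℝ, EP)) (x := g t) (y := g r)
      (by simpa [φ] using h4)).hasMFDerivAt.comp_hasMFDerivWithinAt r h3
    have h6 := h5.hasFDerivWithinAt.mono (inter_subset_right : Metric.ball t ε ∩ I ⊆ I)
    refine h6.congr_fderiv (ContinuousLinearMap.ext fun v => ?_)
    exact map_zero (mfderiv 𝓘(ℝ, EP) 𝓘(ℝ, EP) φ (g r))
  have h7 := ((convex_ball t ε).inter hI).norm_image_sub_le_of_norm_hasFDerivWithin_le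
    (C := 0) hd (fun r hr => by simp) ⟨Metric.mem_ball_self hε, ht⟩ ⟨hs, hsI⟩
  rw [zero_mul, norm_le_zero_iff, sub_eq_zero] at h7
  exact φ.injOn (hb s hs hsI).2 (hb t (Metric.mem_ball_self hε) ht).2 h7

theorem hasMFDerivWithinAt_congr_deriv {c : ℝ → P} {s : Set ℝ} {t : ℝ} {a b : ℝ →L[ℝ] EP}
    (h : HasMFDerivWithinAt 𝓘(ℝ, ℝ) 𝓘(ℝ, EP) c s t a) (e : a = b) :
    HasMFDerivWithinAt 𝓘(ℝ, ℝ) 𝓘(ℝ, EP) c s t b := e ▸ h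

theorem uniqueDiffWithinAt_Icc_zero_one {t : ℝ} (ht : t ∈ Icc (0 : ℝ) 1) :
    UniqueDiffWithinAt ℝ (Icc (0 : ℝ) 1) t := uniqueDiffOn_Icc_zero_one t ht

theorem velocity_congr {c d : ℝ → P} {t : ℝ} (ht : t ∈ Icc (0 : ℝ) 1)
    (h : c =ᶠ[𝓝[Icc 0 1] t] d) : (velocity c t : EP) = (velocity d t : EP) :=
  congrArg (fun T : ℝ →L[ℝ] EP => T 1) (h.mfderivWithin_eq (h.self_of_nhdsWithin ht))

namespace PrincipalConnection

variable [IsManifold 𝓘(ℝ, EP) ∞ P] (conn : PrincipalConnection Q)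

/-- `c` is a horizontal curve over `γ` at time `t`. -/
structure IsHorizontalAt (γ : ℝ → B) (c : ℝ → P) (t : ℝ) : Prop where
  proj_eq : Q.proj (c t) = γ t
  mdifferentiableWithinAt : MDifferentiableWithinAt 𝓘(ℝ, ℝ) 𝓘(ℝ, EP) c (Icc 0 1) t
  horizontal : conn.form (c t) (velocity c t) = 0

variable {conn}

theorem isHorizontalLift_iff {γ : ℝ → B} {c : ℝ → P} :
    conn.IsHorizontalLift γ c ↔ ∀ t ∈ Icc (0 : ℝ) 1, conn.IsHorizontalAt γ c t :=
  ⟨fun h t ht => ⟨h.1 t ht, h.2 t ht, h.3 t ht⟩,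
    fun h => ⟨fun t ht => (h t ht).1, fun t ht => (h t ht).2, fun t ht => (h t ht).3⟩⟩

theorem form_velocity_congr {c d : ℝ → P} {t : ℝ} (ht : t ∈ Icc (0 : ℝ) 1)
    (h : c =ᶠ[𝓝[Icc 0 1] t] d) :
    conn.form (c t) (velocity c t) = conn.form (d t) (velocity d t) :=
  (congrArg (conn.form (c t)) (velocity_congr (d := d) ht h)).trans
    (conn.form_congr (h.self_of_nhdsWithin ht) _)

theorem IsHorizontalAt.congr {γ : ℝ → B} {c d : ℝ → P} {t : ℝ} (ht : t ∈ Icc (0 : ℝ) 1)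
    (hc : conn.IsHorizontalAt γ c t) (h : d =ᶠ[𝓝[Icc 0 1] t] c) : conn.IsHorizontalAt γ d t :=
  ⟨by rw [h.self_of_nhdsWithin ht, hc.1],
    hc.2.congr_of_eventuallyEq h (h.self_of_nhdsWithin ht),
    (form_velocity_congr ht h).trans hc.3⟩

/-- If `c · g` is horizontal then `g' = - ω(c') g`. -/
theorem IsHorizontalAt.hasMFDerivWithinAt_of_act_eq [LieGroup 𝓘(ℝ, EG) ∞ G] {γ : ℝ → B}
    {c d : ℝ → P} {g : ℝ → G} {t : ℝ} (hd : conn.IsHorizontalAt γ d t) (ht : t ∈ Icc (0 : ℝ) 1)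
    (hc : MDifferentiableWithinAt 𝓘(ℝ, ℝ) 𝓘(ℝ, EP) c (Icc 0 1) t)
    (h : ∀ᶠ s in 𝓝[Icc 0 1] t, Q.act (c s) (g s) = d s) :
    HasMFDerivWithinAt 𝓘(ℝ, ℝ) 𝓘(ℝ, EG) g (Icc 0 1) t (ContinuousLinearMap.toSpanSingleton ℝ
      (mfderiv 𝓘(ℝ, EG) 𝓘(ℝ, EG) (fun x : G => x * g t) 1
        (-conn.form (c t) (velocity c t) : EG) : EG)) := by
  have hg := (Q.mdifferentiableWithinAt_of_act_eq hc hd.2 ht h).hasMFDerivWithinAt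
  obtain ⟨η, hη⟩ := exists_mfderiv_mul_right_eq (EG := EG) (g t)
    (mfderivWithin 𝓘(ℝ, ℝ) 𝓘(ℝ, EG) g (Icc 0 1) t (1 : ℝ))
  have hg' := hasMFDerivWithinAt_congr_deriv hg
    ((eq_toSpanSingleton (E := EG) _).trans (congrArg _ hη.symm))
  have h1 := conn.form_mfderivWithin_act (uniqueDiffWithinAt_Icc_zero_one ht) hc hg'
  have h2 : conn.form (Q.act (c t) (g t)) (velocity (fun s => Q.act (c s) (g s)) t) = 0 :=
    (form_velocity_congr ht h).trans hd.3
  have h5 := adjointAction_eq_zero (h1.2.symm.trans h2)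
  have h6 : η = -conn.form (c t) (velocity c t) := eq_neg_of_add_eq_zero_right h5
  rw [h6] at hg'
  exact hg'

theorem hasMFDerivWithinAt_zero_of_horizontal [LieGroup 𝓘(ℝ, EG) ∞ G] {γ : ℝ → B} {c d : ℝ → P}
    {g : ℝ → G} {t : ℝ} (ht : t ∈ Icc (0 : ℝ) 1) (hc : conn.IsHorizontalAt γ c t)
    (hd : conn.IsHorizontalAt γ d t) (h : ∀ᶠ s in 𝓝[Icc 0 1] t, Q.act (c s) (g s) = d s) :
    HasMFDerivWithinAt 𝓘(ℝ, ℝ) 𝓘(ℝ, EG) g (Icc 0 1) t (0 : ℝ →L[ℝ] EG) := by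
  have h1 := hd.hasMFDerivWithinAt_of_act_eq ht hc.2 h
  rw [hc.3, neg_zero] at h1
  exact hasMFDerivWithinAt_congr_deriv h1 (toSpanSingleton_map_zero (E := EG) _)

/-- If `g' = - ω(c') g` then `c · g` is horizontal. -/
theorem isHorizontalAt_act [LieGroup 𝓘(ℝ, EG) ∞ G] {γ : ℝ → B} {c : ℝ → P} {g : ℝ → G} {t : ℝ}
    (ht : t ∈ Icc (0 : ℝ) 1) (hp : Q.proj (c t) = γ t)
    (hc : MDifferentiableWithinAt 𝓘(ℝ, ℝ) 𝓘(ℝ, EP) c (Icc 0 1) t)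
    (hg : HasMFDerivWithinAt 𝓘(ℝ, ℝ) 𝓘(ℝ, EG) g (Icc 0 1) t (ContinuousLinearMap.toSpanSingleton ℝ
      (mfderiv 𝓘(ℝ, EG) 𝓘(ℝ, EG) (fun x : G => x * g t) 1
        (-conn.form (c t) (velocity c t) : EG) : EG))) :
    conn.IsHorizontalAt γ (fun s => Q.act (c s) (g s)) t := by
  have h1 := conn.form_mfderivWithin_act (uniqueDiffWithinAt_Icc_zero_one ht) hc hg
  refine ⟨by rw [Q.proj_act, hp], h1.1, h1.2.trans ?_⟩
  have h2 : conn.form (c t) (mfderivWithin 𝓘(ℝ, ℝ) 𝓘(ℝ, EP) c (Icc 0 1) t (1 : ℝ)) +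
    -conn.form (c t) (velocity c t) = 0 := add_neg_cancel _
  exact (congrArg _ h2).trans (map_zero _)

theorem IsHorizontalAt.act [LieGroup 𝓘(ℝ, EG) ∞ G] {γ : ℝ → B} {c : ℝ → P} {t : ℝ}
    (ht : t ∈ Icc (0 : ℝ) 1) (hc : conn.IsHorizontalAt γ c t) (g : G) :
    conn.IsHorizontalAt γ (fun s => Q.act (c s) g) t := by
  refine isHorizontalAt_act (g := fun _ => g) ht hc.1 hc.2 ?_
  rw [hc.3, neg_zero]
  exact hasMFDerivWithinAt_congr_deriv (hasMFDerivWithinAt_const g _ _)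
    (toSpanSingleton_map_zero (E := EG) _).symm

/-- Horizontal lifts are determined by their value at one time. -/
theorem IsHorizontalAt.eqOn [LieGroup 𝓘(ℝ, EG) ∞ G] {γ : ℝ → B} {c d : ℝ → P} {K : Set ℝ}
    (hK : IsPreconnected K) (hKI : K ⊆ Icc 0 1) (hKo : ∀ t ∈ K, K ∈ 𝓝[Icc 0 1] t)
    (hc : ∀ t ∈ K, conn.IsHorizontalAt γ c t) (hd : ∀ t ∈ K, conn.IsHorizontalAt γ d t)
    {m : ℝ} (hm : m ∈ K) (hcd : c m = d m) : EqOn c d K := by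
  have hex : ∀ t ∈ K, ∃ g, Q.act (c t) g = d t := fun t ht =>
    Q.exists_act (by rw [(hc t ht).1, (hd t ht).1])
  choose! g hg using hex
  have : IsManifold 𝓘(ℝ, EG) ∞ G := inferInstance
  have hloc : ∀ t ∈ K, ∀ᶠ s in 𝓝[K] t, g t = g s := by
    intro t ht
    have h1 : ∀ᶠ s in 𝓝[Icc 0 1] t, HasMFDerivWithinAt 𝓘(ℝ, ℝ) 𝓘(ℝ, EG) g (Icc 0 1) s
        (0 : ℝ →L[ℝ] EG) := by
      filter_upwards [hKo t ht] with s hs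
      exact hasMFDerivWithinAt_zero_of_horizontal (hKI hs) (hc s hs) (hd s hs)
        (by filter_upwards [hKo s hs] with r hr using hg r hr)
    have h2 := eventually_eq_of_hasMFDerivWithinAt_zero (convex_Icc 0 1) (hKI ht) h1
    filter_upwards [nhdsWithin_mono t hKI h2] with s hs using hs.symm
  intro t ht
  have h3 : g m = g t := hK.induction₂ (fun x y => g x = g y) hloc
    (fun x y z _ _ _ h h' => h.trans h') (fun x y _ _ h => h.symm) hm ht
  have h4 : g m = 1 := Q.act_left_cancel (p := c m) (by rw [hg m hm, Q.act_one, hcd])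
  rw [← hg t ht, ← h3, h4, Q.act_one]

theorem IsHorizontalLift.eqOn [LieGroup 𝓘(ℝ, EG) ∞ G] {γ : ℝ → B} {c d : ℝ → P}
    (hc : conn.IsHorizontalLift γ c) (hd : conn.IsHorizontalLift γ d) {m : ℝ}
    (hm : m ∈ Icc (0 : ℝ) 1) (hcd : c m = d m) : EqOn c d (Icc 0 1) :=
  IsHorizontalAt.eqOn isPreconnected_Icc subset_rfl (fun _ _ => self_mem_nhdsWithin)
    (isHorizontalLift_iff.1 hc) (isHorizontalLift_iff.1 hd) hm hcd

theorem IsHorizontalLift.act [LieGroup 𝓘(ℝ, EG) ∞ G] {γ : ℝ → B} {c : ℝ → P}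
    (hc : conn.IsHorizontalLift γ c) (g : G) :
    conn.IsHorizontalLift γ (fun s => Q.act (c s) g) :=
  isHorizontalLift_iff.2 fun t ht => (isHorizontalLift_iff.1 hc t ht).act ht g

/-- Local horizontal lifts can be patched together to a horizontal lift through a given point. -/
theorem exists_isHorizontalLift_of_local [LieGroup 𝓘(ℝ, EG) ∞ G] {γ : ℝ → B}
    (h : ∀ m ∈ Icc (0 : ℝ) 1, ∃ ε > 0, ∃ c : ℝ → P, ∀ t ∈ Icc (0 : ℝ) 1, |t - m| < ε →
      conn.IsHorizontalAt γ c t) {m : ℝ} (hm : m ∈ Icc (0 : ℝ) 1) {p : P} (hp : Q.proj p = γ m) :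
    ∃ c : ℝ → P, conn.IsHorizontalLift γ c ∧ c m = p := by
  have key : ∃ l u : ℝ, 0 ∈ Ioo l u ∧ 1 ∈ Ioo l u ∧ ∃ c : ℝ → P,
      ∀ t ∈ Ioo l u ∩ Icc 0 1, conn.IsHorizontalAt γ c t := by
    refine (isPreconnected_Icc (a := (0 : ℝ)) (b := 1)).induction₂ (fun x y => ∃ l u : ℝ, x ∈ Ioo l u ∧
      y ∈ Ioo l u ∧ ∃ c : ℝ → P, ∀ t ∈ Ioo l u ∩ Icc 0 1, conn.IsHorizontalAt γ c t) ?_ ?_ ?_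
      (left_mem_Icc.2 zero_le_one) (right_mem_Icc.2 zero_le_one)
    · intro x hx
      obtain ⟨ε, hε, c, hc⟩ := h x hx
      have h1 : Ioo (x - ε) (x + ε) ∈ 𝓝[Icc 0 1] x :=
        mem_nhdsWithin_of_mem_nhds (Ioo_mem_nhds (by linarith) (by linarith))
      filter_upwards [h1] with y hy
      refine ⟨x - ε, x + ε, ⟨by linarith, by linarith⟩, hy, c, fun t ht => hc t ht.2 ?_⟩
      rw [abs_lt]
      constructor <;> linarith [ht.1.1, ht.1.2]
    · rintro x y z hx hy hz ⟨l₁, u₁, hx₁, hy₁, c₁, hc₁⟩ ⟨l₂, u₂, hy₂, hz₂, c₂, hc₂⟩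
      obtain ⟨g, hg⟩ := Q.exists_act (p := c₂ y) (q := c₁ y)
        (by rw [(hc₁ y ⟨hy₁, hy⟩).1, (hc₂ y ⟨hy₂, hy⟩).1])
      have hc₂' : ∀ t ∈ Ioo l₂ u₂ ∩ Icc 0 1,
          conn.IsHorizontalAt γ (fun s => Q.act (c₂ s) g) t := fun t ht => (hc₂ t ht).act ht.2 g
      have heq : EqOn c₁ (fun s => Q.act (c₂ s) g) ((Ioo l₁ u₁ ∩ Ioo l₂ u₂) ∩ Icc 0 1) := by
        refine IsHorizontalAt.eqOn (γ := γ) (conn := conn) ?_ inter_subset_right ?_ (fun t ht => hc₁ t ⟨ht.1.1, ht.2⟩)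
          (fun t ht => hc₂' t ⟨ht.1.2, ht.2⟩) (m := y) ⟨⟨hy₁, hy₂⟩, hy⟩ hg.symm
        · exact ((ordConnected_Ioo.inter ordConnected_Ioo).inter ordConnected_Icc).isPreconnected
        · intro t ht
          exact inter_mem (mem_nhdsWithin_of_mem_nhds ((isOpen_Ioo.inter isOpen_Ioo).mem_nhds ht.1))
            self_mem_nhdsWithin
      classical
      refine ⟨min l₁ l₂, max u₁ u₂, ⟨min_lt_of_left_lt hx₁.1, lt_max_of_lt_left hx₁.2⟩,
        ⟨min_lt_of_right_lt hz₂.1, lt_max_of_lt_right hz₂.2⟩,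
        fun t => if t ∈ Ioo l₁ u₁ then c₁ t else Q.act (c₂ t) g, fun t ht => ?_⟩
      by_cases h1 : t ∈ Ioo l₁ u₁
      · refine (hc₁ t ⟨h1, ht.2⟩).congr ht.2 ?_
        filter_upwards [mem_nhdsWithin_of_mem_nhds (isOpen_Ioo.mem_nhds h1)] with s hs
        rw [if_pos hs]
      · have h2 : t ∈ Ioo l₂ u₂ := by
          simp only [mem_Ioo, not_and_or, not_lt, mem_inter_iff, lt_max_iff, min_lt_iff] at *
          rcases h1 with h1 | h1 <;> constructor
          · rcases ht.1.1 with h | h <;> linarith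
          · linarith
          · linarith
          · rcases ht.1.2 with h | h <;> linarith
        refine (hc₂' t ⟨h2, ht.2⟩).congr ht.2 ?_
        filter_upwards [mem_nhdsWithin_of_mem_nhds (isOpen_Ioo.mem_nhds h2), self_mem_nhdsWithin]
          with s hs hsI
        split_ifs with h3
        · exact heq ⟨⟨h3, hs⟩, hsI⟩
        · rfl
    · rintro x y hx hy ⟨l, u, hx', hy', h⟩
      exact ⟨l, u, hy', hx', h⟩
  obtain ⟨l, u, h0, h1, c, hc⟩ := key
  have hlift : conn.IsHorizontalLift γ c := isHorizontalLift_iff.2 fun t ht =>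
    hc t ⟨⟨h0.1.trans_le ht.1, ht.2.trans_lt h1.2⟩, ht⟩
  obtain ⟨g, hg⟩ := Q.exists_act (p := c m) (q := p) (by rw [hlift.1 m hm, hp])
  exact ⟨_, hlift.act g, hg⟩

end PrincipalConnection

end Bundle

section Bundle

variable {EB : Type*} [NormedAddCommGroup EB] [NormedSpace ℝ EB]
  {B : Type*} [TopologicalSpace B] [ChartedSpace EB B]
  {EP : Type*} [NormedAddCommGroup EP] [NormedSpace ℝ EP]
  {P : Type*} [TopologicalSpace P] [ChartedSpace EP P]
  {EG : Type*} [NormedAddCommGroup EG] [NormedSpace ℝ EG]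
  {G : Type*} [TopologicalSpace G] [ChartedSpace EG G] [Group G]
  {Q : PrincipalBundle EB B EP P EG G}

open Filter Topology

/-- A local section of a principal bundle, together with the fibre coordinate which it defines. -/
theorem PrincipalBundle.exists_local_section_coordinate [IsManifold 𝓘(ℝ, EB) ∞ B]
    (Q : PrincipalBundle EB B EP P EG G) (b₀ : B) :
    ∃ (O : Set EB) (σ : EB → P) (τ : P → G), IsOpen O ∧ extChartAt 𝓘(ℝ, EB) b₀ b₀ ∈ O ∧
      O ⊆ (extChartAt 𝓘(ℝ, EB) b₀).target ∧ ContMDiffOn 𝓘(ℝ, EB) 𝓘(ℝ, EP) ∞ σ O ∧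
      (∀ b ∈ O, Q.proj (σ b) = (extChartAt 𝓘(ℝ, EB) b₀).symm b) ∧
      ∀ p, Q.proj p ∈ (extChartAt 𝓘(ℝ, EB) b₀).source → extChartAt 𝓘(ℝ, EB) b₀ (Q.proj p) ∈ O →
        MDifferentiableAt 𝓘(ℝ, EP) 𝓘(ℝ, EG) τ p ∧
        Q.act (σ (extChartAt 𝓘(ℝ, EB) b₀ (Q.proj p))) (τ p) = p := by
  obtain ⟨U, e, hU, hb, hes, het, he, he', hfst, hact⟩ := Q.exists_trivialization b₀
  set ψ := extChartAt 𝓘(ℝ, EB) b₀ with hψ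
  have hψc : ContMDiffOn 𝓘(ℝ, EB) 𝓘(ℝ, EB) ∞ ψ.symm ψ.target := contMDiffOn_extChartAt_symm b₀
  have hmem : ∀ b ∈ ψ.target ∩ ψ.symm ⁻¹' U, (ψ.symm b, (1 : G)) ∈ e.target := fun b hb => by
    rw [het]; exact ⟨hb.2, mem_univ _⟩
  refine ⟨ψ.target ∩ ψ.symm ⁻¹' U, fun b => e.symm (ψ.symm b, 1), fun p => (e p).2, ?_,
    ⟨mem_extChartAt_target b₀, ?_⟩, inter_subset_left, ?_, fun b hb => ?_, fun p hp hpO => ?_⟩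
  · exact hψc.continuousOn.isOpen_inter_preimage (isOpen_extChartAt_target b₀) hU
  · simpa [hψ] using hb
  · exact he'.comp ((hψc.mono inter_subset_left).prodMk contMDiffOn_const) hmem
  · rw [← hfst _ (e.map_target (hmem b hb)), e.right_inv (hmem b hb)]
  · have hm := hmem _ hpO
    have hpU : Q.proj p ∈ U := by have := hpO.2; rwa [mem_preimage, ψ.left_inv hp] at this
    have hps : p ∈ e.source := by rw [hes]; exact hpU
    refine ⟨mdifferentiableAt_snd.comp p (((he p hps).contMDiffAt
      (e.open_source.mem_nhds hps)).mdifferentiableAt (by simp)), ?_⟩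
    have hqs := e.map_target hm
    refine e.injOn ?_ hps ?_
    · rw [hes, mem_preimage, Q.proj_act, ← mem_preimage, ← hes]
      exact hqs
    · rw [hact _ hqs, e.right_inv hm, one_mul, ψ.left_inv hp, ← hfst p hps]

theorem PrincipalBundle.exists_local_section [IsManifold 𝓘(ℝ, EB) ∞ B]
    (Q : PrincipalBundle EB B EP P EG G) (b₀ : B) :
    ∃ (V : Set EB) (σ : EB → P), IsOpen V ∧ extChartAt 𝓘(ℝ, EB) b₀ b₀ ∈ V ∧
      V ⊆ (extChartAt 𝓘(ℝ, EB) b₀).target ∧ ContMDiffOn 𝓘(ℝ, EB) 𝓘(ℝ, EP) ∞ σ V ∧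
      ∀ b ∈ V, Q.proj (σ b) = (extChartAt 𝓘(ℝ, EB) b₀).symm b := by
  obtain ⟨O, σ, -, hO, hb, hOt, hσ, hproj, -⟩ := Q.exists_local_section_coordinate b₀
  exact ⟨O, σ, hO, hb, hOt, hσ, hproj⟩

theorem exists_Icc_box {s : Set (ℝ × ℝ)} {r₀ t₀ : ℝ} (hr₀ : r₀ ∈ Icc (0 : ℝ) 1)
    (ht₀ : t₀ ∈ Icc (0 : ℝ) 1) (hs : s ∈ 𝓝[Icc 0 1 ×ˢ Icc 0 1] (r₀, t₀)) :
    ∃ a b c d ε : ℝ, a < b ∧ c < d ∧ 0 < ε ∧ r₀ ∈ Icc a b ∧ t₀ ∈ Icc c d ∧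
      Icc a b ⊆ Icc 0 1 ∧ Icc c d ⊆ Icc 0 1 ∧ Icc a b ×ˢ Icc c d ⊆ s ∧
      (∀ r ∈ Icc (0 : ℝ) 1, |r - r₀| < ε → r ∈ Icc a b ∧ Icc a b ∈ 𝓝[Icc 0 1] r) ∧
      (∀ t ∈ Icc (0 : ℝ) 1, |t - t₀| < ε → t ∈ Icc c d ∧ Icc c d ∈ 𝓝[Icc 0 1] t) := by
  rw [mem_nhdsWithin_iff_eventually, Metric.nhds_basis_closedBall.eventually_iff] at hs
  obtain ⟨ε, hε, hb⟩ := hs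
  have key : ∀ m ∈ Icc (0 : ℝ) 1, max 0 (m - ε) < min 1 (m + ε) ∧
      m ∈ Icc (max 0 (m - ε)) (min 1 (m + ε)) ∧
      Icc (max 0 (m - ε)) (min 1 (m + ε)) ⊆ Icc 0 1 ∧
      (∀ x ∈ Icc (max 0 (m - ε)) (min 1 (m + ε)), |x - m| ≤ ε) ∧
      (∀ x ∈ Icc (0 : ℝ) 1, |x - m| < ε → x ∈ Icc (max 0 (m - ε)) (min 1 (m + ε)) ∧
        Icc (max 0 (m - ε)) (min 1 (m + ε)) ∈ 𝓝[Icc 0 1] x) := by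
    intro m hm
    have hI : Icc (max 0 (m - ε)) (min 1 (m + ε)) = Icc 0 1 ∩ Icc (m - ε) (m + ε) :=
      Icc_inter_Icc.symm
    refine ⟨?_, ⟨max_le hm.1 (by linarith), le_min hm.2 (by linarith)⟩, ?_, ?_, ?_⟩
    · rw [max_lt_iff, lt_min_iff, lt_min_iff]
      refine ⟨⟨by norm_num, by linarith [hm.1]⟩, by linarith [hm.2], by linarith⟩
    · rw [hI]; exact inter_subset_left
    · intro x hx
      rw [hI] at hx
      rw [abs_le]; constructor <;> linarith [hx.2.1, hx.2.2]
    · intro x hx hxm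
      rw [abs_lt] at hxm
      rw [hI]
      exact ⟨⟨hx, by constructor <;> linarith⟩, inter_mem self_mem_nhdsWithin
        (mem_nhdsWithin_of_mem_nhds (Icc_mem_nhds (by linarith) (by linarith)))⟩
  obtain ⟨h1, h2, h3, h4, h5⟩ := key r₀ hr₀
  obtain ⟨h1', h2', h3', h4', h5'⟩ := key t₀ ht₀
  refine ⟨_, _, _, _, ε, h1, h1', hε, h2, h2', h3, h3', ?_, h5, h5'⟩
  rintro ⟨r, t⟩ ⟨hr, ht⟩
  refine hb ?_ ⟨h3 hr, h3' ht⟩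
  rw [Metric.mem_closedBall, dist_eq_norm]
  exact max_le (h4 r hr) (h4' t ht)

theorem mfderiv_extChartAt_symm_self [IsManifold 𝓘(ℝ, EP) ∞ P] (p : P) (v : EP) :
    (mfderiv 𝓘(ℝ, EP) 𝓘(ℝ, EP) (extChartAt 𝓘(ℝ, EP) p).symm (extChartAt 𝓘(ℝ, EP) p p) v : EP) = v := by
  have : IsManifold 𝓘(ℝ, EP) 1 P := IsManifold.of_le (n := ∞) (by exact_mod_cast le_top)
  have h := mfderivWithin_range_extChartAt_symm (I := 𝓘(ℝ, EP)) (x := p)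
  have hr : range 𝓘(ℝ, EP) = univ := by simp
  rw [hr, mfderivWithin_univ] at h
  exact congrArg (fun T : EP →L[ℝ] EP => T v) h

namespace PrincipalConnection

variable [IsManifold 𝓘(ℝ, EP) ∞ P] (conn : PrincipalConnection Q)

/-- A family of paths in the base has, locally, a differentiable family of horizontal lifts, given
in a chart of `P` by a map `z` whose second partial derivatives commute. -/
theorem exists_local_horizontal_family [IsManifold 𝓘(ℝ, EB) ∞ B] [LieGroup 𝓘(ℝ, EG) ∞ G]
    [FiniteDimensional ℝ EB] [FiniteDimensional ℝ EG]
    {u : ℝ × ℝ → B} (hu : ContMDiffOn 𝓘(ℝ, ℝ × ℝ) 𝓘(ℝ, EB) ∞ u (Icc 0 1 ×ˢ Icc 0 1))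
    {r₀ t₀ : ℝ} (hr₀ : r₀ ∈ Icc (0 : ℝ) 1) (ht₀ : t₀ ∈ Icc (0 : ℝ) 1) :
    ∃ (O : Set (EB × EG)) (N : EB × EG → P), IsOpen O ∧
      ContMDiffOn 𝓘(ℝ, EB × EG) 𝓘(ℝ, EP) ∞ N O ∧
      ∃ δ > 0, ∃ z zr zt zm : ℝ → ℝ → EB × EG, ∀ t ∈ Icc (0 : ℝ) 1, |t - t₀| < δ →
        ∀ r ∈ Icc (0 : ℝ) 1, |r - r₀| < δ → z r t ∈ O ∧ Q.proj (N (z r t)) = u (r, t) ∧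
          HasDerivWithinAt (fun r => z r t) (zr r t) (Icc 0 1) r ∧
          HasDerivWithinAt (fun t => z r t) (zt r t) (Icc 0 1) t ∧
          HasDerivWithinAt (fun t => zr r t) (zm r t) (Icc 0 1) t ∧
          HasDerivWithinAt (fun r => zt r t) (zm r t) (Icc 0 1) r ∧
          ContinuousWithinAt (fun r => zr r t) (Icc 0 1) r ∧
          conn.pullForm N (z r t) (zr r t) = 0 := by
  have : IsManifold 𝓘(ℝ, EG) ∞ G := inferInstance
  set b₀ := u (r₀, t₀) with hb₀
  obtain ⟨V, σ, hV, hbV, hVt, hσ, hσp⟩ := Q.exists_local_section b₀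
  set ψ := extChartAt 𝓘(ℝ, EB) b₀ with hψ
  set χ := extChartAt 𝓘(ℝ, EG) (1 : G) with hχ
  set N : EB × EG → P := fun y => Q.act (σ y.1) (χ.symm y.2) with hN
  set O : Set (EB × EG) := V ×ˢ χ.target with hO
  have hOo : IsOpen O := hV.prod (isOpen_extChartAt_target (1 : G))
  have hNs : ContMDiffOn 𝓘(ℝ, EB × EG) 𝓘(ℝ, EP) ∞ N O := by
    have h1 : ContMDiffOn 𝓘(ℝ, EB × EG) 𝓘(ℝ, EP) ∞ (fun y : EB × EG => σ y.1) O :=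
      hσ.comp (contDiff_fst.contMDiff.contMDiffOn) fun y hy => hy.1
    have h2 : ContMDiffOn 𝓘(ℝ, EB × EG) 𝓘(ℝ, EG) ∞ (fun y : EB × EG => χ.symm y.2) O :=
      (contMDiffOn_extChartAt_symm (1 : G)).comp (contDiff_snd.contMDiff.contMDiffOn) fun y hy => hy.2
    exact Q.contMDiff_act.comp_contMDiffOn (h1.prodMk h2)
  set Θ := conn.pullForm N with hΘ
  have hΘs : ContDiffOn ℝ ∞ Θ O := conn.contDiffOn_pullForm hOo hNs
  set y₀ : EB × EG := (ψ b₀, χ 1) with hy₀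
  have hy₀O : y₀ ∈ O := ⟨hbV, mem_extChartAt_target (1 : G)⟩
  set Lv : EB × EG → EG →L[ℝ] EG := fun y => (Θ y).comp (ContinuousLinearMap.inr ℝ EB EG) with hLv
  have hL₀ : Lv y₀ = ContinuousLinearMap.id ℝ EG := by
    ext ξ
    have hχd : MDifferentiableAt 𝓘(ℝ, EG) 𝓘(ℝ, EG) χ.symm (χ 1) :=
      ((contMDiffOn_extChartAt_symm (1 : G)).contMDiffAt
        ((isOpen_extChartAt_target (1 : G)).mem_nhds hy₀O.2)).mdifferentiableAt (n := ∞) (by simp)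
    have hχ1 : χ.symm (χ 1) = 1 := extChartAt_to_inv (I := 𝓘(ℝ, EG)) (1 : G)
    have h1 : HasMFDerivAt 𝓘(ℝ, EG) 𝓘(ℝ, EP) (fun x => N (ψ b₀, x)) (χ 1)
        ((mfderiv 𝓘(ℝ, EB × EG) 𝓘(ℝ, EP) N y₀ : EB × EG →L[ℝ] EP).comp
          (ContinuousLinearMap.inr ℝ EB EG)) := by
      have h2 : HasMFDerivAt 𝓘(ℝ, EG) 𝓘(ℝ, EB × EG) (fun x : EG => (ψ b₀, x)) (χ 1)
          (ContinuousLinearMap.inr ℝ EB EG) :=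
        (hasFDerivAt_prodMk_right (ψ b₀) (χ 1)).hasMFDerivAt
      exact (((hNs y₀ hy₀O).contMDiffAt (hOo.mem_nhds hy₀O)).mdifferentiableAt
        (n := ∞) (by simp)).hasMFDerivAt.comp (χ 1) h2
    have h3 := (Q.mdifferentiableAt_act_right (σ (ψ b₀)) (χ.symm (χ 1))).hasMFDerivAt.comp (χ 1)
      hχd.hasMFDerivAt
    have h4 := congrArg (fun T : EG →L[ℝ] EP => T ξ) (hasMFDerivAt_unique h1 h3)
    have key : ∀ g : G, g = 1 → ∀ v : EG,
        (mfderiv 𝓘(ℝ, EG) 𝓘(ℝ, EP) (fun h => Q.act (σ (ψ b₀)) h) g v : EP) =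
        mfderiv 𝓘(ℝ, EG) 𝓘(ℝ, EP) (fun h => Q.act (σ (ψ b₀)) h) 1 v := by rintro g rfl v; rfl
    have h5 : (mfderiv 𝓘(ℝ, EB × EG) 𝓘(ℝ, EP) N y₀ ((0, ξ) : EB × EG) : EP) =
        mfderiv 𝓘(ℝ, EG) 𝓘(ℝ, EP) (fun h => Q.act (σ (ψ b₀)) h) 1 ξ := by
      refine h4.trans ((key _ hχ1 _).trans ?_)
      exact congrArg (mfderiv 𝓘(ℝ, EG) 𝓘(ℝ, EP) (fun h => Q.act (σ (ψ b₀)) h) 1 : EG →L[ℝ] EP)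
        (mfderiv_extChartAt_symm_self (1 : G) ξ)
    refine (congrArg (conn.form (N y₀)) h5).trans ?_
    refine Eq.trans ?_ (conn.form_fundamental (σ (ψ b₀)) ξ)
    exact conn.form_congr (by simp only [hN, hy₀, hχ1]) _
  set f : (EB × EB) × EG → EG := fun q =>
    -((Lv (q.1.1, q.2)).inverse (Θ (q.1.1, q.2) (q.1.2, 0))) with hf
  have hproj : ContDiff ℝ ∞ fun q : (EB × EB) × EG => (q.1.1, q.2) := by fun_prop
  have hLs : ∀ y ∈ O, ContDiffAt ℝ ∞ Lv y := fun y hy =>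
    ((hΘs y hy).contDiffAt (hOo.mem_nhds hy)).clm_comp contDiffAt_const
  have hfs : ∀ β : EB, ContDiffAt ℝ 2 f ((ψ b₀, β), χ 1) := by
    intro β
    have h1 : ContDiffAt ℝ ∞ (fun q : (EB × EB) × EG => Θ (q.1.1, q.2)) ((ψ b₀, β), χ 1) :=
      ((hΘs y₀ hy₀O).contDiffAt (hOo.mem_nhds hy₀O)).comp (g := Θ) ((ψ b₀, β), χ 1) hproj.contDiffAt
    have h2 : ContDiffAt ℝ ∞ (fun q : (EB × EB) × EG => Lv (q.1.1, q.2)) ((ψ b₀, β), χ 1) :=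
      (hLs y₀ hy₀O).comp (g := Lv) ((ψ b₀, β), χ 1) hproj.contDiffAt
    have h3 : ContDiffAt ℝ ∞ (ContinuousLinearMap.inverse : (EG →L[ℝ] EG) → EG →L[ℝ] EG)
        (Lv y₀) := by
      rw [hL₀]; exact contDiffAt_map_inverse (ContinuousLinearEquiv.refl ℝ EG)
    have h4 : ContDiffAt ℝ ∞ (fun q : (EB × EB) × EG => (Lv (q.1.1, q.2)).inverse)
        ((ψ b₀, β), χ 1) := h3.comp (f := fun q : (EB × EB) × EG => Lv (q.1.1, q.2))
          ((ψ b₀, β), χ 1) h2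
    have h5 : ContDiffAt ℝ ∞ f ((ψ b₀, β), χ 1) :=
      (h4.clm_apply (h1.clm_apply (ContDiff.contDiffAt (by fun_prop)))).neg
    exact h5.of_le (WithTop.coe_le_coe.2 le_top)
  set Nb : Set ((EB × EB) × EG) := {q | (q.1.1, q.2) ∈ O ∧
    Lv (q.1.1, q.2) ∈ range ((↑) : (EG ≃L[ℝ] EG) → EG →L[ℝ] EG)} with hNb
  have hNbn : ∀ β : EB, Nb ∈ 𝓝 ((ψ b₀, β), χ 1) := by
    intro β
    have h1 : ∀ᶠ y in 𝓝 y₀, y ∈ O ∧ Lv y ∈ range ((↑) : (EG ≃L[ℝ] EG) → EG →L[ℝ] EG) := by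
      have h0 : ∀ᶠ y in 𝓝 y₀, y ∈ O := hOo.mem_nhds hy₀O
      refine h0.and ((hLs y₀ hy₀O).continuousAt ?_)
      rw [hL₀]; exact (ContinuousLinearEquiv.refl ℝ EG).nhds
    have h2 : Tendsto (fun q : (EB × EB) × EG => (q.1.1, q.2)) (𝓝 ((ψ b₀, β), χ 1)) (𝓝 y₀) :=
      hproj.continuous.tendsto ((ψ b₀, β), χ 1)
    exact h2.eventually h1
  have hfsolve : ∀ q ∈ Nb, Θ (q.1.1, q.2) (q.1.2, f q) = 0 := by
    rintro q ⟨-, e, he⟩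
    have h1 : Lv (q.1.1, q.2) (f q) = -(Θ (q.1.1, q.2) (q.1.2, 0)) := by
      simp only [hf]
      rw [← he, ContinuousLinearMap.inverse_equiv]
      simp
    have h2 : ((q.1.2, f q) : EB × EG) = (q.1.2, 0) + (0, f q) := by simp
    have h3 : Θ (q.1.1, q.2) (0, f q) = Lv (q.1.1, q.2) (f q) := rfl
    rw [h2, map_add, h3, h1, add_neg_cancel]
  have hus : u ⁻¹' ψ.source ∈ 𝓝[Icc 0 1 ×ˢ Icc 0 1] (r₀, t₀) :=
    (hu.continuousOn (r₀, t₀) ⟨hr₀, ht₀⟩) (extChartAt_source_mem_nhds b₀)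
  obtain ⟨a, b, c, d, ε, hab, hcd, hε, hr₀', ht₀', haI, hcI, hsub, hrε, htε⟩ :=
    exists_Icc_box hr₀ ht₀ hus
  set D := Icc a b ×ˢ Icc c d with hD
  have hDu : UniqueDiffOn ℝ D := uniqueDiffOn_Icc_prod hab hcd
  set v : ℝ × ℝ → EB := fun p => ψ (u p) with hv
  have hvs : ContDiffOn ℝ ∞ v D := by
    rw [← contMDiffOn_iff_contDiffOn]
    refine (contMDiffOn_extChartAt (x := b₀)).comp (hu.mono (prod_mono haI hcI)) fun p hp => ?_
    simpa [hψ] using hsub hp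
  set vr : ℝ × ℝ → EB := fun p => fderivWithin ℝ v D p (1, 0) with hvr
  set vt : ℝ × ℝ → EB := fun p => fderivWithin ℝ v D p (0, 1) with hvt
  have hvrs : ContDiffOn ℝ ∞ vr D := hvs.fderivWithin_apply_const hDu _
  have hvts : ContDiffOn ℝ ∞ vt D := hvs.fderivWithin_apply_const hDu _
  have hα : ContDiffOn ℝ ∞ (fun p => (v p, vr p)) D := hvs.prodMk hvrs
  obtain ⟨δ, hδ, x, xt, hx⟩ := exists_local_solution_parameter hab hcd hα hr₀' ht₀'
    (hfs (vr (r₀, t₀))) (hNbn (vr (r₀, t₀)))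
  refine ⟨O, N, hOo, hNs, min δ ε, lt_min hδ hε, fun r t => (v (r, t), x r t),
    fun r t => (vr (r, t), f ((v (r, t), vr (r, t)), x r t)), fun r t => (vt (r, t), xt r t),
    fun r t => (fderivWithin ℝ vr D (r, t) (0, 1), fderiv ℝ f ((v (r, t), vr (r, t)), x r t)
      (fderivWithin ℝ (fun p => (v p, vr p)) D (r, t) (0, 1), xt r t)), ?_⟩
  intro t ht htδ r hr hrδ
  obtain ⟨htI, htn⟩ := htε t ht (htδ.trans_le (min_le_right _ _))
  obtain ⟨hrI, hrn⟩ := hrε r hr (hrδ.trans_le (min_le_right _ _))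
  obtain ⟨h1, h2, h3, h4, h5⟩ :=
    (hx t htI (htδ.trans_le (min_le_left _ _))).2 r hrI (hrδ.trans_le (min_le_left _ _))
  have hp : (r, t) ∈ D := ⟨hrI, htI⟩
  have dr : ∀ {w : ℝ × ℝ → EB}, ContDiffOn ℝ ∞ w D →
      HasDerivWithinAt (fun r => w (r, t)) (fderivWithin ℝ w D (r, t) (1, 0)) (Icc 0 1) r :=
    fun hw => ((hw.differentiableOn (by simp) (r, t) hp).hasDerivWithinAt_fst
      htI).mono_of_mem_nhdsWithin hrn
  have dt : ∀ {w : ℝ × ℝ → EB}, ContDiffOn ℝ ∞ w D →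
      HasDerivWithinAt (fun t => w (r, t)) (fderivWithin ℝ w D (r, t) (0, 1)) (Icc 0 1) t :=
    fun hw => ((hw.differentiableOn (by simp) (r, t) hp).hasDerivWithinAt_snd
      hrI).mono_of_mem_nhdsWithin htn
  have dα : HasDerivWithinAt (fun t => (v (r, t), vr (r, t)))
      (fderivWithin ℝ (fun p => (v p, vr p)) D (r, t) (0, 1)) (Icc 0 1) t :=
    ((hα.differentiableOn (by simp) (r, t) hp).hasDerivWithinAt_snd
      hrI).mono_of_mem_nhdsWithin htn
  have h3' := h3.mono_of_mem_nhdsWithin hrn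
  refine ⟨h1.1, ?_, (dr hvs).prodMk h3', (dt hvs).prodMk (h5.mono_of_mem_nhdsWithin htn),
    (dt hvrs).prodMk ?_, ?_, (dr hvrs).continuousWithinAt.prodMk ?_, hfsolve _ h1⟩
  · simp only [hN]
    rw [Q.proj_act, hσp _ h1.1.1]
    exact ψ.left_inv (hsub hp)
  · exact h2.hasFDerivAt.comp_hasDerivWithinAt t (dα.prodMk (h5.mono_of_mem_nhdsWithin htn))
  · have hcomm := hvs.fderivWithin_fderivWithin_apply_comm hDu
      (Icc_prod_subset_closure_interior hab hcd) hp (1, 0) (0, 1)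
    have h6 := dr hvts
    rw [← hcomm] at h6
    exact h6.prodMk (h4.mono_of_mem_nhdsWithin hrn)
  · exact ContinuousAt.comp_continuousWithinAt
      (f := fun r => ((v (r, t), vr (r, t)), x r t)) h2.continuousAt
      (((dr hvs).continuousWithinAt.prodMk (dr hvrs).continuousWithinAt).prodMk
        h3'.continuousWithinAt)

end PrincipalConnection

end Bundle

section Bundle

variable {EB : Type*} [NormedAddCommGroup EB] [NormedSpace ℝ EB]
  {B : Type*} [TopologicalSpace B] [ChartedSpace EB B]
  {EP : Type*} [NormedAddCommGroup EP] [NormedSpace ℝ EP]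
  {P : Type*} [TopologicalSpace P] [ChartedSpace EP P]
  {EG : Type*} [NormedAddCommGroup EG] [NormedSpace ℝ EG]
  {G : Type*} [TopologicalSpace G] [ChartedSpace EG G] [Group G]
  {Q : PrincipalBundle EB B EP P EG G}

open Filter Topology

theorem structureBracket_zero_left (X : EG) : structureBracket G (0 : EG) X = 0 := by
  have h : (mulInvariantVectorField (I := 𝓘(ℝ, EG)) (0 : GroupLieAlgebra 𝓘(ℝ, EG) G) :
      ∀ g : G, TangentSpace 𝓘(ℝ, EG) g) = 0 := by
    funext g
    exact map_zero _
  have h2 : VectorField.mlieBracket 𝓘(ℝ, EG)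
    (mulInvariantVectorField (I := 𝓘(ℝ, EG)) (0 : GroupLieAlgebra 𝓘(ℝ, EG) G))
    (mulInvariantVectorField (I := 𝓘(ℝ, EG)) (X : GroupLieAlgebra 𝓘(ℝ, EG) G)) (1 : G) = 0 := by
    rw [h, VectorField.mlieBracket_zero_left]
    rfl
  exact h2

namespace PrincipalConnection

variable [IsManifold 𝓘(ℝ, EP) ∞ P] (conn : PrincipalConnection Q)

theorem dform_congr {p q : P} (h : p = q) {a b a' b' : EP} (ha : a = a') (hb : b = b') :
    conn.dform p a b = conn.dform q a' b' := by subst h ha hb; rfl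

theorem curvature_eq_dform {p : P} {a : EP} (ha : conn.form p a = 0) (b : EP) :
    conn.curvature p a b = conn.dform p a b := by
  unfold curvature
  rw [ha, structureBracket_zero_left, add_zero]

theorem exists_isHorizontalLift [IsManifold 𝓘(ℝ, EB) ∞ B] [LieGroup 𝓘(ℝ, EG) ∞ G]
    [FiniteDimensional ℝ EB] [FiniteDimensional ℝ EG] {γ : ℝ → B}
    (hγ : ContMDiffOn 𝓘(ℝ, ℝ) 𝓘(ℝ, EB) ∞ γ (Icc 0 1)) {m : ℝ} (hm : m ∈ Icc (0 : ℝ) 1) {p : P}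
    (hp : Q.proj p = γ m) : ∃ c : ℝ → P, conn.IsHorizontalLift γ c ∧ c m = p := by
  refine exists_isHorizontalLift_of_local (fun r₀ hr₀ => ?_) hm hp
  have hu : ContMDiffOn 𝓘(ℝ, ℝ × ℝ) 𝓘(ℝ, EB) ∞ (fun x : ℝ × ℝ => γ x.1) (Icc 0 1 ×ˢ Icc 0 1) :=
    hγ.comp contDiff_fst.contMDiff.contMDiffOn fun x hx => hx.1
  obtain ⟨O, N, hO, hN, δ, hδ, z, zr, zt, zm, h⟩ :=
    conn.exists_local_horizontal_family hu hr₀ (left_mem_Icc.2 zero_le_one)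
  refine ⟨δ, hδ, fun r => N (z r 0), fun r hr hrδ => ?_⟩
  obtain ⟨h1, h2, h3, -, -, -, -, h4⟩ := h 0 (left_mem_Icc.2 zero_le_one) (by simpa) r hr hrδ
  have h5 := conn.form_mfderivWithin_eq_pullForm (c := fun r => N (z r 0)) h3
    (((hN _ h1).contMDiffAt (hO.mem_nhds h1)).mdifferentiableAt (by simp)) EventuallyEq.rfl rfl
    (uniqueDiffWithinAt_Icc_zero_one hr)
  exact ⟨h2, h5.1, h5.2.2.trans h4⟩

/-- The curvature of the connection on the horizontal lifts of a family of curves is the rate of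
change of the connection form on the transversal velocity. -/
theorem hasDerivWithinAt_form_velocity [IsManifold 𝓘(ℝ, EB) ∞ B] [LieGroup 𝓘(ℝ, EG) ∞ G]
    [FiniteDimensional ℝ EB] [FiniteDimensional ℝ EG] [FiniteDimensional ℝ EP]
    {u : ℝ × ℝ → B} (hu : ContMDiffOn 𝓘(ℝ, ℝ × ℝ) 𝓘(ℝ, EB) ∞ u (Icc 0 1 ×ˢ Icc 0 1))
    {Φ : ℝ → ℝ → P}
    (hΦ : ∀ t ∈ Icc (0 : ℝ) 1, conn.IsHorizontalLift (fun r => u (r, t)) fun r => Φ r t)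
    {r₀ t₀ : ℝ} (hr₀ : r₀ ∈ Icc (0 : ℝ) 1) (ht₀ : t₀ ∈ Icc (0 : ℝ) 1) :
    ∃ δ > 0, ∃ k : ℝ → G,
      (∀ r ∈ Icc (0 : ℝ) 1, |r - r₀| < δ →
        (MDifferentiableWithinAt 𝓘(ℝ, ℝ) 𝓘(ℝ, EP) (fun t => Φ r t) (Icc 0 1) t₀ ↔
          MDifferentiableWithinAt 𝓘(ℝ, ℝ) 𝓘(ℝ, EG) k (Icc 0 1) t₀)) ∧
      (MDifferentiableWithinAt 𝓘(ℝ, ℝ) 𝓘(ℝ, EG) k (Icc 0 1) t₀ →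
        (∀ r ∈ Icc (0 : ℝ) 1, |r - r₀| < δ →
          HasDerivWithinAt (fun r => conn.form (Φ r t₀) (velocity (fun t => Φ r t) t₀))
            (conn.curvature (Φ r t₀) (velocity (fun s => Φ s t₀) r) (velocity (fun s => Φ r s) t₀))
            (Icc 0 1) r) ∧
        ContinuousWithinAt (fun r => conn.curvature (Φ r t₀) (velocity (fun s => Φ s t₀) r)
          (velocity (fun s => Φ r s) t₀)) (Icc 0 1) r₀) := by
  have : IsManifold 𝓘(ℝ, EG) ∞ G := inferInstance
  obtain ⟨O, N, hO, hN, δ, hδ, z, zr, zt, zm, h⟩ :=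
    conn.exists_local_horizontal_family hu hr₀ ht₀
  have hNd : ∀ y ∈ O, MDifferentiableAt 𝓘(ℝ, EB × EG) 𝓘(ℝ, EP) N y := fun y hy =>
    ((hN _ hy).contMDiffAt (hO.mem_nhds hy)).mdifferentiableAt (by simp)
  set K : Set ℝ := Metric.ball r₀ δ ∩ Icc 0 1 with hK
  have hKabs : ∀ r ∈ K, |r - r₀| < δ := fun r hr => by simpa [Real.dist_eq] using hr.1
  have hKo : ∀ r ∈ K, K ∈ 𝓝[Icc 0 1] r := fun r hr =>
    inter_mem (mem_nhdsWithin_of_mem_nhds (Metric.isOpen_ball.mem_nhds hr.1)) self_mem_nhdsWithin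
  have hr₀K : r₀ ∈ K := ⟨Metric.mem_ball_self hδ, hr₀⟩
  have hkex : ∀ t ∈ Metric.ball t₀ δ ∩ Icc 0 1, ∃ g, Q.act (N (z r₀ t)) g = Φ r₀ t := by
    intro t ht
    refine Q.exists_act ?_
    rw [(h t ht.2 (by simpa [Real.dist_eq] using ht.1) r₀ hr₀ (by simpa)).2.1, (hΦ t ht.2).1 r₀ hr₀]
  choose! k hk using hkex
  have hΦk : ∀ t ∈ Metric.ball t₀ δ ∩ Icc 0 1, ∀ r ∈ K, Q.act (N (z r t)) (k t) = Φ r t := by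
    intro t ht
    have htδ : |t - t₀| < δ := by simpa [Real.dist_eq] using ht.1
    refine IsHorizontalAt.eqOn (conn := conn) (γ := fun r => u (r, t))
      ((convex_ball r₀ δ).inter (convex_Icc 0 1)).isPreconnected inter_subset_right hKo ?_
      (fun r hr => isHorizontalLift_iff.1 (hΦ t ht.2) r hr.2) hr₀K (hk t ht)
    intro r hr
    obtain ⟨h1, h2, h3, -, -, -, -, h4⟩ := h t ht.2 htδ r hr.2 (hKabs r hr)
    have h5 := conn.form_mfderivWithin_eq_pullForm (c := fun r => N (z r t)) h3 (hNd _ h1)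
      EventuallyEq.rfl rfl (uniqueDiffWithinAt_Icc_zero_one hr.2)
    exact IsHorizontalAt.act hr.2 ⟨h2, h5.1, h5.2.2.trans h4⟩ (k t)
  have ht₀T : t₀ ∈ Metric.ball t₀ δ ∩ Icc 0 1 := ⟨Metric.mem_ball_self hδ, ht₀⟩
  have hTo : ∀ᶠ t in 𝓝[Icc 0 1] t₀, t ∈ Metric.ball t₀ δ ∩ Icc 0 1 :=
    inter_mem (mem_nhdsWithin_of_mem_nhds (Metric.ball_mem_nhds _ hδ)) self_mem_nhdsWithin
  have hNz : ∀ r ∈ K, MDifferentiableWithinAt 𝓘(ℝ, ℝ) 𝓘(ℝ, EP) (fun t => N (z r t))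
      (Icc 0 1) t₀ := by
    intro r hr
    obtain ⟨h1, -, -, h3, -⟩ := h t₀ ht₀ (by simpa) r hr.2 (hKabs r hr)
    exact (conn.form_mfderivWithin_eq_pullForm (c := fun t => N (z r t)) h3 (hNd _ h1)
      EventuallyEq.rfl rfl (uniqueDiffWithinAt_Icc_zero_one ht₀)).1
  refine ⟨δ, hδ, k, fun r hr hrδ => ?_, fun hkd => ?_⟩
  · have hrK : r ∈ K := ⟨by simpa [Real.dist_eq] using hrδ, hr⟩
    have hev : ∀ᶠ t in 𝓝[Icc 0 1] t₀, Q.act (N (z r t)) (k t) = Φ r t := by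
      filter_upwards [hTo] with t ht using hΦk t ht r hrK
    refine ⟨fun hd => Q.mdifferentiableWithinAt_of_act_eq (hNz r hrK) hd ht₀ hev, fun hd => ?_⟩
    have h1 := ((Q.contMDiff_act.mdifferentiable (by simp)) (N (z r t₀), k t₀)).comp_mdifferentiableWithinAt t₀
      ((hNz r hrK).prodMk hd)
    exact h1.congr_of_eventuallyEq (hev.mono fun t ht => ht.symm) (hev.self_of_nhdsWithin ht₀).symm
  set φ := extChartAt 𝓘(ℝ, EG) (k t₀) with hφ
  set M : (EB × EG) × EG → P := fun y => Q.act (N y.1) (φ.symm y.2) with hM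
  set O' : Set ((EB × EG) × EG) := O ×ˢ φ.target with hO'
  have hO'o : IsOpen O' := hO.prod (isOpen_extChartAt_target (k t₀))
  have hMs : ContMDiffOn 𝓘(ℝ, (EB × EG) × EG) 𝓘(ℝ, EP) ∞ M O' := by
    have h1 : ContMDiffOn 𝓘(ℝ, (EB × EG) × EG) 𝓘(ℝ, EP) ∞ (fun y : (EB × EG) × EG => N y.1) O' :=
      hN.comp (contDiff_fst.contMDiff.contMDiffOn) fun y hy => hy.1
    have h2 : ContMDiffOn 𝓘(ℝ, (EB × EG) × EG) 𝓘(ℝ, EG) ∞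
        (fun y : (EB × EG) × EG => φ.symm y.2) O' :=
      (contMDiffOn_extChartAt_symm (k t₀)).comp (contDiff_snd.contMDiff.contMDiffOn)
        fun y hy => hy.2
    exact Q.contMDiff_act.comp_contMDiffOn (h1.prodMk h2)
  have hMd : ∀ y ∈ O', MDifferentiableAt 𝓘(ℝ, (EB × EG) × EG) 𝓘(ℝ, EP) M y := fun y hy =>
    ((hMs _ hy).contMDiffAt (hO'o.mem_nhds hy)).mdifferentiableAt (by simp)
  set Θ := conn.pullForm M with hΘ
  have hΘs : ContDiffOn ℝ ∞ Θ O' := conn.contDiffOn_pullForm hO'o hMs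
  have hΘd : ∀ y ∈ O', HasFDerivAt Θ (fderiv ℝ Θ y) y := fun y hy =>
    (((hΘs y hy).contDiffAt (hO'o.mem_nhds hy)).differentiableAt (by simp)).hasFDerivAt
  set κ : ℝ → EG := fun t => φ (k t) with hκ
  obtain ⟨κ', hκ'⟩ : ∃ κ' : EG, HasDerivWithinAt κ κ' (Icc 0 1) t₀ := by
    have h1 := (mdifferentiableAt_extChartAt (I := 𝓘(ℝ, EG)) (x := k t₀) (y := k t₀)
      (mem_chart_source EG (k t₀))).comp_mdifferentiableWithinAt t₀ hkd
    exact ⟨_, (mdifferentiableWithinAt_iff_differentiableWithinAt.1 h1).hasDerivWithinAt⟩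
  have hksrc : ∀ᶠ t in 𝓝[Icc 0 1] t₀, k t ∈ φ.source :=
    hkd.continuousWithinAt.eventually (extChartAt_source_mem_nhds (k t₀))
  have hT : ∀ᶠ t in 𝓝[Icc 0 1] t₀, t ∈ Metric.ball t₀ δ ∩ Icc 0 1 ∧ k t ∈ φ.source := hTo.and hksrc
  have hMΦ : ∀ t ∈ Metric.ball t₀ δ ∩ Icc 0 1, k t ∈ φ.source → ∀ r ∈ K,
      Φ r t = M (z r t, κ t) ∧ (z r t, κ t) ∈ O' := by
    intro t ht hkt r hr
    refine ⟨?_, (h t ht.2 (by simpa [Real.dist_eq] using ht.1) r hr.2 (hKabs r hr)).1,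
      φ.map_source hkt⟩
    simp only [hM, hκ]
    rw [φ.left_inv hkt, hΦk t ht r hr]
  have hvr : ∀ t ∈ Metric.ball t₀ δ ∩ Icc 0 1, k t ∈ φ.source → ∀ r ∈ K,
      (velocity (fun s => Φ s t) r : EP) =
        mfderiv 𝓘(ℝ, (EB × EG) × EG) 𝓘(ℝ, EP) M (z r t, κ t) (zr r t, (0 : EG)) ∧
      Θ (z r t, κ t) (zr r t, (0 : EG)) = 0 := by
    intro t ht hkt r hr
    obtain ⟨-, -, h3, -⟩ := h t ht.2 (by simpa [Real.dist_eq] using ht.1) r hr.2 (hKabs r hr)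
    obtain ⟨h4, h5⟩ := hMΦ t ht hkt r hr
    have h6 := conn.form_mfderivWithin_eq_pullForm (c := fun s => Φ s t) (N := M)
      (h3.prodMk (hasDerivWithinAt_const r _ (κ t))) (hMd _ h5)
      (by filter_upwards [hKo r hr] with s hs using (hMΦ t ht hkt s hs).1) h4
      (uniqueDiffWithinAt_Icc_zero_one hr.2)
    exact ⟨h6.2.1, h6.2.2.symm.trans ((hΦ t ht.2).3 r hr.2)⟩
  have hvt : ∀ r ∈ K, (velocity (fun s => Φ r s) t₀ : EP) =
        mfderiv 𝓘(ℝ, (EB × EG) × EG) 𝓘(ℝ, EP) M (z r t₀, κ t₀) (zt r t₀, κ') ∧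
      conn.form (Φ r t₀) (velocity (fun s => Φ r s) t₀) = Θ (z r t₀, κ t₀) (zt r t₀, κ') := by
    intro r hr
    obtain ⟨-, -, -, h3, -⟩ := h t₀ ht₀ (by simpa) r hr.2 (hKabs r hr)
    obtain ⟨h4, h5⟩ := hMΦ t₀ ht₀T (mem_extChartAt_source (k t₀)) r hr
    have h6 := conn.form_mfderivWithin_eq_pullForm (c := fun s => Φ r s) (N := M)
      (h3.prodMk hκ') (hMd _ h5)
      (by filter_upwards [hT] with s hs using (hMΦ s hs.1 hs.2 r hr).1) h4
      (uniqueDiffWithinAt_Icc_zero_one ht₀)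
    exact h6.2
  set ρ : ℝ → EG := fun r => fderiv ℝ Θ (z r t₀, κ t₀) (zr r t₀, (0 : EG)) (zt r t₀, κ') -
    fderiv ℝ Θ (z r t₀, κ t₀) (zt r t₀, κ') (zr r t₀, (0 : EG)) with hρ
  have hcurv : ∀ r ∈ K, conn.curvature (Φ r t₀) (velocity (fun s => Φ s t₀) r)
      (velocity (fun s => Φ r s) t₀) = ρ r := by
    intro r hr
    obtain ⟨h4, h5⟩ := hMΦ t₀ ht₀T (mem_extChartAt_source (k t₀)) r hr
    refine (conn.curvature_eq_dform ((hΦ t₀ ht₀).3 r hr.2) _).trans ?_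
    refine (conn.dform_congr h4 (hvr t₀ ht₀T (mem_extChartAt_source (k t₀)) r hr).1
      (hvt r hr).1).trans ?_
    exact conn.dform_mfderiv hO'o hMs h5 _ _
  have hA : ∀ r ∈ K, HasDerivWithinAt
      (fun r => conn.form (Φ r t₀) (velocity (fun t => Φ r t) t₀)) (ρ r) (Icc 0 1) r := by
    intro r hr
    obtain ⟨h1, -, h3, h4, h5, h6, -, -⟩ := h t₀ ht₀ (by simpa) r hr.2 (hKabs r hr)
    have h7 := (hMΦ t₀ ht₀T (mem_extChartAt_source (k t₀)) r hr).2
    have d1 : HasDerivWithinAt (fun r => Θ (z r t₀, κ t₀) (zt r t₀, κ'))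
        (fderiv ℝ Θ (z r t₀, κ t₀) (zr r t₀, (0 : EG)) (zt r t₀, κ') +
          Θ (z r t₀, κ t₀) (zm r t₀, (0 : EG))) (Icc 0 1) r :=
      (HasFDerivAt.comp_hasDerivWithinAt (f := fun r => (z r t₀, κ t₀)) r (hΘd _ h7)
        (h3.prodMk (hasDerivWithinAt_const r _ (κ t₀)))).clm_apply
        (h6.prodMk (hasDerivWithinAt_const r _ κ'))
    have d2 : HasDerivWithinAt (fun t => Θ (z r t, κ t) (zr r t, (0 : EG)))
        (fderiv ℝ Θ (z r t₀, κ t₀) (zt r t₀, κ') (zr r t₀, (0 : EG)) +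
          Θ (z r t₀, κ t₀) (zm r t₀, (0 : EG))) (Icc 0 1) t₀ :=
      (HasFDerivAt.comp_hasDerivWithinAt (f := fun t => (z r t, κ t)) t₀ (hΘd _ h7)
        (h4.prodMk hκ')).clm_apply
        (h5.prodMk (hasDerivWithinAt_const t₀ _ (0 : EG)))
    have d3 : HasDerivWithinAt (fun t => Θ (z r t, κ t) (zr r t, (0 : EG))) 0 (Icc 0 1) t₀ := by
      refine (hasDerivWithinAt_const t₀ _ (0 : EG)).congr_of_eventuallyEq ?_
        (hvr t₀ ht₀T (mem_extChartAt_source (k t₀)) r hr).2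
      filter_upwards [hT] with t ht using (hvr t ht.1 ht.2 r hr).2
    have d4 := (uniqueDiffWithinAt_Icc_zero_one ht₀).eq_deriv _ d2 d3
    have d5 : ρ r = fderiv ℝ Θ (z r t₀, κ t₀) (zr r t₀, (0 : EG)) (zt r t₀, κ') +
          Θ (z r t₀, κ t₀) (zm r t₀, (0 : EG)) := by
      rw [hρ]
      simp only
      rw [eq_neg_of_add_eq_zero_left d4, sub_neg_eq_add]
    rw [d5]
    refine d1.congr_of_eventuallyEq ?_ (hvt r hr).2
    filter_upwards [hKo r hr] with s hs using (hvt s hs).2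
  refine ⟨fun r hr hrδ => ?_, ?_⟩
  · have hrK : r ∈ K := ⟨by simpa [Real.dist_eq] using hrδ, hr⟩
    rw [hcurv r hrK]
    exact hA r hrK
  · obtain ⟨h1, -, h3, h4, h5, h6, h8, -⟩ := h t₀ ht₀ (by simpa) r₀ hr₀ (by simpa)
    have h7 := (hMΦ t₀ ht₀T (mem_extChartAt_source (k t₀)) r₀ hr₀K).2
    have c1 : ContinuousWithinAt (fun r => fderiv ℝ Θ (z r t₀, κ t₀)) (Icc 0 1) r₀ := by
      have hc : ContinuousAt (fderiv ℝ Θ) (z r₀ t₀, κ t₀) :=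
        (((hΘs _ h7).contDiffAt (hO'o.mem_nhds h7)).fderiv_right (m := 0)
          (by exact WithTop.coe_le_coe.2 le_top)).continuousAt
      exact ContinuousAt.comp_continuousWithinAt (f := fun r => (z r t₀, κ t₀)) hc
        (h3.continuousWithinAt.prodMk continuousWithinAt_const)
    have c2 : ContinuousWithinAt (fun r => (zr r t₀, (0 : EG))) (Icc 0 1) r₀ :=
      h8.prodMk continuousWithinAt_const
    have c3 : ContinuousWithinAt (fun r => (zt r t₀, κ')) (Icc 0 1) r₀ :=
      h6.continuousWithinAt.prodMk continuousWithinAt_const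
    have c4 : ContinuousWithinAt ρ (Icc 0 1) r₀ :=
      ((c1.clm_apply c2).clm_apply c3).sub ((c1.clm_apply c3).clm_apply c2)
    refine c4.congr_of_eventuallyEq ?_ (hcurv r₀ hr₀K)
    filter_upwards [hKo r₀ hr₀K] with s hs using hcurv s hs

/-- Horizontal lifts of the curves `r ↦ u (r, t)` that start on a horizontal lift of `t ↦ u (0, t)`
depend differentiably on `t`, and the connection form on the velocity of the end points is the
integral of the curvature. -/
theorem form_velocity_eq_integral_curvature [IsManifold 𝓘(ℝ, EB) ∞ B] [LieGroup 𝓘(ℝ, EG) ∞ G]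
    [FiniteDimensional ℝ EB] [FiniteDimensional ℝ EG] [FiniteDimensional ℝ EP]
    {u : ℝ × ℝ → B} (hu : ContMDiffOn 𝓘(ℝ, ℝ × ℝ) 𝓘(ℝ, EB) ∞ u (Icc 0 1 ×ˢ Icc 0 1))
    {Φ : ℝ → ℝ → P}
    (hΦ : ∀ t ∈ Icc (0 : ℝ) 1, conn.IsHorizontalLift (fun r => u (r, t)) fun r => Φ r t)
    {t : ℝ} (ht : t ∈ Icc (0 : ℝ) 1)
    (h0d : MDifferentiableWithinAt 𝓘(ℝ, ℝ) 𝓘(ℝ, EP) (fun t => Φ 0 t) (Icc 0 1) t)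
    (h0 : conn.form (Φ 0 t) (velocity (fun t => Φ 0 t) t) = 0) :
    (∀ r ∈ Icc (0 : ℝ) 1,
      MDifferentiableWithinAt 𝓘(ℝ, ℝ) 𝓘(ℝ, EP) (fun t => Φ r t) (Icc 0 1) t) ∧
    conn.form (Φ 1 t) (velocity (fun t => Φ 1 t) t) = ∫ r in (0 : ℝ)..1,
      conn.curvature (Φ r t) (velocity (fun s => Φ s t) r) (velocity (fun s => Φ r s) t) := by
  choose! δ hδ k hk1 hk2 using fun r₀ hr₀ =>
    conn.hasDerivWithinAt_form_velocity hu hΦ (r₀ := r₀) (t₀ := t) hr₀ ht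
  have hd : ∀ r ∈ Icc (0 : ℝ) 1,
      MDifferentiableWithinAt 𝓘(ℝ, ℝ) 𝓘(ℝ, EP) (fun t => Φ r t) (Icc 0 1) t := by
    intro r hr
    refine ((isPreconnected_Icc (a := (0 : ℝ)) (b := 1)).induction₂ (fun x y =>
      (MDifferentiableWithinAt 𝓘(ℝ, ℝ) 𝓘(ℝ, EP) (fun t => Φ x t) (Icc 0 1) t ↔
      MDifferentiableWithinAt 𝓘(ℝ, ℝ) 𝓘(ℝ, EP) (fun t => Φ y t) (Icc 0 1) t)) ?_
      (fun x y z _ _ _ h h' => h.trans h') (fun x y _ _ h => h.symm)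
      (left_mem_Icc.2 zero_le_one) hr).1 h0d
    intro x hx
    filter_upwards [mem_nhdsWithin_of_mem_nhds (Metric.ball_mem_nhds x (hδ x hx)),
      self_mem_nhdsWithin] with y hy hyI
    exact (hk1 x hx x hx (by simpa using hδ x hx)).trans
      (hk1 x hx y hyI (by simpa [Real.dist_eq] using hy)).symm
  refine ⟨hd, ?_⟩
  have hk : ∀ r ∈ Icc (0 : ℝ) 1, MDifferentiableWithinAt 𝓘(ℝ, ℝ) 𝓘(ℝ, EG) (k r) (Icc 0 1) t :=
    fun r hr => (hk1 r hr r hr (by simpa using hδ r hr)).1 (hd r hr)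
  have hA := fun r hr => (hk2 r hr (hk r hr)).1 r hr (by simpa using hδ r hr)
  have hR : ContinuousOn (fun r => conn.curvature (Φ r t) (velocity (fun s => Φ s t) r)
      (velocity (fun s => Φ r s) t)) (Icc 0 1) := fun r hr => (hk2 r hr (hk r hr)).2
  rw [intervalIntegral.integral_eq_sub_of_hasDerivAt_of_le zero_le_one
    (fun r hr => (hA r hr).continuousWithinAt)
    (fun r hr => (hA r (Ioo_subset_Icc_self hr)).hasDerivAt (Icc_mem_nhds hr.1 hr.2))
    (hR.intervalIntegrable_of_Icc zero_le_one), h0, sub_zero]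

end PrincipalConnection

end Bundle

section Bundle

variable {EB : Type*} [NormedAddCommGroup EB] [NormedSpace ℝ EB]
  {B : Type*} [TopologicalSpace B] [ChartedSpace EB B]
  {EP : Type*} [NormedAddCommGroup EP] [NormedSpace ℝ EP]
  {P : Type*} [TopologicalSpace P] [ChartedSpace EP P]
  {EG : Type*} [NormedAddCommGroup EG] [NormedSpace ℝ EG]
  {G : Type*} [TopologicalSpace G] [ChartedSpace EG G] [Group G]
  {Q : PrincipalBundle EB B EP P EG G}

open Filter Topology

namespace PrincipalConnection

variable [IsManifold 𝓘(ℝ, EP) ∞ P] [LieGroup 𝓘(ℝ, EG) ∞ G] (conn : PrincipalConnection Q)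

theorem IsHolonomy.unique {γ : ℝ → B} {p : P} {g h : G} (hg : conn.IsHolonomy γ p g)
    (hh : conn.IsHolonomy γ p h) : g = h := by
  obtain ⟨c, hc, hc0, hc1⟩ := hg
  obtain ⟨d, hd, hd0, hd1⟩ := hh
  have h1 := hc.eqOn hd (left_mem_Icc.2 zero_le_one) (hc0.trans hd0.symm)
    (right_mem_Icc.2 zero_le_one)
  exact Q.act_left_cancel (hc1.symm.trans (h1.trans hd1))

theorem existsUnique_isHolonomy [IsManifold 𝓘(ℝ, EB) ∞ B] [FiniteDimensional ℝ EB]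
    [FiniteDimensional ℝ EG] {γ : ℝ → B} (hγ : ContMDiffOn 𝓘(ℝ, ℝ) 𝓘(ℝ, EB) ∞ γ (Icc 0 1))
    (h01 : γ 0 = γ 1) {p : P} (hp : Q.proj p = γ 0) : ∃! h : G, conn.IsHolonomy γ p h := by
  obtain ⟨c, hc, hc0⟩ := conn.exists_isHorizontalLift hγ (left_mem_Icc.2 zero_le_one) hp
  obtain ⟨h, hh⟩ := Q.exists_act (p := p) (q := c 1)
    (by rw [hp, hc.1 1 (right_mem_Icc.2 zero_le_one), h01])
  exact ⟨h, ⟨c, hc, hc0, hh.symm⟩, fun g hg => hg.unique conn ⟨c, hc, hc0, hh.symm⟩⟩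

/-- Over the far edge of a square, the horizontal lift is compared with the end points of a family
of horizontal lifts by a path-ordered exponential. -/
theorem exists_isHorizontalLift_iff_isPathOrderedExp {γ : ℝ → B} {d : ℝ → P} {a : ℝ → EG} {h : G}
    (hp : ∀ t ∈ Icc (0 : ℝ) 1, Q.proj (d t) = γ t)
    (hd : ∀ t ∈ Icc (0 : ℝ) 1, MDifferentiableWithinAt 𝓘(ℝ, ℝ) 𝓘(ℝ, EP) d (Icc 0 1) t)
    (ha : ∀ t ∈ Icc (0 : ℝ) 1, conn.form (d t) (velocity d t) = -a t) :
    (∃ c : ℝ → P, conn.IsHorizontalLift γ c ∧ c 0 = d 0 ∧ c 1 = Q.act (d 1) h) ↔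
      IsPathOrderedExp a h := by
  have ha' : ∀ t ∈ Icc (0 : ℝ) 1, -conn.form (d t) (velocity d t) = a t := fun t ht => by
    rw [ha t ht, neg_neg]
  constructor
  · rintro ⟨c, hc, hc0, hc1⟩
    have hex : ∀ t ∈ Icc (0 : ℝ) 1, ∃ g, Q.act (d t) g = c t := fun t ht =>
      Q.exists_act (by rw [hp t ht, hc.1 t ht])
    choose! g hg using hex
    refine ⟨g, ?_, ?_, fun t ht => ?_⟩
    · exact Q.act_left_cancel (p := d 0)
        (by rw [hg 0 (left_mem_Icc.2 zero_le_one), Q.act_one, hc0])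
    · exact Q.act_left_cancel (p := d 1) (by rw [hg 1 (right_mem_Icc.2 zero_le_one), hc1])
    · have h1 := (isHorizontalLift_iff.1 hc t ht).hasMFDerivWithinAt_of_act_eq (g := g) ht (hd t ht)
        (by filter_upwards [self_mem_nhdsWithin] with s hs using hg s hs)
      rw [ha' t ht] at h1
      exact h1
  · rintro ⟨g, hg0, hg1, hg⟩
    refine ⟨fun t => Q.act (d t) (g t), isHorizontalLift_iff.2 fun t ht => ?_, ?_, ?_⟩
    · refine isHorizontalAt_act ht (hp t ht) (hd t ht) ?_
      rw [ha' t ht]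
      exact hg t ht
    · simp only [hg0, Q.act_one]
    · simp only [hg1]

section Disc

theorem polar_one_eq_polar_zero {X : Type*} (f : ℂ → X) : (fun r : ℝ => f (r * Complex.exp (2 * Real.pi * (1 : ℝ) * Complex.I))) =
    fun r : ℝ => f (r * Complex.exp (2 * Real.pi * (0 : ℝ) * Complex.I)) := by
  funext r
  simp [Complex.exp_two_pi_mul_I]

variable {f : ℂ → B}

theorem contMDiffOn_polar (hf : ContMDiffOn 𝓘(ℝ, ℂ) 𝓘(ℝ, EB) ∞ f (Metric.closedBall 0 1)) :
    ContMDiffOn 𝓘(ℝ, ℝ × ℝ) 𝓘(ℝ, EB) ∞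
      (fun x : ℝ × ℝ => f (x.1 * Complex.exp (2 * Real.pi * x.2 * Complex.I)))
      (Icc 0 1 ×ˢ Icc 0 1) := by
  have h1 : ContDiff ℝ ∞ fun x : ℝ × ℝ => (x.1 : ℂ) * Complex.exp (2 * Real.pi * x.2 * Complex.I) := by
    have e : ∀ L : ℝ × ℝ →L[ℝ] ℝ, ContDiff ℝ ∞ fun x : ℝ × ℝ => ((L x : ℝ) : ℂ) := fun L =>
      Complex.ofRealCLM.contDiff.comp L.contDiff
    exact (e (ContinuousLinearMap.fst ℝ ℝ ℝ)).mul
      ((contDiff_const.mul (e (ContinuousLinearMap.snd ℝ ℝ ℝ))).mul contDiff_const).cexp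
  refine hf.comp h1.contMDiff.contMDiffOn fun x hx => ?_
  have h2 : (2 * Real.pi * x.2 * Complex.I : ℂ) = ((2 * Real.pi * x.2 : ℝ) : ℂ) * Complex.I := by
    push_cast; ring
  simp only [mem_preimage, Metric.mem_closedBall, dist_zero_right, norm_mul]
  rw [h2, Complex.norm_exp_ofReal_mul_I, mul_one, Complex.norm_real, Real.norm_eq_abs,
    abs_of_nonneg hx.1.1]
  exact hx.1.2

variable {conn} in
theorem IsRadialLift.isHolonomy_iff [IsManifold 𝓘(ℝ, EB) ∞ B] [FiniteDimensional ℝ EB]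
    [FiniteDimensional ℝ EG] [FiniteDimensional ℝ EP]
    (hf : ContMDiffOn 𝓘(ℝ, ℂ) 𝓘(ℝ, EB) ∞ f (Metric.closedBall 0 1)) {γ : ℝ → B}
    (hγ : ∀ t ∈ Icc (0 : ℝ) 1, γ t = f (Complex.exp (2 * Real.pi * t * Complex.I)))
    {p₀ : P} {Φ : ℝ → ℝ → P} (hΦ : conn.IsRadialLift f p₀ Φ) (h : G) :
    conn.IsHolonomy γ p₀ h ↔ IsPathOrderedExp (fun t => -∫ r in (0 : ℝ)..1,
      conn.curvature (Φ r t) (velocity (fun s => Φ s t) r) (velocity (fun s => Φ r s) t)) h := by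
  have h0 : (0 : ℝ) ∈ Icc (0 : ℝ) 1 := left_mem_Icc.2 zero_le_one
  have h1 : (1 : ℝ) ∈ Icc (0 : ℝ) 1 := right_mem_Icc.2 zero_le_one
  have hcentre : ∀ t ∈ Icc (0 : ℝ) 1, conn.form (Φ 0 t) (velocity (fun t => Φ 0 t) t) = 0 := by
    intro t ht
    have hev : (fun t => Φ 0 t) =ᶠ[𝓝[Icc 0 1] t] fun _ => Φ 0 0 := by
      filter_upwards [self_mem_nhdsWithin] with s hs using hΦ.centre s hs
    have hv : (velocity (fun t => Φ 0 t) t : EP) = 0 := by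
      refine (velocity_congr ht hev).trans ?_
      unfold velocity
      rw [mfderivWithin_const]
      rfl
    exact (congrArg (conn.form (Φ 0 t)) hv).trans (map_zero _)
  have h11 : Φ 1 1 = p₀ := by
    have h2 := hΦ.lift 1 h1
    rw [polar_one_eq_polar_zero f] at h2
    exact (h2.eqOn (hΦ.lift 0 h0) h0 (hΦ.centre 1 h1) h1).trans hΦ.basepoint
  have key := conn.exists_isHorizontalLift_iff_isPathOrderedExp (γ := γ) (d := fun t => Φ 1 t)
    (a := fun t => -∫ r in (0 : ℝ)..1,
      conn.curvature (Φ r t) (velocity (fun s => Φ s t) r) (velocity (fun s => Φ r s) t)) (h := h)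
    (fun t ht => by rw [(hΦ.lift t ht).1 1 h1, hγ t ht]; simp)
    (fun t ht => hΦ.mdifferentiableOn 1 h1 t ht)
    (fun t ht => by
      rw [neg_neg]
      exact (conn.form_velocity_eq_integral_curvature (contMDiffOn_polar hf) hΦ.lift ht
        (hΦ.mdifferentiableOn 0 h0 t ht) (hcentre t ht)).2)
  rw [h11, hΦ.basepoint] at key
  exact key

theorem exists_isRadialLift [IsManifold 𝓘(ℝ, EB) ∞ B] [FiniteDimensional ℝ EB]
    [FiniteDimensional ℝ EG] [FiniteDimensional ℝ EP]
    (hf : ContMDiffOn 𝓘(ℝ, ℂ) 𝓘(ℝ, EB) ∞ f (Metric.closedBall 0 1)) {p₀ : P}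
    (hp : Q.proj p₀ = f 1) : ∃ Φ, conn.IsRadialLift f p₀ Φ := by
  have h0 : (0 : ℝ) ∈ Icc (0 : ℝ) 1 := left_mem_Icc.2 zero_le_one
  have h1 : (1 : ℝ) ∈ Icc (0 : ℝ) 1 := right_mem_Icc.2 zero_le_one
  have hu := contMDiffOn_polar hf
  have hus : ∀ t ∈ Icc (0 : ℝ) 1, ContMDiffOn 𝓘(ℝ, ℝ) 𝓘(ℝ, EB) ∞
      (fun r : ℝ => f (r * Complex.exp (2 * Real.pi * t * Complex.I))) (Icc 0 1) := fun t ht =>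
    hu.comp (f := fun r : ℝ => (r, t)) (ContDiff.contMDiff (by fun_prop)).contMDiffOn
      fun r hr => ⟨hr, ht⟩
  obtain ⟨c₀, hc₀, hc₀1⟩ := conn.exists_isHorizontalLift (hus 0 h0) h1 (p := p₀) (by simpa using hp)
  have hex : ∀ t ∈ Icc (0 : ℝ) 1, ∃ c, conn.IsHorizontalLift
      (fun r : ℝ => f (r * Complex.exp (2 * Real.pi * t * Complex.I))) c ∧ c 0 = c₀ 0 :=
    fun t ht => conn.exists_isHorizontalLift (hus t ht) h0 (by rw [hc₀.1 0 h0]; simp)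
  have : Nonempty P := ⟨p₀⟩
  choose! Φ hΦ hΦ0 using hex
  have hd0 : ∀ t ∈ Icc (0 : ℝ) 1, ∀ᶠ s in 𝓝[Icc 0 1] t, Φ s 0 = c₀ 0 := fun t _ => by
    filter_upwards [self_mem_nhdsWithin] with s hs using hΦ0 s hs
  refine ⟨fun r t => Φ t r, ?_, fun t ht => (hΦ0 t ht).trans (hΦ0 0 h0).symm, hΦ, fun r hr t ht => ?_⟩
  · exact ((hΦ 0 h0).eqOn hc₀ h0 (hΦ0 0 h0) h1).trans hc₀1
  · refine (conn.form_velocity_eq_integral_curvature (Φ := fun r t => Φ t r) hu hΦ ht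
      ((mdifferentiableWithinAt_const (c := c₀ 0)).congr_of_eventuallyEq (hd0 t ht)
        (hΦ0 t ht)) ?_).1 r hr
    have hv : (velocity (fun t => Φ t 0) t : EP) = 0 := by
      refine (velocity_congr (d := fun _ => c₀ 0) ht (hd0 t ht)).trans ?_
      unfold velocity
      rw [mfderivWithin_const]
      rfl
    exact (congrArg (conn.form (Φ t 0)) hv).trans (map_zero _)

/-- The holonomy of the boundary of a disc is the path-ordered exponential of minus its curvature. -/
theorem isHolonomy_iff_isSurfaceOrderedExp [IsManifold 𝓘(ℝ, EB) ∞ B] [FiniteDimensional ℝ EB]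
    [FiniteDimensional ℝ EG] [FiniteDimensional ℝ EP]
    (hf : ContMDiffOn 𝓘(ℝ, ℂ) 𝓘(ℝ, EB) ∞ f (Metric.closedBall 0 1)) {γ : ℝ → B}
    (hγ : ∀ t ∈ Icc (0 : ℝ) 1, γ t = f (Complex.exp (2 * Real.pi * t * Complex.I)))
    {p₀ : P} (hp : Q.proj p₀ = γ 0) :
    (∃! h : G, conn.IsHolonomy γ p₀ h) ∧
      ∀ h : G, conn.IsHolonomy γ p₀ h ↔ conn.IsSurfaceOrderedExp f p₀ h := by
  have h0 : (0 : ℝ) ∈ Icc (0 : ℝ) 1 := left_mem_Icc.2 zero_le_one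
  have h1 : (1 : ℝ) ∈ Icc (0 : ℝ) 1 := right_mem_Icc.2 zero_le_one
  have hγ0 : γ 0 = f 1 := by rw [hγ 0 h0]; simp
  have hγ1 : γ 1 = f 1 := by rw [hγ 1 h1]; simp [Complex.exp_two_pi_mul_I]
  have hγs : ContMDiffOn 𝓘(ℝ, ℝ) 𝓘(ℝ, EB) ∞ γ (Icc 0 1) := by
    refine ((contMDiffOn_polar hf).comp (f := fun t : ℝ => ((1 : ℝ), t))
      (ContDiff.contMDiff (by fun_prop)).contMDiffOn fun t ht => ⟨h1, ht⟩).congr fun t ht => ?_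
    rw [hγ t ht]
    simp
  refine ⟨conn.existsUnique_isHolonomy hγs (hγ0.trans hγ1.symm) hp, fun h => ⟨fun hh => ?_, ?_⟩⟩
  · obtain ⟨Φ, hΦ⟩ := conn.exists_isRadialLift hf (hp.trans hγ0)
    exact ⟨Φ, hΦ, (hΦ.isHolonomy_iff hf hγ h).1 hh⟩
  · rintro ⟨Φ, hΦ, hh⟩
    exact (hΦ.isHolonomy_iff hf hγ h).2 hh

end Disc

end PrincipalConnection

end Bundle

/-! ### The translation group of a vector space -/

section Translation

variable {V : Type*} [NormedAddCommGroup V] [NormedSpace ℝ V]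

theorem mfderiv_mul_right_translation (g : Multiplicative V) (v : V) :
    (mfderiv 𝓘(ℝ, V) 𝓘(ℝ, V) (fun x : Multiplicative V => x * g) 1 v : V) = v := by
  have h : HasMFDerivAt 𝓘(ℝ, V) 𝓘(ℝ, V) (fun x : V => x + g.toAdd) (0 : V)
      (ContinuousLinearMap.id ℝ V) :=
    ((hasFDerivAt_id (𝕜 := ℝ) (0 : V)).add_const g.toAdd).hasMFDerivAt
  have h' : HasMFDerivAt 𝓘(ℝ, V) 𝓘(ℝ, V) (fun x : Multiplicative V => x * g) 1
      (ContinuousLinearMap.id ℝ V) := h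
  exact congrArg (fun T : V →L[ℝ] V => T v) h'.mfderiv

theorem mfderiv_mul_left_translation (g : Multiplicative V) (v : V) :
    (mfderiv 𝓘(ℝ, V) 𝓘(ℝ, V) (fun x : Multiplicative V => g * x) 1 v : V) = v := by
  have h : (fun x : Multiplicative V => g * x) = fun x => x * g := funext fun x => mul_comm g x
  rw [h]
  exact mfderiv_mul_right_translation g v

theorem adjointAction_translation (g : Multiplicative V) (v : V) : adjointAction V g v = v := by
  have h : (fun x : Multiplicative V => g * x * g⁻¹) = id := by ext x; simp
  unfold adjointAction
  rw [h]
  exact congrArg (fun T : V →L[ℝ] V => T v) (mfderiv_id (I := 𝓘(ℝ, V)) (x := (1 : Multiplicative V)))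

theorem structureBracket_translation (v w : V) : structureBracket (Multiplicative V) v w = 0 := by
  have h (v : V) : (mulInvariantVectorField (I := 𝓘(ℝ, V))
      (v : GroupLieAlgebra 𝓘(ℝ, V) (Multiplicative V)) :
      ∀ g : Multiplicative V, TangentSpace 𝓘(ℝ, V) g) = fun _ => (v : V) := by
    funext g
    exact mfderiv_mul_left_translation g v
  have h2 : VectorField.mlieBracket 𝓘(ℝ, V)
      (mulInvariantVectorField (I := 𝓘(ℝ, V)) (v : GroupLieAlgebra 𝓘(ℝ, V) (Multiplicative V)))
      (mulInvariantVectorField (I := 𝓘(ℝ, V)) (w : GroupLieAlgebra 𝓘(ℝ, V) (Multiplicative V)))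
      (1 : Multiplicative V) = (0 : V) := by
    rw [h v, h w]
    have h3 : VectorField.mlieBracket 𝓘(ℝ, V) (M := V) (fun x => (v : TangentSpace 𝓘(ℝ, V) x))
        (fun x => (w : TangentSpace 𝓘(ℝ, V) x)) (0 : V) = (0 : V) := by
      have h4 : VectorField.lieBracketWithin ℝ (fun _ : V => v) (fun _ : V => w) univ 0 = 0 := by
        simp [VectorField.lieBracketWithin]
      exact (congrFun (VectorField.mlieBracketWithin_eq_lieBracketWithin
        (V := fun x => (v : TangentSpace 𝓘(ℝ, V) x)) (W := fun x => (w : TangentSpace 𝓘(ℝ, V) x))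
        (s := univ)) 0).trans h4
    exact h3
  exact h2

/-- For the translation group, path-ordered exponentials are exponentials of integrals. -/
theorem isPathOrderedExp_translation [CompleteSpace V] {a : ℝ → V}
    (ha : ContinuousOn a (Icc 0 1)) :
    IsPathOrderedExp a (Multiplicative.ofAdd (∫ t in (0 : ℝ)..1, a t)) := by
  refine ⟨fun t => Multiplicative.ofAdd (∫ s in (0 : ℝ)..t, a s), by simp, rfl, fun t ht => ?_⟩
  have h1 : HasDerivWithinAt (fun t => ∫ s in (0 : ℝ)..t, a s) (a t) (Icc 0 1) t := by
    have : Fact (t ∈ Icc (0 : ℝ) 1) := ⟨ht⟩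
    exact intervalIntegral.integral_hasDerivWithinAt_right
      ((ha.mono (by rw [uIcc_of_le ht.1]; exact Icc_subset_Icc_right ht.2)).intervalIntegrable)
      (ha.stronglyMeasurableAtFilter_nhdsWithin measurableSet_Icc t) (ha t ht)
  have h2 : HasMFDerivWithinAt 𝓘(ℝ, ℝ) 𝓘(ℝ, V) (fun t => ∫ s in (0 : ℝ)..t, a s) (Icc 0 1) t
      (ContinuousLinearMap.toSpanSingleton ℝ (a t)) := h1.hasFDerivWithinAt.hasMFDerivWithinAt
  exact hasMFDerivWithinAt_congr_deriv (P := Multiplicative V) (EP := V)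
    (c := fun t => Multiplicative.ofAdd (∫ s in (0 : ℝ)..t, a s)) h2
    (congrArg (ContinuousLinearMap.toSpanSingleton ℝ) (mfderiv_mul_right_translation _ (a t)).symm)

end Translation

section Bundle

variable {EB : Type*} [NormedAddCommGroup EB] [NormedSpace ℝ EB]
  {B : Type*} [TopologicalSpace B] [ChartedSpace EB B]
  {EP : Type*} [NormedAddCommGroup EP] [NormedSpace ℝ EP]
  {P : Type*} [TopologicalSpace P] [ChartedSpace EP P]
  {EG : Type*} [NormedAddCommGroup EG] [NormedSpace ℝ EG]
  {G : Type*} [TopologicalSpace G] [ChartedSpace EG G] [Group G]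
  {V : Type*} [NormedAddCommGroup V] [NormedSpace ℝ V]

open Filter Topology

/-- The differential of the bundle projection is surjective. -/
theorem PrincipalBundle.exists_mfderiv_proj_eq [IsManifold 𝓘(ℝ, EB) ∞ B]
    (Q : PrincipalBundle EB B EP P EG G) (b : B) : ∃ p, Q.proj p = b ∧ ∀ β : EB, ∃ u : EP,
      (mfderiv 𝓘(ℝ, EP) 𝓘(ℝ, EB) Q.proj p u : EB) = β := by
  obtain ⟨O, σ, hO, hb, hOt, hσ, hproj⟩ := Q.exists_local_section b
  set ψ := extChartAt 𝓘(ℝ, EB) b with hψ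
  refine ⟨σ (ψ b), (hproj _ hb).trans (extChartAt_to_inv b), fun β =>
    ⟨mfderiv 𝓘(ℝ, EB) 𝓘(ℝ, EP) σ (ψ b) β, ?_⟩⟩
  have h1 : Q.proj ∘ σ =ᶠ[𝓝 (ψ b)] ψ.symm := by
    filter_upwards [hO.mem_nhds hb] with x hx using hproj x hx
  have h2 := mfderiv_comp (ψ b) ((Q.contMDiff_proj.mdifferentiable (n := ∞) (by simp)) (σ (ψ b)))
    (((hσ _ hb).contMDiffAt (hO.mem_nhds hb)).mdifferentiableAt (by simp))
  have h3 := congrArg (fun T : EB →L[ℝ] EB => T β) (h2.symm.trans h1.mfderiv_eq)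
  exact Eq.trans h3 (mfderiv_extChartAt_symm_self b β)

namespace PrincipalConnection

variable [IsManifold 𝓘(ℝ, EP) ∞ P] {Q : PrincipalBundle EB B EP P V (Multiplicative V)}
  (conn : PrincipalConnection Q)

theorem pullForm_act_translation {σ : EB → P} {x : EB}
    (hσ : ContMDiffAt 𝓘(ℝ, EB) 𝓘(ℝ, EP) ∞ σ x) (y : V) (β : EB) (η : V) :
    conn.pullForm (fun z : EB × V => Q.act (σ z.1) (Multiplicative.ofAdd z.2)) (x, y) (β, η) =
      conn.pullForm σ x β + η := by
  have hu : UniqueDiffWithinAt ℝ (univ : Set ℝ) 0 := uniqueDiffWithinAt_univ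
  have hzx : HasDerivWithinAt (fun s : ℝ => x + s • β) β univ 0 := by
    simpa only [one_smul, id] using (((hasDerivAt_id (0 : ℝ)).smul_const β).const_add x).hasDerivWithinAt
  have hzy : HasDerivWithinAt (fun s : ℝ => y + s • η) η univ 0 := by
    simpa only [one_smul, id] using (((hasDerivAt_id (0 : ℝ)).smul_const η).const_add y).hasDerivWithinAt
  have e0 : x + (0 : ℝ) • β = x := by simp
  have f0 : y + (0 : ℝ) • η = y := by simp
  have h1 := conn.form_mfderivWithin_eq_pullForm (N := σ) (c := σ ∘ fun s : ℝ => x + s • β) hzx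
    (by rw [e0]; exact hσ.mdifferentiableAt (by simp)) EventuallyEq.rfl rfl hu
  have hN : ContMDiffAt 𝓘(ℝ, EB × V) 𝓘(ℝ, EP) ∞
      (fun z : EB × V => Q.act (σ z.1) (Multiplicative.ofAdd z.2)) (x, y) := by
    have ha : ContMDiffAt 𝓘(ℝ, EB × V) 𝓘(ℝ, EP) ∞ (fun z : EB × V => σ z.1) (x, y) :=
      ContMDiffAt.comp (x, y) (g := σ) (f := Prod.fst) hσ contDiff_fst.contMDiff.contMDiffAt
    have hb : ContMDiffAt 𝓘(ℝ, EB × V) 𝓘(ℝ, V) ∞ (fun z : EB × V => z.2) (x, y) :=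
      contDiff_snd.contMDiff.contMDiffAt
    have hb' : ContMDiffAt 𝓘(ℝ, EB × V) 𝓘(ℝ, V) ∞
      (fun z : EB × V => Multiplicative.ofAdd z.2) (x, y) := hb
    exact Q.contMDiff_act.contMDiffAt.comp (x, y) (ha.prodMk hb')
  have h2 := conn.form_mfderivWithin_eq_pullForm
    (N := fun z : EB × V => Q.act (σ z.1) (Multiplicative.ofAdd z.2))
    (z := fun s : ℝ => (x + s • β, y + s • η))
    (c := fun s : ℝ => Q.act (σ (x + s • β)) (Multiplicative.ofAdd (y + s • η))) (hzx.prodMk hzy)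
    (by rw [e0, f0]; exact hN.mdifferentiableAt (by simp)) EventuallyEq.rfl rfl hu
  have hg : HasMFDerivWithinAt 𝓘(ℝ, ℝ) 𝓘(ℝ, V) (fun s : ℝ => y + s • η) univ 0
      (ContinuousLinearMap.toSpanSingleton ℝ η) := hzy.hasFDerivWithinAt.hasMFDerivWithinAt
  have h3 := conn.form_mfderivWithin_act (c := σ ∘ fun s : ℝ => x + s • β)
    (g := fun s : ℝ => Multiplicative.ofAdd (y + s • η)) (η := η) hu h1.1
    (hasMFDerivWithinAt_congr_deriv (P := Multiplicative V) (EP := V)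
      (c := fun s : ℝ => Multiplicative.ofAdd (y + s • η)) hg
      (congrArg (ContinuousLinearMap.toSpanSingleton ℝ) (mfderiv_mul_right_translation _ η).symm))
  have h4 := h2.2.2.symm.trans (h3.2.trans (adjointAction_translation _ _))
  rw [h1.2.2] at h4
  rw [e0, f0] at h4
  exact h4

end PrincipalConnection

end Bundle

section Bundle

variable {EB : Type*} [NormedAddCommGroup EB] [NormedSpace ℝ EB]
  {B : Type*} [TopologicalSpace B] [ChartedSpace EB B]
  {EP : Type*} [NormedAddCommGroup EP] [NormedSpace ℝ EP]
  {P : Type*} [TopologicalSpace P] [ChartedSpace EP P]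
  {V : Type*} [NormedAddCommGroup V] [NormedSpace ℝ V]

open Filter Topology

namespace PrincipalConnection

variable [IsManifold 𝓘(ℝ, EP) ∞ P] [IsManifold 𝓘(ℝ, EB) ∞ B]
  {Q : PrincipalBundle EB B EP P V (Multiplicative V)}
  (conn : PrincipalConnection Q)

/-- For the translation group, the curvature is locally the pull-back of the exterior derivative of
the local connection form on the base. -/
theorem exists_curvature_eq [FiniteDimensional ℝ EB] [FiniteDimensional ℝ EP]
    [FiniteDimensional ℝ V] (b₀ : B) :
    ∃ (O : Set EB) (α : EB → EB →L[ℝ] V), IsOpen O ∧ extChartAt 𝓘(ℝ, EB) b₀ b₀ ∈ O ∧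
      ContDiffOn ℝ ∞ α O ∧
      ∀ (p : P) (u v : EP), Q.proj p ∈ (extChartAt 𝓘(ℝ, EB) b₀).source →
        extChartAt 𝓘(ℝ, EB) b₀ (Q.proj p) ∈ O → conn.curvature p u v =
          fderiv ℝ α (extChartAt 𝓘(ℝ, EB) b₀ (Q.proj p))
            (mfderiv 𝓘(ℝ, EB) 𝓘(ℝ, EB) (extChartAt 𝓘(ℝ, EB) b₀) (Q.proj p)
              (mfderiv 𝓘(ℝ, EP) 𝓘(ℝ, EB) Q.proj p u))
            (mfderiv 𝓘(ℝ, EB) 𝓘(ℝ, EB) (extChartAt 𝓘(ℝ, EB) b₀) (Q.proj p)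
              (mfderiv 𝓘(ℝ, EP) 𝓘(ℝ, EB) Q.proj p v)) -
          fderiv ℝ α (extChartAt 𝓘(ℝ, EB) b₀ (Q.proj p))
            (mfderiv 𝓘(ℝ, EB) 𝓘(ℝ, EB) (extChartAt 𝓘(ℝ, EB) b₀) (Q.proj p)
              (mfderiv 𝓘(ℝ, EP) 𝓘(ℝ, EB) Q.proj p v))
            (mfderiv 𝓘(ℝ, EB) 𝓘(ℝ, EB) (extChartAt 𝓘(ℝ, EB) b₀) (Q.proj p)
              (mfderiv 𝓘(ℝ, EP) 𝓘(ℝ, EB) Q.proj p u)) := by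
  obtain ⟨O, σ, τ, hO, hb, hOt, hσ, hproj, hτ⟩ := Q.exists_local_section_coordinate b₀
  set ψ := extChartAt 𝓘(ℝ, EB) b₀ with hψ
  have hα : ContDiffOn ℝ ∞ (conn.pullForm σ) O := conn.contDiffOn_pullForm hO hσ
  refine ⟨O, conn.pullForm σ, hO, hb, hα, fun p u v hps hpO => ?_⟩
  set N : EB × V → P := fun z => Q.act (σ z.1) (Multiplicative.ofAdd z.2) with hNdef
  set M : P → EB × V := fun q => (ψ (Q.proj q), (τ q).toAdd) with hM
  have hOO : IsOpen (O ×ˢ (univ : Set V)) := hO.prod isOpen_univ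
  have hN : ContMDiffOn 𝓘(ℝ, EB × V) 𝓘(ℝ, EP) ∞ N (O ×ˢ univ) := by
    have h1 : ContMDiffOn 𝓘(ℝ, EB × V) 𝓘(ℝ, EP) ∞ (fun z : EB × V => σ z.1) (O ×ˢ univ) :=
      hσ.comp contDiff_fst.contMDiff.contMDiffOn fun z hz => hz.1
    have h2 : ContMDiffOn 𝓘(ℝ, EB × V) 𝓘(ℝ, V) ∞ (fun z : EB × V => z.2) (O ×ˢ univ) :=
      contDiff_snd.contMDiff.contMDiffOn
    have h2' : ContMDiffOn 𝓘(ℝ, EB × V) 𝓘(ℝ, V) ∞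
      (fun z : EB × V => Multiplicative.ofAdd z.2) (O ×ˢ univ) := h2
    exact Q.contMDiff_act.comp_contMDiffOn (h1.prodMk h2')
  have hz : M p ∈ O ×ˢ (univ : Set V) := ⟨hpO, mem_univ _⟩
  have hNM : N (M p) = p := (hτ p hps hpO).2
  have hev : N ∘ M =ᶠ[𝓝 p] id := by
    have h1 : ContinuousAt Q.proj p := Q.contMDiff_proj.continuous.continuousAt
    have h2 : ContinuousAt (fun q => ψ (Q.proj q)) p :=
      (continuousAt_extChartAt' (I := 𝓘(ℝ, EB)) (x := b₀) hps).comp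
        (f := Q.proj) h1
    filter_upwards [h1.eventually ((isOpen_extChartAt_source b₀).mem_nhds hps),
      h2.eventually (hO.mem_nhds hpO)] with q hq hq'
    exact (hτ q hq hq').2
  have hψπ : HasMFDerivAt 𝓘(ℝ, EP) 𝓘(ℝ, EB) (fun q => ψ (Q.proj q)) p _ :=
    (mdifferentiableAt_extChartAt (I := 𝓘(ℝ, EB)) (by simpa [hψ] using hps)).hasMFDerivAt.comp p
      ((Q.contMDiff_proj.mdifferentiable (n := ∞) (by simp)) p).hasMFDerivAt
  have hτd : HasMFDerivAt 𝓘(ℝ, EP) 𝓘(ℝ, V) (fun q => (τ q).toAdd) p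
    (mfderiv 𝓘(ℝ, EP) 𝓘(ℝ, V) τ p) := (hτ p hps hpO).1.hasMFDerivAt
  have hMd : HasMFDerivAt 𝓘(ℝ, EP) 𝓘(ℝ, EB × V) M p
      (((mfderiv 𝓘(ℝ, EB) 𝓘(ℝ, EB) ψ (Q.proj p) : EB →L[ℝ] EB).comp
        (mfderiv 𝓘(ℝ, EP) 𝓘(ℝ, EB) Q.proj p : EP →L[ℝ] EB)).prod
        (mfderiv 𝓘(ℝ, EP) 𝓘(ℝ, V) τ p : EP →L[ℝ] V)) :=
    ⟨hψπ.1.prodMk hτd.1, hψπ.2.prodMk hτd.2⟩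
  have hNd : MDifferentiableAt 𝓘(ℝ, EB × V) 𝓘(ℝ, EP) N (M p) :=
    ((hN _ hz).contMDiffAt (hOO.mem_nhds hz)).mdifferentiableAt (by simp)
  have hid := (hNd.hasMFDerivAt.comp p hMd).mfderiv.symm.trans
    (hev.mfderiv_eq.trans mfderiv_id)
  have hu (w : EP) : w = (mfderiv 𝓘(ℝ, EB × V) 𝓘(ℝ, EP) N (M p)
      ((mfderiv 𝓘(ℝ, EB) 𝓘(ℝ, EB) ψ (Q.proj p) (mfderiv 𝓘(ℝ, EP) 𝓘(ℝ, EB) Q.proj p w),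
        mfderiv 𝓘(ℝ, EP) 𝓘(ℝ, V) τ p w) : EB × V) : EP) :=
    (congrArg (fun T : EP →L[ℝ] EP => T w) hid).symm
  have hθ : conn.pullForm N =ᶠ[𝓝 (M p)] fun z =>
      (conn.pullForm σ z.1).comp (ContinuousLinearMap.fst ℝ EB V) +
        ContinuousLinearMap.snd ℝ EB V := by
    filter_upwards [hOO.mem_nhds hz] with z hz
    ext w
    · have := conn.pullForm_act_translation ((hσ _ hz.1).contMDiffAt (hO.mem_nhds hz.1)) z.2 w 0
      simpa using this
    · have := conn.pullForm_act_translation ((hσ _ hz.1).contMDiffAt (hO.mem_nhds hz.1)) z.2 0 w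
      simpa using this
  have hαd : DifferentiableAt ℝ (conn.pullForm σ) (M p).1 :=
    (hα.contDiffAt (hO.mem_nhds hpO)).differentiableAt (by simp)
  have hθd : ∀ a b : EB × V, fderiv ℝ (conn.pullForm N) (M p) a b =
      fderiv ℝ (conn.pullForm σ) (M p).1 a.1 b.1 := by
    intro a b
    have h1 : HasFDerivAt (fun z : EB × V => conn.pullForm σ z.1) _ (M p) :=
      hαd.hasFDerivAt.comp (M p) hasFDerivAt_fst
    rw [hθ.fderiv_eq, ((h1.clm_comp (hasFDerivAt_const _ _)).add_const _).fderiv]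
    simp
  have h1 : conn.curvature p u v = conn.dform p u v := by
    unfold curvature
    rw [structureBracket_translation, add_zero]
  refine h1.trans ((conn.dform_congr hNM.symm (hu u) (hu v)).trans
    ((conn.dform_mfderiv hOO hN hz _ _).trans ?_))
  rw [hθd, hθd]

/-- For the translation group, the curvature is the pull-back of a unique two-form on the base. -/
theorem existsUnique_isBaseCurvature [FiniteDimensional ℝ EB] [FiniteDimensional ℝ EP]
    [FiniteDimensional ℝ V] :
    ∃! F : ∀ b : B, TangentSpace 𝓘(ℝ, EB) b → TangentSpace 𝓘(ℝ, EB) b → V,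
      conn.IsBaseCurvature F := by
  have h := fun b => conn.exists_curvature_eq b
  choose O α hO hb hα hK using h
  refine ⟨fun b β₁ β₂ => fderiv ℝ (α b) (extChartAt 𝓘(ℝ, EB) b b)
      (mfderiv 𝓘(ℝ, EB) 𝓘(ℝ, EB) (extChartAt 𝓘(ℝ, EB) b) b β₁)
      (mfderiv 𝓘(ℝ, EB) 𝓘(ℝ, EB) (extChartAt 𝓘(ℝ, EB) b) b β₂) -
    fderiv ℝ (α b) (extChartAt 𝓘(ℝ, EB) b b)
      (mfderiv 𝓘(ℝ, EB) 𝓘(ℝ, EB) (extChartAt 𝓘(ℝ, EB) b) b β₂)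
      (mfderiv 𝓘(ℝ, EB) 𝓘(ℝ, EB) (extChartAt 𝓘(ℝ, EB) b) b β₁),
    fun p u v => hK (Q.proj p) p u v (mem_extChartAt_source _) (hb _), fun F hF => ?_⟩
  funext b β₁ β₂
  obtain ⟨p, rfl, hp⟩ := Q.exists_mfderiv_proj_eq b
  obtain ⟨u, rfl⟩ := hp β₁
  obtain ⟨v, rfl⟩ := hp β₂
  exact (hF p u v).symm.trans
    (hK (Q.proj p) p u v (mem_extChartAt_source _) (hb _))

variable {conn}
  {F : ∀ b : B, TangentSpace 𝓘(ℝ, EB) b → TangentSpace 𝓘(ℝ, EB) b → V}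

theorem IsBaseCurvature.exists_eq [FiniteDimensional ℝ EB] [FiniteDimensional ℝ EP]
    [FiniteDimensional ℝ V] (hF : conn.IsBaseCurvature F) (b₀ : B) :
    ∃ (O : Set EB) (α : EB → EB →L[ℝ] V), IsOpen O ∧ extChartAt 𝓘(ℝ, EB) b₀ b₀ ∈ O ∧
      ContDiffOn ℝ ∞ α O ∧
      ∀ (b : B) (β₁ β₂ : EB), b ∈ (extChartAt 𝓘(ℝ, EB) b₀).source →
        extChartAt 𝓘(ℝ, EB) b₀ b ∈ O → F b β₁ β₂ =
          fderiv ℝ α (extChartAt 𝓘(ℝ, EB) b₀ b)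
            (mfderiv 𝓘(ℝ, EB) 𝓘(ℝ, EB) (extChartAt 𝓘(ℝ, EB) b₀) b β₁)
            (mfderiv 𝓘(ℝ, EB) 𝓘(ℝ, EB) (extChartAt 𝓘(ℝ, EB) b₀) b β₂) -
          fderiv ℝ α (extChartAt 𝓘(ℝ, EB) b₀ b)
            (mfderiv 𝓘(ℝ, EB) 𝓘(ℝ, EB) (extChartAt 𝓘(ℝ, EB) b₀) b β₂)
            (mfderiv 𝓘(ℝ, EB) 𝓘(ℝ, EB) (extChartAt 𝓘(ℝ, EB) b₀) b β₁) := by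
  obtain ⟨O, α, hO, hb, hα, hK⟩ := conn.exists_curvature_eq b₀
  refine ⟨O, α, hO, hb, hα, fun b β₁ β₂ hbs hbO => ?_⟩
  obtain ⟨p, rfl, hp⟩ := Q.exists_mfderiv_proj_eq b
  obtain ⟨u, rfl⟩ := hp β₁
  obtain ⟨v, rfl⟩ := hp β₂
  exact (hF p u v).symm.trans (hK p u v hbs hbO)

theorem IsBaseCurvature.swap [FiniteDimensional ℝ EB] [FiniteDimensional ℝ EP]
    [FiniteDimensional ℝ V] (hF : conn.IsBaseCurvature F) (b : B) (β₁ β₂ : EB) :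
    F b β₁ β₂ = -F b β₂ β₁ := by
  obtain ⟨O, α, hO, hb, hα, hK⟩ := hF.exists_eq b
  rw [hK b β₁ β₂ (mem_extChartAt_source b) hb, hK b β₂ β₁ (mem_extChartAt_source b) hb, neg_sub]

/-- The integrand of the surface integral is continuous. -/
theorem IsBaseCurvature.continuousOn_square [FiniteDimensional ℝ EB] [FiniteDimensional ℝ EP]
    [FiniteDimensional ℝ V] (hF : conn.IsBaseCurvature F) {S : ℝ × ℝ → B}
    (hS : ContMDiffOn 𝓘(ℝ, ℝ × ℝ) 𝓘(ℝ, EB) ∞ S (Icc (0 : ℝ × ℝ) 1)) (a b : ℝ × ℝ) :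
    ContinuousOn (fun x => F (S x)
      (mfderivWithin 𝓘(ℝ, ℝ × ℝ) 𝓘(ℝ, EB) S (Icc 0 1) x a)
      (mfderivWithin 𝓘(ℝ, ℝ × ℝ) 𝓘(ℝ, EB) S (Icc 0 1) x b)) (Icc (0 : ℝ × ℝ) 1) := by
  intro x₀ hx₀
  obtain ⟨O, α, hO, hb, hα, hK⟩ := hF.exists_eq (S x₀)
  set ψ := extChartAt 𝓘(ℝ, EB) (S x₀) with hψ
  set K : Set (ℝ × ℝ) := Icc 0 1 with hKdef
  have hKu : UniqueDiffOn ℝ K := by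
    rw [hKdef, ← Prod.mk_zero_zero, ← Prod.mk_one_one, ← Icc_prod_Icc]
    exact uniqueDiffOn_Icc_zero_one.prod uniqueDiffOn_Icc_zero_one
  set A : Set (ℝ × ℝ) := {x | S x ∈ ψ.source ∧ ψ (S x) ∈ O} with hA
  have hAK : A ∈ 𝓝[K] x₀ := by
    have h1 := (hS x₀ hx₀).continuousWithinAt
    have h2 : ContinuousWithinAt (fun x => ψ (S x)) K x₀ :=
      (continuousAt_extChartAt (I := 𝓘(ℝ, EB)) (S x₀)).comp_continuousWithinAt h1
    filter_upwards [h1.eventually (extChartAt_source_mem_nhds (I := 𝓘(ℝ, EB)) (S x₀)),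
      h2.eventually (hO.mem_nhds hb)] with x hx hx' using ⟨hx, hx'⟩
  have hψd : ∀ x ∈ A, MDifferentiableAt 𝓘(ℝ, EB) 𝓘(ℝ, EB) ψ (S x) := fun x hx =>
    mdifferentiableAt_extChartAt (I := 𝓘(ℝ, EB)) (by simpa [hψ] using hx.1)
  have hM : ContDiffWithinAt ℝ ∞ (fun x => ψ (S x)) K x₀ := by
    rw [← contMDiffWithinAt_iff_contDiffWithinAt]
    exact contMDiffAt_extChartAt.comp_contMDiffWithinAt x₀ (hS x₀ hx₀)
  have hder : ∀ x ∈ A ∩ K, ∀ w : ℝ × ℝ, fderivWithin ℝ (fun x => ψ (S x)) K x w =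
      mfderiv 𝓘(ℝ, EB) 𝓘(ℝ, EB) ψ (S x) (mfderivWithin 𝓘(ℝ, ℝ × ℝ) 𝓘(ℝ, EB) S K x w) := by
    intro x hx w
    have h1 := (hψd x hx.1).hasMFDerivAt.comp_hasMFDerivWithinAt x
      ((hS x hx.2).mdifferentiableWithinAt (by simp)).hasMFDerivWithinAt
    have h2 : mfderivWithin 𝓘(ℝ, ℝ × ℝ) 𝓘(ℝ, EB) (fun x => ψ (S x)) K x = _ :=
      h1.mfderivWithin (hKu x hx.2).uniqueMDiffWithinAt
    rw [← mfderivWithin_eq_fderivWithin]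
    exact congrArg (fun T : ℝ × ℝ →L[ℝ] EB => T w) h2
  have hc : ContinuousWithinAt (fderivWithin ℝ (fun x => ψ (S x)) K) K x₀ :=
    (hM.fderivWithin_right (m := 0) hKu (WithTop.coe_le_coe.2 le_top) hx₀).continuousWithinAt
  have hαc : ContinuousWithinAt (fun x => fderiv ℝ α (ψ (S x))) K x₀ := by
    have h1 : ContinuousAt (fderiv ℝ α) (ψ (S x₀)) :=
      ((hα.contDiffAt (hO.mem_nhds hb)).fderiv_right (m := 0)
        (WithTop.coe_le_coe.2 le_top)).continuousAt
    exact h1.comp_continuousWithinAt (f := fun x => ψ (S x)) hM.continuousWithinAt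
  have hev : ∀ x ∈ A ∩ K, F (S x) (mfderivWithin 𝓘(ℝ, ℝ × ℝ) 𝓘(ℝ, EB) S K x a)
      (mfderivWithin 𝓘(ℝ, ℝ × ℝ) 𝓘(ℝ, EB) S K x b) =
      fderiv ℝ α (ψ (S x)) (fderivWithin ℝ (fun x => ψ (S x)) K x a)
        (fderivWithin ℝ (fun x => ψ (S x)) K x b) -
      fderiv ℝ α (ψ (S x)) (fderivWithin ℝ (fun x => ψ (S x)) K x b)
        (fderivWithin ℝ (fun x => ψ (S x)) K x a) := by
    intro x hx
    rw [hder x hx a, hder x hx b]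
    exact hK (S x) _ _ hx.1.1 hx.1.2
  refine ContinuousWithinAt.congr_of_eventuallyEq ?_
    (eventually_of_mem (inter_mem hAK self_mem_nhdsWithin) hev)
    (hev x₀ ⟨mem_of_mem_nhdsWithin hx₀ hAK, hx₀⟩)
  have hca := fun w : ℝ × ℝ => hc.clm_apply (continuousWithinAt_const (b := w))
  exact ((hαc.clm_apply (hca a)).clm_apply (hca b)).sub
    ((hαc.clm_apply (hca b)).clm_apply (hca a))

end PrincipalConnection

end Bundle

/-- Parametric integrals over the unit interval are continuous. -/
theorem continuousOn_integral_zero_one {V : Type*} [NormedAddCommGroup V] [NormedSpace ℝ V]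
    {f : ℝ × ℝ → V} (hf : ContinuousOn f (Icc (0 : ℝ × ℝ) 1)) :
    ContinuousOn (fun x => ∫ y in (0 : ℝ)..1, f (x, y)) (Icc 0 1) := by
  set κ : ℝ → ℝ := fun x => (projIcc (0 : ℝ) 1 zero_le_one x : ℝ) with hκ
  have hκc : Continuous κ := continuous_subtype_val.comp continuous_projIcc
  have hκm : ∀ x, κ x ∈ Icc (0 : ℝ) 1 := fun x => (projIcc (0 : ℝ) 1 zero_le_one x).2
  have hκe : ∀ x ∈ Icc (0 : ℝ) 1, κ x = x := fun x hx => by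
    simp only [hκ, projIcc_of_mem zero_le_one hx]
  have h1 : Continuous fun z : ℝ × ℝ => f (κ z.1, κ z.2) :=
    hf.comp_continuous ((hκc.comp continuous_fst).prodMk (hκc.comp continuous_snd))
      fun z => ⟨⟨(hκm _).1, (hκm _).1⟩, ⟨(hκm _).2, (hκm _).2⟩⟩
  have h2 : Continuous fun x => ∫ y in (0 : ℝ)..1, f (κ x, κ y) :=
    intervalIntegral.continuous_parametric_intervalIntegral_of_continuous' h1 0 1
  refine h2.continuousOn.congr fun x hx => intervalIntegral.integral_congr fun y hy => ?_
  rw [uIcc_of_le zero_le_one] at hy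
  simp only [hκe x hx, hκe y hy]

section Bundle

variable {EB : Type*} [NormedAddCommGroup EB] [NormedSpace ℝ EB]
  {B : Type*} [TopologicalSpace B] [ChartedSpace EB B]
  {EP : Type*} [NormedAddCommGroup EP] [NormedSpace ℝ EP]
  {P : Type*} [TopologicalSpace P] [ChartedSpace EP P]
  {EG : Type*} [NormedAddCommGroup EG] [NormedSpace ℝ EG]
  {G : Type*} [TopologicalSpace G] [ChartedSpace EG G] [Group G]
  {V : Type*} [NormedAddCommGroup V] [NormedSpace ℝ V]

open Filter Topology

theorem velocity_comp {f : P → B} {c : ℝ → P} {t : ℝ} (ht : t ∈ Icc (0 : ℝ) 1)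
    (hf : MDifferentiableAt 𝓘(ℝ, EP) 𝓘(ℝ, EB) f (c t))
    (hc : MDifferentiableWithinAt 𝓘(ℝ, ℝ) 𝓘(ℝ, EP) c (Icc 0 1) t) :
    (mfderiv 𝓘(ℝ, EP) 𝓘(ℝ, EB) f (c t) (velocity c t) : EB) =
      velocity (EP := EB) (fun s => f (c s)) t := by
  have h1 := hf.hasMFDerivAt.comp_hasMFDerivWithinAt t hc.hasMFDerivWithinAt
  exact congrArg (fun T : ℝ →L[ℝ] EB => T 1)
    (h1.mfderivWithin (uniqueDiffWithinAt_Icc_zero_one ht).uniqueMDiffWithinAt).symm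

theorem velocity_comp_within {K : Set (ℝ × ℝ)} {S : ℝ × ℝ → B} {l : ℝ → ℝ × ℝ} {l' : ℝ × ℝ} {t : ℝ}
    (ht : t ∈ Icc (0 : ℝ) 1) (hS : MDifferentiableWithinAt 𝓘(ℝ, ℝ × ℝ) 𝓘(ℝ, EB) S K (l t))
    (hl : HasDerivAt l l' t) (hlK : MapsTo l (Icc 0 1) K) :
    (velocity (EP := EB) (fun s => S (l s)) t : EB) =
      mfderivWithin 𝓘(ℝ, ℝ × ℝ) 𝓘(ℝ, EB) S K (l t) l' := by
  have h0 : HasMFDerivWithinAt 𝓘(ℝ, ℝ) 𝓘(ℝ, ℝ × ℝ) l (Icc 0 1) t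
      (ContinuousLinearMap.toSpanSingleton ℝ l') :=
    hl.hasDerivWithinAt.hasFDerivWithinAt.hasMFDerivWithinAt
  have h1 := hS.hasMFDerivWithinAt.comp t h0 hlK
  refine (congrArg (fun T : ℝ →L[ℝ] EB => T 1)
    (h1.mfderivWithin (uniqueDiffWithinAt_Icc_zero_one ht).uniqueMDiffWithinAt)).trans ?_
  exact congrArg (mfderivWithin 𝓘(ℝ, ℝ × ℝ) 𝓘(ℝ, EB) S K (l t))
    (toSpanSingleton_apply_one l')

theorem hasMFDerivWithinAt_reverse {c : ℝ → P} {t : ℝ}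
    (hc : MDifferentiableWithinAt 𝓘(ℝ, ℝ) 𝓘(ℝ, EP) c (Icc 0 1) (1 - t)) :
    HasMFDerivWithinAt 𝓘(ℝ, ℝ) 𝓘(ℝ, EP) (fun s => c (1 - s)) (Icc 0 1) t
      (ContinuousLinearMap.toSpanSingleton ℝ (-(velocity c (1 - t)) : EP)) := by
  have h0 : HasMFDerivWithinAt 𝓘(ℝ, ℝ) 𝓘(ℝ, ℝ) (fun s : ℝ => 1 - s) (Icc 0 1) t
      (ContinuousLinearMap.toSpanSingleton ℝ (-1 : ℝ)) :=
    ((hasDerivAt_id t).const_sub 1).hasDerivWithinAt.hasFDerivWithinAt.hasMFDerivWithinAt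
  have h1 := HasMFDerivWithinAt.comp (g := c) (f := fun s : ℝ => 1 - s) t hc.hasMFDerivWithinAt h0
    (fun s hs => ⟨by linarith [hs.2], by linarith [hs.1]⟩)
  refine hasMFDerivWithinAt_congr_deriv h1 (ContinuousLinearMap.ext_ring ?_)
  have h2 : (ContinuousLinearMap.toSpanSingleton ℝ (-1 : ℝ)) (1 : ℝ) = -1 :=
    toSpanSingleton_apply_one _
  refine (congrArg (mfderivWithin 𝓘(ℝ, ℝ) 𝓘(ℝ, EP) c (Icc 0 1) (1 - t) : ℝ →L[ℝ] EP) h2).trans ?_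
  refine (map_neg (mfderivWithin 𝓘(ℝ, ℝ) 𝓘(ℝ, EP) c (Icc 0 1) (1 - t) : ℝ →L[ℝ] EP) 1).trans ?_
  exact (toSpanSingleton_apply_one (E := EP) _).symm

namespace PrincipalConnection

variable [IsManifold 𝓘(ℝ, EP) ∞ P]

section General

variable {Q : PrincipalBundle EB B EP P EG G} {conn : PrincipalConnection Q}

theorem IsHorizontalLift.reverse {γ : ℝ → B} {c : ℝ → P} (hc : conn.IsHorizontalLift γ c) :
    conn.IsHorizontalLift (fun t => γ (1 - t)) (fun t => c (1 - t)) := by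
  have hm : ∀ t ∈ Icc (0 : ℝ) 1, 1 - t ∈ Icc (0 : ℝ) 1 := fun t ht =>
    ⟨by linarith [ht.2], by linarith [ht.1]⟩
  refine ⟨fun t ht => hc.1 _ (hm t ht), fun t ht =>
    (hasMFDerivWithinAt_reverse (hc.2 _ (hm t ht))).mdifferentiableWithinAt, fun t ht => ?_⟩
  have h1 : (velocity (fun t => c (1 - t)) t : EP) = -(velocity c (1 - t) : EP) :=
    (congrArg (fun T : ℝ →L[ℝ] EP => T 1)
      ((hasMFDerivWithinAt_reverse (hc.2 _ (hm t ht))).mfderivWithin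
        (uniqueDiffWithinAt_Icc_zero_one ht).uniqueMDiffWithinAt)).trans
      (toSpanSingleton_apply_one (E := EP) _)
  refine (congrArg (conn.form (c (1 - t))) h1).trans ?_
  refine (map_neg (conn.form (c (1 - t))) _).trans ?_
  rw [hc.3 _ (hm t ht), neg_zero]

theorem isHorizontalLift_const (p : P) :
    conn.IsHorizontalLift (fun _ => Q.proj p) (fun _ => p) := by
  refine ⟨fun _ _ => rfl, fun _ _ => mdifferentiableWithinAt_const, fun t _ => ?_⟩
  have hv : (velocity (fun _ : ℝ => p) t : EP) = 0 := by
    unfold velocity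
    rw [mfderivWithin_const]
    rfl
  exact (congrArg (conn.form p) hv).trans (map_zero _)

theorem IsHorizontalLift.congr_path {γ δ : ℝ → B} {c : ℝ → P} (hc : conn.IsHorizontalLift γ c)
    (h : EqOn γ δ (Icc 0 1)) : conn.IsHorizontalLift δ c :=
  ⟨fun t ht => (hc.1 t ht).trans (h ht), hc.2, hc.3⟩

end General

variable [IsManifold 𝓘(ℝ, EB) ∞ B] [FiniteDimensional ℝ EB] [FiniteDimensional ℝ EP]
  [FiniteDimensional ℝ V] {Q : PrincipalBundle EB B EP P V (Multiplicative V)}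
  {conn : PrincipalConnection Q}
  {F : ∀ b : B, TangentSpace 𝓘(ℝ, EB) b → TangentSpace 𝓘(ℝ, EB) b → V}

/-- The holonomy around a square is minus the integral of the curvature. -/
theorem IsBaseCurvature.square_holonomy (hF : conn.IsBaseCurvature F) {S : ℝ × ℝ → B}
    (hS : ContMDiffOn 𝓘(ℝ, ℝ × ℝ) 𝓘(ℝ, EB) ∞ S (Icc (0 : ℝ × ℝ) 1)) {c₀ c₁ d₀ d₁ : ℝ → P}
    (hc₀ : conn.IsHorizontalLift (fun t => S (t, 0)) c₀)
    (hd₁ : conn.IsHorizontalLift (fun t => S (1, t)) d₁) (h₁ : d₁ 0 = c₀ 1)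
    (hd₀ : conn.IsHorizontalLift (fun t => S (0, t)) d₀) (h₀ : d₀ 0 = c₀ 0)
    (hc₁ : conn.IsHorizontalLift (fun t => S (t, 1)) c₁) (h₀₁ : c₁ 0 = d₀ 1) :
    c₁ 1 = Q.act (d₁ 1) (Multiplicative.ofAdd (∫ x in (0 : ℝ)..1, ∫ y in (0 : ℝ)..1, F (S (x, y))
      (mfderivWithin 𝓘(ℝ, ℝ × ℝ) 𝓘(ℝ, EB) S (Icc 0 1) (x, y) ((1, 0) : ℝ × ℝ))
      (mfderivWithin 𝓘(ℝ, ℝ × ℝ) 𝓘(ℝ, EB) S (Icc 0 1) (x, y) ((0, 1) : ℝ × ℝ)))) := by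
  have m0 : (0 : ℝ) ∈ Icc (0 : ℝ) 1 := left_mem_Icc.2 zero_le_one
  have m1 : (1 : ℝ) ∈ Icc (0 : ℝ) 1 := right_mem_Icc.2 zero_le_one
  have mk : ∀ {x y : ℝ}, x ∈ Icc (0 : ℝ) 1 → y ∈ Icc (0 : ℝ) 1 → (x, y) ∈ Icc (0 : ℝ × ℝ) 1 :=
    fun hx hy => ⟨⟨hx.1, hy.1⟩, ⟨hx.2, hy.2⟩⟩
  have : CompleteSpace V := FiniteDimensional.complete ℝ V
  have hu : ContMDiffOn 𝓘(ℝ, ℝ × ℝ) 𝓘(ℝ, EB) ∞ (fun z : ℝ × ℝ => S (z.2, z.1))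
      (Icc 0 1 ×ˢ Icc 0 1) :=
    hS.comp (contDiff_snd.prodMk contDiff_fst).contMDiff.contMDiffOn fun z hz => mk hz.2 hz.1
  have hex : ∀ t ∈ Icc (0 : ℝ) 1, ∃ c, conn.IsHorizontalLift (fun r => S (t, r)) c ∧ c 0 = c₀ t :=
    fun t ht => conn.exists_isHorizontalLift (hS.comp (f := fun r : ℝ => (t, r))
      (ContDiff.contMDiff (by fun_prop)).contMDiffOn fun r hr => mk ht hr) m0 (hc₀.1 t ht)
  have : Nonempty P := ⟨c₀ 0⟩
  choose! Φ hΦ hΦ0 using hex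
  have hev : ∀ t ∈ Icc (0 : ℝ) 1, (fun t => Φ t 0) =ᶠ[𝓝[Icc 0 1] t] c₀ := fun t _ => by
    filter_upwards [self_mem_nhdsWithin] with s hs using hΦ0 s hs
  have key := fun t (ht : t ∈ Icc (0 : ℝ) 1) =>
    conn.form_velocity_eq_integral_curvature (Φ := fun r t => Φ t r) hu hΦ ht
      ((hc₀.2 t ht).congr_of_eventuallyEq (hev t ht) (hΦ0 t ht))
      ((form_velocity_congr ht (hev t ht)).trans (hc₀.3 t ht))
  set f : ℝ × ℝ → V := fun z => F (S z)
      (mfderivWithin 𝓘(ℝ, ℝ × ℝ) 𝓘(ℝ, EB) S (Icc 0 1) z ((1, 0) : ℝ × ℝ))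
      (mfderivWithin 𝓘(ℝ, ℝ × ℝ) 𝓘(ℝ, EB) S (Icc 0 1) z ((0, 1) : ℝ × ℝ)) with hf
  have hfc : ContinuousOn f (Icc (0 : ℝ × ℝ) 1) := hF.continuousOn_square hS _ _
  have hint : ∀ t ∈ Icc (0 : ℝ) 1, conn.form (Φ t 1) (velocity (fun t => Φ t 1) t) =
      -∫ y in (0 : ℝ)..1, f (t, y) := by
    intro t ht
    rw [(key t ht).2, ← intervalIntegral.integral_neg]
    refine intervalIntegral.integral_congr fun r hr => ?_
    rw [uIcc_of_le zero_le_one] at hr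
    have hπ := (Q.contMDiff_proj.mdifferentiable (n := ∞) (by simp)) (Φ t r)
    have hSd := (hS _ (mk ht hr)).mdifferentiableWithinAt (by simp)
    have e1 : (mfderiv 𝓘(ℝ, EP) 𝓘(ℝ, EB) Q.proj (Φ t r) (velocity (fun s => Φ t s) r) : EB) =
        mfderivWithin 𝓘(ℝ, ℝ × ℝ) 𝓘(ℝ, EB) S (Icc 0 1) (t, r) ((0, 1) : ℝ × ℝ) := by
      refine (velocity_comp hr hπ ((hΦ t ht).2 r hr)).trans ((velocity_congr
        (d := fun s => S (t, s)) hr ?_).trans (velocity_comp_within (l := fun s : ℝ => (t, s)) hr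
          hSd ((hasDerivAt_const r t).prodMk (hasDerivAt_id r)) fun s hs => mk ht hs))
      filter_upwards [self_mem_nhdsWithin] with s hs using (hΦ t ht).1 s hs
    have e2 : (mfderiv 𝓘(ℝ, EP) 𝓘(ℝ, EB) Q.proj (Φ t r) (velocity (fun s => Φ s r) t) : EB) =
        mfderivWithin 𝓘(ℝ, ℝ × ℝ) 𝓘(ℝ, EB) S (Icc 0 1) (t, r) ((1, 0) : ℝ × ℝ) := by
      refine (velocity_comp (c := fun s => Φ s r) ht hπ ((key t ht).1 r hr)).trans ((velocity_congr
        (d := fun s => S (s, r)) ht ?_).trans (velocity_comp_within (l := fun s : ℝ => (s, r)) ht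
          hSd ((hasDerivAt_id t).prodMk (hasDerivAt_const t r)) fun s hs => mk hs hr))
      filter_upwards [self_mem_nhdsWithin] with s hs using (hΦ s hs).1 r hr
    have e3 : ∀ {b b' : B} (_ : b = b') {β₁ β₂ β₁' β₂' : EB} (_ : β₁ = β₁') (_ : β₂ = β₂'),
        F b β₁ β₂ = F b' β₁' β₂' := by rintro b _ rfl β₁ β₂ _ _ rfl rfl; rfl
    exact (hF (Φ t r) _ _).trans ((e3 ((hΦ t ht).1 r hr) e1 e2).trans (hF.swap _ _ _))
  have hex1 := (conn.exists_isHorizontalLift_iff_isPathOrderedExp (γ := fun t => S (t, 1))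
    (d := fun t => Φ t 1) (a := fun t => ∫ y in (0 : ℝ)..1, f (t, y))
    (h := Multiplicative.ofAdd (∫ x in (0 : ℝ)..1, ∫ y in (0 : ℝ)..1, f (x, y)))
    (fun t ht => (hΦ t ht).1 1 m1) (fun t ht => (key t ht).1 1 m1) hint).2
    (isPathOrderedExp_translation (continuousOn_integral_zero_one hfc))
  obtain ⟨c, hc, hc0, hc1⟩ := hex1
  have e0 : Φ 0 1 = d₀ 1 := (hΦ 0 m0).eqOn hd₀ m0 ((hΦ0 0 m0).trans h₀.symm) m1
  have e1 : Φ 1 1 = d₁ 1 := (hΦ 1 m1).eqOn hd₁ m0 ((hΦ0 1 m1).trans h₁.symm) m1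
  rw [← e1, ← hc1]
  exact hc₁.eqOn hc m0 (h₀₁.trans (e0.symm.trans hc0.symm)) m1

end PrincipalConnection

end Bundle

section Bundle

variable {EB : Type*} [NormedAddCommGroup EB] [NormedSpace ℝ EB]
  {B : Type*} [TopologicalSpace B] [ChartedSpace EB B]
  {EP : Type*} [NormedAddCommGroup EP] [NormedSpace ℝ EP]
  {P : Type*} [TopologicalSpace P] [ChartedSpace EP P]
  {V : Type*} [NormedAddCommGroup V] [NormedSpace ℝ V]

theorem PrincipalBundle.exists_eq_act {Q : PrincipalBundle EB B EP P V (Multiplicative V)}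
    {s : B → P} (hs : ∀ b, Q.proj (s b) = b) (p : P) :
    ∃ v : V, p = Q.act (s (Q.proj p)) (Multiplicative.ofAdd v) := by
  obtain ⟨g, hg⟩ := Q.exists_act (hs (Q.proj p))
  exact ⟨g.toAdd, hg.symm⟩

namespace PrincipalConnection

variable [IsManifold 𝓘(ℝ, EP) ∞ P]
  {Q : PrincipalBundle EB B EP P V (Multiplicative V)} (conn : PrincipalConnection Q)

/-- The displacement of the horizontal lift of an edge relative to reference points `s` in the
fibres; it is zero if the edge has no horizontal lift. -/
def edgeHolonomy (s : B → P) (e : unitInterval → B) : V :=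
  open Classical in
  if h : ∃ v : V, ∃ c, conn.IsHorizontalLift (IccExtend zero_le_one e) c ∧ c 0 = s (e 0) ∧
    c 1 = Q.act (s (e 1)) (Multiplicative.ofAdd v) then h.choose else 0

variable {conn} {s : B → P}

theorem edgeHolonomy_eq {e : unitInterval → B} {c : ℝ → P} {v w : V}
    (hc : conn.IsHorizontalLift (IccExtend zero_le_one e) c)
    (h0 : c 0 = Q.act (s (e 0)) (Multiplicative.ofAdd v))
    (h1 : c 1 = Q.act (s (e 1)) (Multiplicative.ofAdd w)) : conn.edgeHolonomy s e = w - v := by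
  have hc' := hc.act (Multiplicative.ofAdd (-v))
  have h0' : Q.act (c 0) (Multiplicative.ofAdd (-v)) = s (e 0) := by
    rw [h0, ← Q.act_mul, ← ofAdd_add, add_neg_cancel, ofAdd_zero, Q.act_one]
  have h1' : Q.act (c 1) (Multiplicative.ofAdd (-v)) =
      Q.act (s (e 1)) (Multiplicative.ofAdd (w - v)) := by
    rw [h1, ← Q.act_mul, ← ofAdd_add, sub_eq_add_neg]
  have h : ∃ v : V, ∃ c, conn.IsHorizontalLift (IccExtend zero_le_one e) c ∧ c 0 = s (e 0) ∧
    c 1 = Q.act (s (e 1)) (Multiplicative.ofAdd v) := ⟨w - v, _, hc', h0', h1'⟩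
  rw [edgeHolonomy, dif_pos h]
  obtain ⟨d, hd, hd0, hd1⟩ := h.choose_spec
  have h2 := hd.eqOn hc' (left_mem_Icc.2 zero_le_one) (hd0.trans h0'.symm)
    (right_mem_Icc.2 zero_le_one)
  exact Multiplicative.ofAdd.injective (Q.act_left_cancel (hd1.symm.trans (h2.trans h1')))

theorem edgeHolonomy_restrict_eq {γ : ℝ → B} {c : ℝ → P} {v w : V}
    (hc : conn.IsHorizontalLift γ c) (h0 : c 0 = Q.act (s (γ 0)) (Multiplicative.ofAdd v))
    (h1 : c 1 = Q.act (s (γ 1)) (Multiplicative.ofAdd w)) :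
    conn.edgeHolonomy s (fun t => γ t) = w - v :=
  edgeHolonomy_eq (hc.congr_path fun _ ht => (IccExtend_of_mem zero_le_one
    (fun t : unitInterval => γ t) ht).symm) h0 h1

theorem IsHorizontalLift.exists_eq_act {γ : ℝ → B} {c : ℝ → P} (hs : ∀ b, Q.proj (s b) = b)
    (hc : conn.IsHorizontalLift γ c) {t : ℝ} (ht : t ∈ Icc (0 : ℝ) 1) :
    ∃ v : V, c t = Q.act (s (γ t)) (Multiplicative.ofAdd v) := by
  rw [← hc.1 t ht]
  exact PrincipalBundle.exists_eq_act hs (c t)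

theorem edgeHolonomy_add_symm (hs : ∀ b, Q.proj (s b) = b) (e : unitInterval → B) :
    conn.edgeHolonomy s e + conn.edgeHolonomy s (fun t => e (unitInterval.symm t)) = 0 := by
  have hrev : ∀ {e : unitInterval → B} {c : ℝ → P},
      conn.IsHorizontalLift (IccExtend zero_le_one e) c →
      conn.IsHorizontalLift (IccExtend zero_le_one fun t => e (unitInterval.symm t))
        (fun t => c (1 - t)) := by
    intro e c hc
    refine hc.reverse.congr_path fun t ht => ?_
    have ht' : 1 - t ∈ Icc (0 : ℝ) 1 := ⟨by linarith [ht.2], by linarith [ht.1]⟩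
    simp only [IccExtend_of_mem zero_le_one _ ht, IccExtend_of_mem zero_le_one _ ht']
    rfl
  by_cases h : ∃ c, conn.IsHorizontalLift (IccExtend zero_le_one e) c
  · obtain ⟨c, hc⟩ := h
    obtain ⟨v, hv⟩ := hc.exists_eq_act hs (left_mem_Icc.2 zero_le_one)
    obtain ⟨w, hw⟩ := hc.exists_eq_act hs (right_mem_Icc.2 zero_le_one)
    rw [IccExtend_left] at hv
    rw [IccExtend_right] at hw
    rw [edgeHolonomy_eq hc hv hw, edgeHolonomy_eq (v := w) (w := v) (hrev hc)
      (by simp only [sub_zero, unitInterval.symm_zero]; exact hw)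
      (by simp only [sub_self, unitInterval.symm_one]; exact hv)]
    abel
  · have h' : ¬∃ c, conn.IsHorizontalLift
        (IccExtend zero_le_one fun t => e (unitInterval.symm t)) c := by
      rintro ⟨c, hc⟩
      have h2 := hrev hc
      simp only [unitInterval.symm_symm] at h2
      exact h ⟨_, h2⟩
    rw [edgeHolonomy, edgeHolonomy, dif_neg, dif_neg, add_zero]
    · rintro ⟨v, c, hc, -⟩; exact h' ⟨c, hc⟩
    · rintro ⟨v, c, hc, -⟩; exact h ⟨c, hc⟩

theorem edgeHolonomy_const (hs : ∀ b, Q.proj (s b) = b) (b : B) :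
    conn.edgeHolonomy s (fun _ => b) = 0 := by
  have h1 := isHorizontalLift_const (conn := conn) (s b)
  rw [hs] at h1
  have h2 := edgeHolonomy_restrict_eq (s := s) (v := 0) (w := 0) h1 (by simp [Q.act_one])
    (by simp [Q.act_one])
  simpa using h2

variable (conn) in
/-- The displacement along a one-chain. -/
def chainHolonomy (s : B → P) : ((unitInterval → B) →₀ ℤ) →+ V :=
  Finsupp.liftAddHom fun e => zmultiplesHom V (conn.edgeHolonomy s e)

theorem chainHolonomy_single (e : unitInterval → B) :
    conn.chainHolonomy s (Finsupp.single e 1) = conn.edgeHolonomy s e := by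
  simp [chainHolonomy]

theorem chainHolonomy_eq_zero (hs : ∀ b, Q.proj (s b) = b) {z : (unitInterval → B) →₀ ℤ}
    (hz : z ∈ trivialEdgeChains B) : conn.chainHolonomy s z = 0 := by
  have h : trivialEdgeChains B ≤ (conn.chainHolonomy s).ker := by
    refine (AddSubgroup.closure_le _).2 ?_
    rintro _ (⟨e, rfl⟩ | ⟨b, rfl⟩)
    · simp only [SetLike.mem_coe, AddMonoidHom.mem_ker, map_add, chainHolonomy_single]
      exact edgeHolonomy_add_symm hs e
    · simp only [SetLike.mem_coe, AddMonoidHom.mem_ker, chainHolonomy_single]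
      exact edgeHolonomy_const hs b
  exact h hz

variable [IsManifold 𝓘(ℝ, EB) ∞ B] [FiniteDimensional ℝ EB] [FiniteDimensional ℝ EP]
  [FiniteDimensional ℝ V]
  {F : ∀ b : B, TangentSpace 𝓘(ℝ, EB) b → TangentSpace 𝓘(ℝ, EB) b → V}

theorem IsBaseCurvature.chainHolonomy_boundary (hF : conn.IsBaseCurvature F)
    (hs : ∀ b, Q.proj (s b) = b) (S : SurfaceChain EB B) :
    conn.chainHolonomy s S.boundary = -S.integral F := by
  have m0 : (0 : ℝ) ∈ Icc (0 : ℝ) 1 := left_mem_Icc.2 zero_le_one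
  have m1 : (1 : ℝ) ∈ Icc (0 : ℝ) 1 := right_mem_Icc.2 zero_le_one
  unfold SurfaceChain.boundary SurfaceChain.integral
  rw [map_sum, ← Finset.sum_neg_distrib]
  refine Finset.sum_congr rfl fun i _ => ?_
  rw [map_zsmul, ← smul_neg]
  congr 1
  have hS := S.contMDiffOn_square i
  simp only [map_add, map_sub, edgeChain, chainHolonomy_single]
  have hx : ∀ a ∈ Icc (0 : ℝ) 1, ContMDiffOn 𝓘(ℝ, ℝ) 𝓘(ℝ, EB) ∞
      (fun t => S.square i (t, a)) (Icc 0 1) := fun a ha =>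
    hS.comp (f := fun t : ℝ => (t, a)) (ContDiff.contMDiff (by fun_prop)).contMDiffOn
      fun t ht => ⟨⟨ht.1, ha.1⟩, ⟨ht.2, ha.2⟩⟩
  have hy : ∀ a ∈ Icc (0 : ℝ) 1, ContMDiffOn 𝓘(ℝ, ℝ) 𝓘(ℝ, EB) ∞
      (fun t => S.square i (a, t)) (Icc 0 1) := fun a ha =>
    hS.comp (f := fun t : ℝ => (a, t)) (ContDiff.contMDiff (by fun_prop)).contMDiffOn
      fun t ht => ⟨⟨ha.1, ht.1⟩, ⟨ha.2, ht.2⟩⟩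
  obtain ⟨c₀, hc₀, hc₀0⟩ := conn.exists_isHorizontalLift (hx 0 m0) m0 (hs _)
  obtain ⟨d₁, hd₁, hd₁0⟩ := conn.exists_isHorizontalLift (hy 1 m1) m0 (hc₀.1 1 m1)
  obtain ⟨d₀, hd₀, hd₀0⟩ := conn.exists_isHorizontalLift (hy 0 m0) m0 (hs _)
  obtain ⟨c₁, hc₁, hc₁0⟩ := conn.exists_isHorizontalLift (hx 1 m1) m0 (hd₀.1 1 m1)
  obtain ⟨v, hv⟩ := hc₀.exists_eq_act hs m1
  obtain ⟨w, hw⟩ := hd₁.exists_eq_act hs m1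
  obtain ⟨x, hxx⟩ := hd₀.exists_eq_act hs m1
  have key := hF.square_holonomy hS hc₀ hd₁ hd₁0 hd₀ (hd₀0.trans hc₀0.symm) hc₁ hc₁0
  rw [hw, ← Q.act_mul, ← ofAdd_add] at key
  have e1 : ∀ p : P, p = Q.act p (Multiplicative.ofAdd (0 : V)) := fun p => by
    rw [ofAdd_zero, Q.act_one]
  rw [edgeHolonomy_restrict_eq hc₀ (hc₀0.trans (e1 _)) hv,
    edgeHolonomy_restrict_eq hd₁ (hd₁0.trans hv) hw,
    edgeHolonomy_restrict_eq hd₀ (hd₀0.trans (e1 _)) hxx,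
    edgeHolonomy_restrict_eq hc₁ (hc₁0.trans hxx) key]
  abel

/-- For the translation group, the holonomy of the boundary of a surface is minus the integral of
the curvature. -/
theorem IsBaseCurvature.isHolonomy_iff (hF : conn.IsBaseCurvature F) {γ : ℝ → B}
    (hγ : ContMDiffOn 𝓘(ℝ, ℝ) 𝓘(ℝ, EB) ∞ γ (Icc 0 1)) (h01 : γ 0 = γ 1) {S : SurfaceChain EB B}
    (hS : S.Bounds γ) {p₀ : P} (hp : Q.proj p₀ = γ 0) (h : Multiplicative V) :
    conn.IsHolonomy γ p₀ h ↔ h = Multiplicative.ofAdd (-S.integral F) := by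
  have hex : ∀ b, ∃ p, Q.proj p = b := fun b => (Q.exists_mfderiv_proj_eq b).imp fun _ h => h.1
  choose s hs using hex
  obtain ⟨g, hg, hgu⟩ := conn.existsUnique_isHolonomy hγ h01 hp
  have hgS : g = Multiplicative.ofAdd (-S.integral F) := by
    obtain ⟨c, hc, hc0, hc1⟩ := hg
    obtain ⟨v, hv⟩ := PrincipalBundle.exists_eq_act hs p₀
    rw [hp] at hv
    have h1 : c 1 = Q.act (s (γ 1)) (Multiplicative.ofAdd (v + g.toAdd)) := by
      rw [hc1, ← h01, ofAdd_add, Q.act_mul, ← hv]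
      rfl
    have h2 := edgeHolonomy_restrict_eq hc (hc0.trans hv) h1
    have h3 := chainHolonomy_eq_zero (conn := conn) hs hS
    rw [map_sub, hF.chainHolonomy_boundary hs, edgeChain, chainHolonomy_single, h2,
      add_sub_cancel_left, sub_eq_zero] at h3
    rw [h3]
    rfl
  rw [← hgS]
  exact ⟨hgu h, fun e => e ▸ hg⟩

end PrincipalConnection

end Bundle

end

theorem mainTheorem8
    {EB : Type*} [NormedAddCommGroup EB] [NormedSpace ℝ EB] [FiniteDimensional ℝ EB]
    {B : Type*} [TopologicalSpace B] [T2Space B] [ChartedSpace EB B] [IsManifold 𝓘(ℝ, EB) ∞ B]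
    {EP : Type*} [NormedAddCommGroup EP] [NormedSpace ℝ EP] [FiniteDimensional ℝ EP]
    {P : Type*} [TopologicalSpace P] [T2Space P] [ChartedSpace EP P] [IsManifold 𝓘(ℝ, EP) ∞ P] :
    -- general structure group, disc-shaped surface: `Hol(γ, p₀) = P exp (- ∫_S R)`
    (∀ {EG : Type*} [NormedAddCommGroup EG] [NormedSpace ℝ EG] [FiniteDimensional ℝ EG]
      {G : Type*} [TopologicalSpace G] [T2Space G] [ChartedSpace EG G] [Group G]
      [LieGroup 𝓘(ℝ, EG) ∞ G]
      (Q : PrincipalBundle EB B EP P EG G) (conn : PrincipalConnection Q)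
      (f : ℂ → B) (_ : ContMDiffOn 𝓘(ℝ, ℂ) 𝓘(ℝ, EB) ∞ f (Metric.closedBall 0 1))
      (γ : ℝ → B)
      (_ : ∀ t ∈ Icc (0 : ℝ) 1, γ t = f (Complex.exp (2 * Real.pi * t * Complex.I)))
      (p₀ : P) (_ : Q.proj p₀ = γ 0),
      (∃! h : G, conn.IsHolonomy γ p₀ h) ∧
        ∀ h : G, conn.IsHolonomy γ p₀ h ↔ conn.IsSurfaceOrderedExp f p₀ h) ∧
    -- structure group `(ℝⁿ⁺¹, +)`, arbitrary surface: `Hol(γ, p₀) = - ∫_S R`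
    (∀ (n : ℕ)
      (Q : PrincipalBundle EB B EP P (EuclideanSpace ℝ (Fin (n + 1)))
        (Multiplicative (EuclideanSpace ℝ (Fin (n + 1)))))
      (conn : PrincipalConnection Q),
      (∃! F : ∀ b : B, TangentSpace 𝓘(ℝ, EB) b → TangentSpace 𝓘(ℝ, EB) b →
          EuclideanSpace ℝ (Fin (n + 1)), conn.IsBaseCurvature F) ∧
        ∀ F : ∀ b : B, TangentSpace 𝓘(ℝ, EB) b → TangentSpace 𝓘(ℝ, EB) b →
            EuclideanSpace ℝ (Fin (n + 1)), conn.IsBaseCurvature F →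
          ∀ (γ : ℝ → B) (_ : ContMDiffOn 𝓘(ℝ, ℝ) 𝓘(ℝ, EB) ∞ γ (Icc 0 1)) (_ : γ 0 = γ 1)
            (S : SurfaceChain EB B) (_ : S.Bounds γ) (p₀ : P) (_ : Q.proj p₀ = γ 0)
            (h : Multiplicative (EuclideanSpace ℝ (Fin (n + 1)))),
            conn.IsHolonomy γ p₀ h ↔ h = Multiplicative.ofAdd (-S.integral F)) := by
  refine ⟨?_, ?_⟩
  · intro EG _ _ _ G _ _ _ _ _ Q conn f hf γ hγ p₀ hp
    exact conn.isHolonomy_iff_isSurfaceOrderedExp hf hγ hp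
  · intro n Q conn
    exact ⟨conn.existsUnique_isBaseCurvature, fun F hF γ hγ h01 S hS p₀ hp h =>
      hF.isHolonomy_iff hγ h01 hS hp h⟩
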